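/- Let $P_1(X)=X^8-X^5-X^4-X^3+1$. There is a unique real number $\alpha<-1$ with $P_1(-\alpha)=0$, i.e. $\alpha^8+\alpha^5-\alpha^4+\alpha^3+1=0$; its absolute value $|\alpha|\approx 1.28064$ is the largest real root of $P_1$. Let $(a_0,\dots,a_7)$ stand for $\sum_{i=0}^7 a_i\alpha^i$ and put $$\begin{array}{ll} \lambda_1=(0,1,-2,1,-1,0,1,-1)&\tau_1=(-1,0,0,0,0,-1,0,0)\\ \lambda_2=(0,-1,1,0,1,0,-1,0)&\tau_2=(0,0,-1,1,0,1,0,-1)\\ \lambda_3=(-1,0,-1,0,0,-1,0,0)&\tau_3=(0,0,-1,0,-1,0,0,-1)\\ \lambda_4=(-1,2,-1,1,0,-1,1,0)&\tau_4=(0,1,0,0,0,0,1,0)\\ \lambda_5=(1,-1,1,0,0,1,0,0)&\tau_5=(0,0,0,1,0,0,0,0)\\ \lambda_6=(-1,1,-1,1,-1,-1,0,-1)&\tau_6=(0,0,-1,0,0,0,1,0)\\ \lambda_7=(1,-2,2,-2,1,1,-1,1)&\tau_7=(0,0,0,0,0,0,-1,0)\\ \lambda_8=(0,0,1,-1,1,0,0,1)&\tau_8=(0,1,0,0,0,0,0,0)\\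 \lambda_9=(1,0,0,0,0,0,0,0)&\tau_9=(-1,0,0,0,0,0,0,0) \end{array}$$ and $\zeta_j=\lambda_j+\mathrm{i}\,\tau_j\in\mathbb C=\mathbb R^2$. Let $\pi$ be the permutation with $(\pi^{-1}(1),\dots,\pi^{-1}(9))=(5,3,9,8,6,2,7,1,4)$. Then $0\text{-}1\text{-}0\text{-}0\text{-}1\text{-}1\text{-}1\text{-}0\text{-}1\text{-}0\text{-}0\text{-}1\text{-}0\text{-}0$ is a closed Rauzy path based at $\pi$; the product of its transition matrices is $$R=\left(\begin{smallmatrix} 1&1&0&0&0&0&0&0&0\\ 0&0&1&1&1&1&1&1&0\\ 0&0&0&0&0&1&0&1&1\\ 1&0&0&1&0&0&1&0&0\\ 0&0&1&0&1&0&0&0&0\\ 0&0&0&1&1&0&0&0&0\\ 0&0&0&0&0&1&1&0&0\\ 1&0&0&0&0&1&1&1&0\\ 1&1&0&1&0&0&1&0&0 \end{smallmatrix}\right),$$ $R\lambda=\alpha^4\lambda$ where $\alpha^4$ is the Perron eigenvalue of $R$ (all complex eigenvalues have modulus at most $\alpha^4$, and $\lambda>0$), $R\tau=\alpha^{-4}\tau$,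 and $\zeta$ is a suspension datum for $(\pi,\lambda)$: $\mathrm{Im}\sum_{j\le k}\zeta_j>0>\mathrm{Im}\sum_{j\le k}\zeta_{\pi^{-1}(j)}$ for $1\le k\le 8$. Let $M=M(\pi,\zeta)$ be the translation surface obtained from the closed polygon bounded by the broken lines from $0$ with successive edges $\zeta_1,\dots,\zeta_9$ (top) and $\zeta_{\pi^{-1}(1)},\dots,\zeta_{\pi^{-1}(9)}$ (bottom) by gluing, for each $j$, the two sides $\zeta_j$ by a translation. It is a compact connected translation surface of genus $4$, and the vertices of the polygon give exactly two points of $M$, with cone angles $4\pi$ and $12\pi$. Let $A=\left(\begin{smallmatrix}\alpha^{-1}&0\\0&\alpha\end{smallmatrix}\right)$ and let $M'=A\cdot M$ be the surface obtained in the same way from the image of the polygon under $A$. Number the vertices of the polygon of $M$ by $p_1=0,p_2,\dots,p_{10}$ (top, left to right) and $p_{11},\dots,p_{18}$ (the remaining bottom vertices, right to left), and put $q_i=Ap_i$. **Theorem.** $M'$ and $M$ are isometric as translation surfaces: there is a homeomorphism $h:M'\to M$ that preserves the flat distance, maps vertices to vertices and is a translation in the charts of the translation structures off the vertices. It is obtained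 by cutting the polygon of $M'$ into the following $8$ pieces (polygons with the listed vertices, with disjoint interiors) and translating each of them onto the piece of the polygon of $M$ on the same line, with vertices corresponding in the listed order: $$\begin{array}{clcl} 1:&q_8q_{14}q_3q_4q_6&\to&p_1p_2p_3p_{17}p_{18}\\ 2:&q_{18}q_1q_{17}&\to&p_3p_{16}p_{17}\\ 3:&q_6q_4q_5&\to&p_3p_4p_{16}\\ 4:&q_{11}q_{12}q_{13}q_9q_{10}&\to&p_4p_5p_{14}p_{15}p_{16}\\ 5:&q_8q_6q_7&\to&p_5p_6p_{14}\\ 6:&q_{15}q_{16}q_{17}q_1q_2q_3q_{14}&\to&p_6p_8p_9p_{10}p_{11}p_{13}p_{14}\\ 7:&q_9q_{13}q_8&\to&p_6p_7p_8\\ 8:&q_{14}q_8q_{13}&\to&p_{11}p_{12}p_{13} \end{array}$$ **Corollary.** There is an affine pseudo-Anosov map $f:M\to M$ (a homeomorphism permuting the conical points, differentiable off them with constant derivative of determinant $1$ and trace of absolute value $>2$) with $Df=A$; its dilatation, the absolute value of the expanding eigenvalue of $Df$, is $|\alpha|$. -/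

import Mathlib

open Polynomial
open scoped ENNReal Topology

noncomputable section

/-! ## Polygons in the plane -/

/-- The union of all vertical segments joining two points of `S`. If `S` is the boundary of a
polygon that meets every vertical line in a segment or in the empty set, this is the closed
polygonal region bounded by `S`. -/
def verticalHull (S : Set ℂ) : Set ℂ :=
  {z | ∃ a ∈ S, ∃ b ∈ S, a.re = z.re ∧ b.re = z.re ∧ a.im ≤ z.im ∧ z.im ≤ b.im}

/-- The closed broken line through the points of `l`, in this order. -/
def closedBrokenLine (l : List ℂ) : Set ℂ :=
  {z | ∃ e ∈ l.zip (l.rotate 1), z ∈ segment ℝ e.1 e.2}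

/-- The closed polygonal region with vertices `l` (for polygons that meet every vertical line in
a segment or in the empty set). -/
def polygonRegion (l : List ℂ) : Set ℂ := verticalHull (closedBrokenLine l)

/-! ## Surfaces obtained from a plane region by gluing sides by translations -/

/-- A plane region together with `n` pairs of parallel sides: the `j`-th pair consists of the
segments from `startA j` to `startA j + vec j` and from `startB j` to `startB j + vec j`. -/
structure PolygonGluing (n : ℕ) where
  region : Set ℂ
  startA : Fin n → ℂ
  startB : Fin n → ℂ
  vec : Fin n → ℂ

namespace PolygonGluing

variable {n : ℕ} (G : PolygonGluing n)

/-- `x` lies on the first side of some pair, and `y` is the corresponding point (under the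
translation) of the second side. -/
def sideRel (x y : G.region) : Prop :=
  ∃ j, ∃ t ∈ Set.Icc (0 : ℝ) 1,
    (x : ℂ) = G.startA j + t * G.vec j ∧ (y : ℂ) = G.startB j + t * G.vec j

def glueSetoid : Setoid G.region := Relation.EqvGen.setoid G.sideRel

/-- The surface: the region with paired sides identified by translation (quotient topology). -/
def Surface : Type := Quotient G.glueSetoid

instance : TopologicalSpace G.Surface := inferInstanceAs (TopologicalSpace (Quotient G.glueSetoid))

def toSurface (x : G.region) : G.Surface := Quotient.mk G.glueSetoid x

/-- The points of the surface that come from end points of sides. -/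
def vertices : Set G.Surface :=
  {s | ∃ x : G.region, G.toSurface x = s ∧ ∃ j, (x : ℂ) ∈
    ({G.startA j, G.startA j + G.vec j, G.startB j, G.startB j + G.vec j} : Set ℂ)}

/-- The surface has a cell decomposition with one face, `n` edges and the classes of end points of
sides as vertices; its genus `g` is given by `2 - 2 g = V - E + F`. -/
def HasGenus (g : ℕ) : Prop := (2 : ℤ) - 2 * g = (G.vertices.ncard : ℤ) - n + 1

/-- Charts of the translation structure: local coordinates on the complement of the vertices which
near every point of the region are a translation of the coordinate of the plane. -/
def IsTranslationChart (φ : OpenPartialHomeomorph G.Surface ℂ) : Prop :=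
  (∀ s ∈ φ.source, s ∉ G.vertices) ∧
  ∀ x : G.region, G.toSurface x ∈ φ.source → ∃ c : ℂ, ∀ᶠ y in 𝓝 x, φ (G.toSurface y) = (y : ℂ) + c

/-- The gluing is a closed connected surface with a translation structure off the finite set of
vertices. -/
def IsTranslationSurface : Prop :=
  CompactSpace G.Surface ∧ ConnectedSpace G.Surface ∧ T2Space G.Surface ∧ G.vertices.Finite ∧
  ∀ s ∉ G.vertices, ∃ φ, G.IsTranslationChart φ ∧ s ∈ φ.source

/-- `BrokenGeodesic x y ℓ`: the points `x` and `y` are joined by a finite chain of straight segments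
of the region (crossing sides through the gluing) of total length `ℓ`. -/
inductive BrokenGeodesic : G.Surface → G.Surface → ℝ≥0∞ → Prop
  | nil (x : G.Surface) : BrokenGeodesic x x 0
  | cons (a b : G.region) (y : G.Surface) (l : ℝ≥0∞) (hab : segment ℝ (a : ℂ) (b : ℂ) ⊆ G.region)
      (h : BrokenGeodesic (G.toSurface b) y l) : BrokenGeodesic (G.toSurface a) y (edist (a : ℂ) (b : ℂ) + l)

/-- The distance of the flat metric: the infimum of the lengths of broken geodesics. -/
def flatDist (x y : G.Surface) : ℝ≥0∞ := sInf {l | G.BrokenGeodesic x y l}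

/-- The image `L · G` of a surface under a linear map of the plane: the region and its sides are
replaced by their images. -/
def map (L : ℂ →L[ℝ] ℂ) : PolygonGluing n where
  region := L '' G.region
  startA j := L (G.startA j)
  startB j := L (G.startB j)
  vec j := L (G.vec j)

variable {G} {m : ℕ} {H : PolygonGluing m}

/-- The homeomorphism `f` maps vertices to vertices and off the vertices it is differentiable with
constant derivative `D` in the charts of the translation structures. -/
def IsAffine (f : G.Surface ≃ₜ H.Surface) (D : ℂ →L[ℝ] ℂ) : Prop :=
  f '' G.vertices = H.vertices ∧
  ∀ φ ψ, G.IsTranslationChart φ → H.IsTranslationChart ψ →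
    ∀ z ∈ φ.target, f (φ.symm z) ∈ ψ.source →
      HasFDerivAt (fun w => ψ (f (φ.symm w))) D z

/-- `f` is obtained by cutting the region of `G` into the pieces `P k` and translating
`P k` by `d k` onto the piece `Q k` of the region of `H`. -/
def IsCutAndPaste (f : G.Surface ≃ₜ H.Surface) {N : ℕ} (P Q : Fin N → Set ℂ) (d : Fin N → ℂ) :
    Prop :=
  G.region = ⋃ k, P k ∧ H.region = ⋃ k, Q k ∧
  (∀ k l, k ≠ l → Disjoint (interior (P k)) (interior (P l))) ∧
  (∀ k l, k ≠ l → Disjoint (interior (Q k)) (interior (Q l))) ∧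
  (∀ k, (fun z => z + d k) '' P k = Q k) ∧
  ∀ k, ∀ x : G.region, ∀ y : H.region, (x : ℂ) ∈ P k → (y : ℂ) = x + d k → f (G.toSurface x) = H.toSurface y

end PolygonGluing

/-! ## Suspension data -/

section Suspension

variable {n : ℕ} (π : Equiv.Perm (Fin n)) (ζ : Fin n → ℂ)

/-- The `k`-th vertex of the broken line `L₀`, the concatenation of `ζ 0, ζ 1, …`. -/
def topVertex (k : ℕ) : ℂ := ∑ j : Fin n with j.val < k, ζ j

/-- The `k`-th vertex of the broken line `L₁`, the concatenation of `ζ (π⁻¹ 0), ζ (π⁻¹ 1), …`. -/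
def botVertex (k : ℕ) : ℂ := topVertex (fun j => ζ (π.symm j)) k

/-- `ζ` is a suspension datum for the interval exchange map with permutation `π` and lengths
`lam`. -/
def IsSuspensionDatum (lam : Fin n → ℝ) : Prop :=
  (∀ j, 0 < lam j) ∧ (∀ j, (ζ j).re = lam j) ∧
  (∀ k, 1 ≤ k → k < n → 0 < (topVertex ζ k).im) ∧
  (∀ k, 1 ≤ k → k < n → (botVertex π ζ k).im < 0)

/-- The surface `M(π, ζ)`: the closed polygon bounded by `L₀` and `L₁`, with the side `ζ j` of `L₀`
glued to the side `ζ j` of `L₁`. -/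
def suspension : PolygonGluing n where
  region := verticalHull
    ((⋃ j : Fin n, segment ℝ (topVertex ζ j) (topVertex ζ (j + 1))) ∪
      ⋃ j : Fin n, segment ℝ (botVertex π ζ j) (botVertex π ζ (j + 1)))
  startA j := topVertex ζ j
  startB j := botVertex π ζ (π j)
  vec j := ζ j

open Classical in
/-- The cone angle of `M(π, ζ)` at the point `s`, for a vertex `s`: the sum of the interior angles
of the polygon at the vertices representing `s` (those of `L₀` and of `L₁` that are
not end points, the common left end point, and the common right end point). -/
def suspensionConeAngle (s : (suspension π ζ).Surface) : ℝ :=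
  let rep (z : ℂ) : Prop := ∃ x : (suspension π ζ).region, (x : ℂ) = z ∧ (suspension π ζ).toSurface x = s
  let t := topVertex ζ
  let b := botVertex π ζ
  (∑ k ∈ Finset.Ico 1 n,
    if rep (t k) then Real.pi + Complex.arg ((t (k + 1) - t k) / (t k - t (k - 1))) else 0) +
  (∑ k ∈ Finset.Ico 1 n,
    if rep (b k) then Real.pi - Complex.arg ((b (k + 1) - b k) / (b k - b (k - 1))) else 0) +
  (if rep (t 0) then Complex.arg ((t 1 - t 0) / (b 1 - b 0)) else 0) +
  (if rep (t n) then Complex.arg ((b n - b (n - 1)) / (t n - t (n - 1))) else 0)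

end Suspension

/-! ## Rauzy paths -/

section Rauzy

variable {ι : Type} [Fintype ι] [DecidableEq ι]

/-- Insert `x` directly after `a` in the list `l`. -/
def insertAfter (a x : ι) (l : List ι) : List ι := l.flatMap fun y => if y = a then [y, x] else [y]

/-- One step of the Rauzy induction of type `0` or `1` on a pair of orderings (top and bottom) of
the letters, multiplying the current matrix by the transition matrix (old lengths in terms of new
lengths). In type `0` the last top letter `a` is longer than the last bottom letter `b`: then
`b` is moved directly after `a` in the bottom ordering and the length of `a` is decreased by that
of `b`. Type `1` is symmetric. -/
def rauzyStep (s : List ι × List ι × Matrix ι ι ℤ) (ε : Fin 2) : List ι × List ι × Matrix ι ι ℤ :=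
  match s.1.getLast?, s.2.1.getLast? with
  | some a, some b =>
    if ε = 0 then (s.1, insertAfter a b s.2.1.dropLast, s.2.2 * Matrix.transvection a b 1)
    else (insertAfter b a s.1.dropLast, s.2.1, s.2.2 * Matrix.transvection b a 1)
  | _, _ => s

/-- The path `p` in the Rauzy class of `π` starting at `π` is closed (it ends at the same
permutation, after renumbering the letters according to the final top ordering), and `R` is the
product of the transition matrices, with the final lengths numbered by the final top ordering. -/
def IsClosedRauzyPath {n : ℕ} (π : Equiv.Perm (Fin n)) (p : List (Fin 2))
    (R : Matrix (Fin n) (Fin n) ℤ) : Prop :=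
  let top := List.finRange n
  let bot := (List.finRange n).map π.symm
  let s := p.foldl rauzyStep (top, bot, 1)
  s.2.1.map (fun a => s.1.idxOf a) = bot.map (fun a => top.idxOf a) ∧
  s.1.length = n ∧
  ∀ (i k c : Fin n), s.1[(k : ℕ)]? = some c → R i k = s.2.2 i c

end Rauzy

/-! ## Derivatives and dilatation -/

/-- The linear map of the plane with matrix `A`. -/
def planeMap (A : Matrix (Fin 2) (Fin 2) ℝ) : ℂ →L[ℝ] ℂ :=
  LinearMap.toContinuousLinearMap (Matrix.toLin Complex.basisOneI Complex.basisOneI A)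

/-- The affine homeomorphism `f` with derivative `A` is pseudo-Anosov (`|Tr A| > 2`), with
dilatation `δ` the absolute value of the expanding eigenvalue of `A`. -/
def IsAffinePseudoAnosov {n : ℕ} {G : PolygonGluing n} (f : G.Surface ≃ₜ G.Surface)
    (A : Matrix (Fin 2) (Fin 2) ℝ) (δ : ℝ) : Prop :=
  A.det = 1 ∧ PolygonGluing.IsAffine f (planeMap A) ∧ 2 < |A.trace| ∧
  ∃ μ : ℝ, Module.End.HasEigenvalue (Matrix.toLin' A) μ ∧ 1 < |μ| ∧ δ = |μ|

/-! ## The example in genus four (letters and positions are numbered from `0`) -/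

namespace GenusFour

/-- `X⁸ - X⁵ - X⁴ - X³ + 1`. -/
def poly : ℝ[X] := X ^ 8 - X ^ 5 - X ^ 4 - X ^ 3 + 1

/-- The permutation for which `π⁻¹ (1), …, π⁻¹ (9)` is `5, 3, 9, 8, 6, 2, 7, 1, 4`. -/
def perm : Equiv.Perm (Fin 9) where
  toFun := ![7, 5, 1, 8, 0, 4, 6, 3, 2]
  invFun := ![4, 2, 8, 7, 5, 1, 6, 0, 3]
  left_inv := by decide
  right_inv := by decide

def path : List (Fin 2) := [0, 1, 0, 0, 1, 1, 1, 0, 1, 0, 0, 1, 0, 0]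

def R : Matrix (Fin 9) (Fin 9) ℤ :=
  !![1, 1, 0, 0, 0, 0, 0, 0, 0;
     0, 0, 1, 1, 1, 1, 1, 1, 0;
     0, 0, 0, 0, 0, 1, 0, 1, 1;
     1, 0, 0, 1, 0, 0, 1, 0, 0;
     0, 0, 1, 0, 1, 0, 0, 0, 0;
     0, 0, 0, 1, 1, 0, 0, 0, 0;
     0, 0, 0, 0, 0, 1, 1, 0, 0;
     1, 0, 0, 0, 0, 1, 1, 1, 0;
     1, 1, 0, 1, 0, 0, 1, 0, 0]

/-- The number `∑ aᵢ αⁱ`. -/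
def eval (α : ℝ) (a : Fin 8 → ℤ) : ℝ := ∑ i : Fin 8, (a i : ℝ) * α ^ (i : ℕ)

def lam (α : ℝ) (j : Fin 9) : ℝ := eval α
  ((!![0, 1, -2, 1, -1, 0, 1, -1;
       0, -1, 1, 0, 1, 0, -1, 0;
       -1, 0, -1, 0, 0, -1, 0, 0;
       -1, 2, -1, 1, 0, -1, 1, 0;
       1, -1, 1, 0, 0, 1, 0, 0;
       -1, 1, -1, 1, -1, -1, 0, -1;
       1, -2, 2, -2, 1, 1, -1, 1;
       0, 0, 1, -1, 1, 0, 0, 1;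
       1, 0, 0, 0, 0, 0, 0, 0] : Matrix (Fin 9) (Fin 8) ℤ) j)

def tau (α : ℝ) (j : Fin 9) : ℝ := eval α
  ((!![-1, 0, 0, 0, 0, -1, 0, 0;
       0, 0, -1, 1, 0, 1, 0, -1;
       0, 0, -1, 0, -1, 0, 0, -1;
       0, 1, 0, 0, 0, 0, 1, 0;
       0, 0, 0, 1, 0, 0, 0, 0;
       0, 0, -1, 0, 0, 0, 1, 0;
       0, 0, 0, 0, 0, 0, -1, 0;
       0, 1, 0, 0, 0, 0, 0, 0;
       -1, 0, 0, 0, 0, 0, 0, 0] : Matrix (Fin 9) (Fin 8) ℤ) j)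

def zeta (α : ℝ) (j : Fin 9) : ℂ := ⟨lam α j, tau α j⟩

/-- The translation surface `M(π, ζ)`. -/
def M (α : ℝ) : PolygonGluing 9 := suspension perm (zeta α)

/-- The matrix `diag(α⁻¹, α)`. -/
def A (α : ℝ) : Matrix (Fin 2) (Fin 2) ℝ := !![α⁻¹, 0; 0, α]

/-- The image `M' = A · M`. -/
def M' (α : ℝ) : PolygonGluing 9 := (M α).map (planeMap (A α))

/-- The vertices `p₁ = 0, p₂, …, p₁₈` of the polygon of `M`: first along the top broken line
from left to right, then along the bottom broken line from right to left. -/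
def p (α : ℝ) (i : ℕ) : ℂ :=
  if i ≤ 10 then topVertex (zeta α) (i - 1) else botVertex perm (zeta α) (19 - i)

/-- The corresponding vertices `qᵢ = A pᵢ` of the polygon of `M'`. -/
def q (α : ℝ) (i : ℕ) : ℂ := planeMap (A α) (p α i)

/-- The vertices `pᵢ` of the eight pieces of `M`. -/
def pieces : Fin 8 → List ℕ :=
  ![[1, 2, 3, 17, 18], [3, 16, 17], [3, 4, 16], [4, 5, 14, 15, 16], [5, 6, 14],
    [6, 8, 9, 10, 11, 13, 14], [6, 7, 8], [11, 12, 13]]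

/-- The vertices `qᵢ` of the eight pieces of `M'`, in the corresponding order. -/
def pieces' : Fin 8 → List ℕ :=
  ![[8, 14, 3, 4, 6], [18, 1, 17], [6, 4, 5], [11, 12, 13, 9, 10], [8, 6, 7],
    [15, 16, 17, 1, 2, 3, 14], [9, 13, 8], [14, 8, 13]]

end GenusFour

end

noncomputable section

/-! ### Quotients of compact spaces -/

theorem isClosedMap_quotient_mk {X : Type*} [TopologicalSpace X] [CompactSpace X] [T2Space X]
    (s : Setoid X) (hs : IsClosed {p : X × X | s p.1 p.2}) :
    IsClosedMap (Quotient.mk s) := by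
  intro C hC
  have hq : Topology.IsQuotientMap (Quotient.mk s) := isQuotientMap_quotient_mk'
  rw [← hq.isClosed_preimage]
  have : Quotient.mk s ⁻¹' (Quotient.mk s '' C) =
      Prod.snd '' ({p : X × X | s p.1 p.2} ∩ Prod.fst ⁻¹' C) := by
    ext y
    constructor
    · rintro ⟨x, hx, hxy⟩
      exact ⟨(x, y), ⟨Quotient.exact hxy, hx⟩, rfl⟩
    · rintro ⟨⟨x, y'⟩, ⟨h, hx⟩, rfl⟩
      exact ⟨x, hx, Quotient.sound h⟩
  rw [this]
  exact ((hs.inter (hC.preimage continuous_fst)).isCompact.image continuous_snd).isClosed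

theorem t2Space_of_isClosedMap {X Y : Type*} [TopologicalSpace X] [TopologicalSpace Y]
    [NormalSpace X] {f : X → Y} (hf : IsClosedMap f) (hsurj : Function.Surjective f)
    (hfib : ∀ y, IsClosed (f ⁻¹' {y})) : T2Space Y := by
  rw [t2Space_iff_disjoint_nhds]
  intro y₁ y₂ hne
  have hdisj : Disjoint (f ⁻¹' {y₁}) (f ⁻¹' {y₂}) :=
    Disjoint.preimage f (by simpa using hne)
  obtain ⟨U₁, U₂, hU₁, hU₂, h₁, h₂, hU⟩ := normal_separation (hfib y₁) (hfib y₂) hdisj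
  have e₁ := hf.eventually_nhds_fiber (p := (· ∈ U₁)) y₁ fun x hx => hU₁.mem_nhds (h₁ hx)
  have e₂ := hf.eventually_nhds_fiber (p := (· ∈ U₂)) y₂ fun x hx => hU₂.mem_nhds (h₂ hx)
  rw [Filter.disjoint_iff]
  refine ⟨_, e₁, _, e₂, Set.disjoint_left.2 fun y hy₁ hy₂ => ?_⟩
  obtain ⟨x, rfl⟩ := hsurj y
  exact Set.disjoint_left.1 hU (hy₁ x rfl) (hy₂ x rfl)

theorem t2Space_quotient_of_isClosed {X : Type*} [TopologicalSpace X] [CompactSpace X] [T2Space X]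
    (s : Setoid X) (hs : IsClosed {p : X × X | s p.1 p.2}) : T2Space (Quotient s) := by
  refine t2Space_of_isClosedMap (isClosedMap_quotient_mk s hs) Quotient.mk_surjective fun y => ?_
  obtain ⟨x, rfl⟩ := Quotient.mk_surjective y
  have : Quotient.mk s ⁻¹' {Quotient.mk s x} = (fun y => (y, x)) ⁻¹' {p : X × X | s p.1 p.2} := by
    ext y
    exact Quotient.eq
  rw [this]
  exact hs.preimage (by fun_prop)

theorem exists_homeomorph_of_same_fibers {X Y Z : Type*} [TopologicalSpace X] [TopologicalSpace Y]
    [TopologicalSpace Z] [CompactSpace X] [T2Space Y] [T2Space Z] {f : X → Y} {g : X → Z}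
    (hf : Continuous f) (hg : Continuous g) (hfs : Function.Surjective f)
    (hgs : Function.Surjective g) (h : ∀ x y, f x = f y ↔ g x = g y) :
    ∃ e : Y ≃ₜ Z, ∀ x, e (f x) = g x := by
  have key : ∀ x, g (Function.surjInv hfs (f x)) = g x := fun x =>
    (h _ _).1 (Function.surjInv_eq hfs _)
  have key' : ∀ x, f (Function.surjInv hgs (g x)) = f x := fun x =>
    (h _ _).2 (Function.surjInv_eq hgs _)
  let E : Y ≃ Z :=
    { toFun := fun y => g (Function.surjInv hfs y)
      invFun := fun z => f (Function.surjInv hgs z)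
      left_inv := fun y => (key' _).trans (Function.surjInv_eq hfs y)
      right_inv := fun z => (key _).trans (Function.surjInv_eq hgs z) }
  have hq : Topology.IsQuotientMap f := hf.isClosedMap.isQuotientMap hf hfs
  have : CompactSpace Y := by
    rw [← isCompact_univ_iff, ← hfs.range_eq]
    exact isCompact_range hf
  have hE : Continuous E := by
    rw [hq.continuous_iff]
    have : ⇑E ∘ f = g := funext key
    rwa [this]
  exact ⟨hE.homeoOfEquivCompactToT2, key⟩

/-! ### Vertical hulls -/

/-- The points lying vertically above a point of `A` and below a point of `B`. -/
def verticalJoin (A B : Set ℂ) : Set ℂ :=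
  {z | ∃ a ∈ A, ∃ b ∈ B, a.re = z.re ∧ b.re = z.re ∧ a.im ≤ z.im ∧ z.im ≤ b.im}

theorem verticalHull_iUnion {ι : Type*} (S : ι → Set ℂ) :
    verticalHull (⋃ i, S i) = ⋃ p : ι × ι, verticalJoin (S p.1) (S p.2) := by
  ext z
  simp only [verticalHull, verticalJoin, Set.mem_iUnion, Set.mem_ofPred_eq, Prod.exists]
  constructor
  · rintro ⟨a, ⟨i, ha⟩, b, ⟨j, hb⟩, h⟩
    exact ⟨i, j, a, ha, b, hb, h⟩
  · rintro ⟨i, j, a, ha, b, hb, h⟩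
    exact ⟨a, ⟨i, ha⟩, b, ⟨j, hb⟩, h⟩

theorem subset_verticalHull (S : Set ℂ) : S ⊆ verticalHull S :=
  fun z hz => ⟨z, hz, z, hz, rfl, rfl, le_rfl, le_rfl⟩

theorem Convex.verticalJoin {A B : Set ℂ} (hA : Convex ℝ A) (hB : Convex ℝ B) :
    Convex ℝ (verticalJoin A B) := by
  rintro z ⟨a, ha, b, hb, h₁, h₂, h₃, h₄⟩ z' ⟨a', ha', b', hb', h₁', h₂', h₃', h₄'⟩ s t hs ht hst
  refine ⟨s • a + t • a', hA ha ha' hs ht hst, s • b + t • b', hB hb hb' hs ht hst, ?_, ?_, ?_, ?_⟩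
  · simp [h₁, h₁']
  · simp [h₂, h₂']
  · simp only [Complex.add_im, Complex.real_smul, Complex.im_ofReal_mul]
    gcongr
  · simp only [Complex.add_im, Complex.real_smul, Complex.im_ofReal_mul]
    gcongr

theorem IsCompact.verticalJoin {A B : Set ℂ} (hA : IsCompact A) (hB : IsCompact B) :
    IsCompact (verticalJoin A B) := by
  have hK : IsCompact ((A ×ˢ B ×ˢ Set.Icc (0 : ℝ) 1) ∩
      {p : ℂ × ℂ × ℝ | p.1.re = p.2.1.re ∧ p.1.im ≤ p.2.1.im}) := by
    refine (hA.prod (hB.prod isCompact_Icc)).inter_right ?_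
    have h₁ : IsClosed {p : ℂ × ℂ × ℝ | p.1.re = p.2.1.re} :=
      isClosed_eq (by fun_prop) (by fun_prop)
    have h₂ : IsClosed {p : ℂ × ℂ × ℝ | p.1.im ≤ p.2.1.im} :=
      isClosed_le (by fun_prop) (by fun_prop)
    exact h₁.inter h₂
  have himg := hK.image (f := fun p : ℂ × ℂ × ℝ => p.1 + p.2.2 * (p.2.1 - p.1)) (by fun_prop)
  convert himg using 1
  ext z
  constructor
  · rintro ⟨a, ha, b, hb, h₁, h₂, h₃, h₄⟩
    rcases (h₃.trans h₄).eq_or_lt with h | h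
    · refine ⟨(a, b, 0), ⟨⟨ha, hb, by simp⟩, by simp [h₁, h₂], by simp [h]⟩, ?_⟩
      apply Complex.ext
      · simp [h₁]
      · simp; linarith
    · have h' : 0 < b.im - a.im := by linarith
      refine ⟨(a, b, (z.im - a.im) / (b.im - a.im)), ⟨⟨ha, hb, ?_, ?_⟩, by simp [h₁, h₂], h.le⟩, ?_⟩
      · exact div_nonneg (by linarith) h'.le
      · exact (div_le_one h').2 (by linarith)
      · apply Complex.ext
        · simp only [Complex.add_re, Complex.re_ofReal_mul, Complex.sub_re, h₁, h₂]
          ring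
        · simp only [Complex.add_im, Complex.im_ofReal_mul, Complex.sub_im]
          field_simp
          ring
  · rintro ⟨⟨a, b, t⟩, ⟨⟨ha, hb, ht₀, ht₁⟩, h₁, h₂⟩, rfl⟩
    simp only at ha hb ht₀ ht₁ h₁ h₂
    refine ⟨a, ha, b, hb, ?_, ?_, ?_, ?_⟩
    · simp [h₁]
    · simp [h₁]
    · simp only [Complex.add_im, Complex.im_ofReal_mul, Complex.sub_im]
      nlinarith
    · simp only [Complex.add_im, Complex.im_ofReal_mul, Complex.sub_im]
      nlinarith

theorem isCompact_segment (a b : ℂ) : IsCompact (segment ℝ a b) := by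
  rw [segment_eq_image_lineMap]
  exact isCompact_Icc.image AffineMap.lineMap_continuous

/-- A set that is a finite union of compact convex sets. -/
def IsFiniteConvexUnion (S : Set ℂ) : Prop :=
  ∃ (N : ℕ) (C : Fin N → Set ℂ), (∀ i, IsCompact (C i)) ∧ (∀ i, Convex ℝ (C i)) ∧ S = ⋃ i, C i

theorem IsFiniteConvexUnion.of_finite {ι : Type*} [Finite ι] {S : Set ℂ} (C : ι → Set ℂ)
    (h₁ : ∀ i, IsCompact (C i)) (h₂ : ∀ i, Convex ℝ (C i)) (h : S = ⋃ i, C i) :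
    IsFiniteConvexUnion S := by
  obtain ⟨N, ⟨e⟩⟩ := Finite.exists_equiv_fin ι
  refine ⟨N, fun i => C (e.symm i), fun i => h₁ _, fun i => h₂ _, ?_⟩
  rw [h]
  exact (e.symm.surjective.iUnion_comp C).symm

theorem IsFiniteConvexUnion.isCompact {S : Set ℂ} (h : IsFiniteConvexUnion S) : IsCompact S := by
  obtain ⟨N, C, hc, -, rfl⟩ := h
  exact isCompact_iUnion hc

theorem IsFiniteConvexUnion.verticalHull {S : Set ℂ} (h : IsFiniteConvexUnion S) :
    IsFiniteConvexUnion (verticalHull S) := by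
  obtain ⟨N, C, hc, hv, rfl⟩ := h
  exact .of_finite (ι := Fin N × Fin N) _ (fun p => (hc p.1).verticalJoin (hc p.2))
    (fun p => (hv p.1).verticalJoin (hv p.2)) (verticalHull_iUnion C)

theorem IsFiniteConvexUnion.polygonRegion (l : List ℂ) : IsFiniteConvexUnion (polygonRegion l) := by
  refine IsFiniteConvexUnion.verticalHull ?_
  refine .of_finite (ι := {e // e ∈ l.zip (l.rotate 1)}) (fun e => segment ℝ e.1.1 e.1.2)
    (fun e => isCompact_segment _ _) (fun e => convex_segment _ _) ?_
  ext z
  simp [closedBrokenLine]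

theorem closedBrokenLine_map (l : List ℂ) (f : ℂ →ᵃ[ℝ] ℂ) :
    closedBrokenLine (l.map f) = f '' closedBrokenLine l := by
  ext z
  simp only [closedBrokenLine, ← List.map_rotate, List.zip_map, List.mem_map, Prod.exists,
    Set.mem_ofPred_eq, Set.mem_image]
  constructor
  · rintro ⟨a', b', ⟨a, b, hab, he⟩, hz⟩
    simp only [Prod.map_apply, Prod.mk.injEq] at he
    rw [← he.1, ← he.2, ← image_segment] at hz
    obtain ⟨w, hw, rfl⟩ := hz
    exact ⟨w, ⟨a, b, hab, hw⟩, rfl⟩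
  · rintro ⟨w, ⟨a, b, hab, hw⟩, rfl⟩
    refine ⟨f a, f b, ⟨a, b, hab, rfl⟩, ?_⟩
    rw [← image_segment]
    exact ⟨w, hw, rfl⟩

/-! ### Segments covered by finitely many closed sets -/

theorem segment_induction {ι : Type*} (C : ι → Set ℂ) (hC : ∀ i, IsClosed (C i))
    (B : ℂ → ℂ → ℝ≥0∞ → Prop) (hB : ∀ i, ∀ a ∈ C i, ∀ b ∈ C i, B a b (edist a b))
    (htr : ∀ a b c l l', B a b l → B b c l' → B a c (l + l')) (s : Finset ι) :
    ∀ a b, segment ℝ a b ⊆ ⋃ i ∈ s, C i → B a b (edist a b) := by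
  classical
  induction s using Finset.strongInduction with
  | H s ih =>
    intro a b hab
    obtain ⟨i, hi, hai⟩ : ∃ i ∈ s, a ∈ C i := by
      simpa using hab (left_mem_segment ℝ a b)
    let γ : ℝ → ℂ := AffineMap.lineMap a b
    have hγ : Continuous γ := AffineMap.lineMap_continuous
    have hcomp : IsCompact (Set.Icc (0 : ℝ) 1 ∩ γ ⁻¹' C i) :=
      isCompact_Icc.inter_right ((hC i).preimage hγ)
    obtain ⟨t, ⟨ht, htC⟩, hmax⟩ := hcomp.exists_isGreatest ⟨0, by simp, by simpa [γ] using hai⟩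
    have hseg : ∀ u ∈ Set.Icc (0 : ℝ) 1, γ u ∈ segment ℝ a b := by
      intro u hu
      rw [segment_eq_image_lineMap]
      exact ⟨u, hu, rfl⟩
    have hsum : edist a (γ t) + edist (γ t) b = edist a b := by
      rw [edist_dist, edist_dist, edist_dist, ← ENNReal.ofReal_add dist_nonneg dist_nonneg,
        dist_add_dist_of_mem_segment (hseg t ht)]
    have h₁ : B a (γ t) (edist a (γ t)) := hB i a hai _ htC
    rcases ht.2.eq_or_lt with h1 | h1
    · have : γ t = b := by simp [γ, h1]
      rwa [this] at h₁
    rw [← hsum]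
    refine htr _ _ _ _ _ h₁ (ih (s.erase i) (Finset.erase_ssubset hi) _ _ ?_)
    have hopen : ∀ u ∈ Set.Ioc t 1, γ u ∈ ⋃ j ∈ s.erase i, C j := by
      intro u hu
      have hu' : u ∈ Set.Icc (0 : ℝ) 1 := ⟨ht.1.trans hu.1.le, hu.2⟩
      obtain ⟨j, hj, huj⟩ : ∃ j ∈ s, γ u ∈ C j := by
        simpa using hab (hseg u hu')
      have hji : j ≠ i := by
        rintro rfl
        exact absurd (hmax ⟨hu', huj⟩) (not_le.2 hu.1)
      exact Set.mem_biUnion (Finset.mem_coe.2 (Finset.mem_erase.2 ⟨hji, hj⟩)) huj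
    have hclosed : IsClosed (γ ⁻¹' ⋃ j ∈ s.erase i, C j) :=
      (isClosed_biUnion_finset fun j _ => hC j).preimage hγ
    have hIcc : Set.Icc t 1 ⊆ γ ⁻¹' ⋃ j ∈ s.erase i, C j := by
      rw [← closure_Ioc h1.ne]
      exact hclosed.closure_subset_iff.2 hopen
    have hb : b = γ 1 := by simp [γ]
    have : segment ℝ (γ t) b = γ '' Set.Icc t 1 := by
      rw [hb, ← segment_eq_Icc h1.le, image_segment]
    rw [this]
    rintro _ ⟨u, hu, rfl⟩
    exact hIcc hu

namespace PolygonGluing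

variable {n m : ℕ} {G : PolygonGluing n} {H : PolygonGluing m}

theorem continuous_toSurface : Continuous G.toSurface := continuous_quotient_mk'

theorem toSurface_surjective : Function.Surjective G.toSurface := Quotient.mk_surjective

theorem BrokenGeodesic.trans {x y z : G.Surface} {l l' : ℝ≥0∞} (h : G.BrokenGeodesic x y l)
    (h' : G.BrokenGeodesic y z l') : G.BrokenGeodesic x z (l + l') := by
  induction h with
  | nil x => simpa using h'
  | cons a b y l hab h ih =>
    rw [add_assoc]
    exact .cons a b z _ hab (ih h')

theorem flatDist_map_le (f : G.Surface → H.Surface) {N : ℕ} (P : Fin N → Set ℂ) (d : Fin N → ℂ)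
    (hP : ∀ k, IsFiniteConvexUnion (P k)) (hcov : G.region = ⋃ k, P k)
    (hm : ∀ k, ∀ x ∈ P k, x + d k ∈ H.region)
    (hf : ∀ k, ∀ x : G.region, ∀ y : H.region, (x : ℂ) ∈ P k → (y : ℂ) = x + d k →
      f (G.toSurface x) = H.toSurface y) (x y : G.Surface) :
    H.flatDist (f x) (f y) ≤ G.flatDist x y := by
  choose M C hCc hCv hCP using hP
  have hCsub : ∀ k i, C k i ⊆ P k := fun k i => by
    rw [hCP k]; exact Set.subset_iUnion _ i
  have hPsub : ∀ k, P k ⊆ G.region := fun k => by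
    rw [hcov]; exact Set.subset_iUnion _ k
  have hcov' : G.region = ⋃ q ∈ (Finset.univ : Finset (Σ k, Fin (M k))), C q.1 q.2 := by
    rw [hcov]
    ext z
    simp [hCP]
  have hseg := segment_induction (fun q : Σ k, Fin (M k) => C q.1 q.2)
    (fun q => (hCc q.1 q.2).isClosed)
    (fun a b l => ∃ (ha : a ∈ G.region) (hb : b ∈ G.region),
      H.BrokenGeodesic (f (G.toSurface ⟨a, ha⟩)) (f (G.toSurface ⟨b, hb⟩)) l)
    (by
      rintro ⟨k, i⟩ a ha b hb
      have ha' := hCsub k i ha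
      have hb' := hCsub k i hb
      refine ⟨hPsub k ha', hPsub k hb', ?_⟩
      rw [hf k ⟨a, hPsub k ha'⟩ ⟨a + d k, hm k a ha'⟩ ha' rfl,
        hf k ⟨b, hPsub k hb'⟩ ⟨b + d k, hm k b hb'⟩ hb' rfl]
      have := BrokenGeodesic.cons (G := H) ⟨a + d k, hm k a ha'⟩ ⟨b + d k, hm k b hb'⟩ _ 0
        (by
          rintro z hz
          have hz' : z - d k ∈ segment ℝ a b := by
            rw [← mem_segment_translate ℝ (d k)]
            simpa [add_comm] using hz
          have := hm k _ (hCsub k i ((hCv k i).segment_subset ha hb hz'))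
          simpa using this) (.nil _)
      simpa using this)
    (by
      rintro a b c l l' ⟨ha, hb, h⟩ ⟨hb', hc, h'⟩
      exact ⟨ha, hc, h.trans h'⟩) Finset.univ
  have main : ∀ l, G.BrokenGeodesic x y l → H.BrokenGeodesic (f x) (f y) l := by
    intro l h
    induction h with
    | nil x => exact .nil _
    | cons a b y l hab h ih =>
      obtain ⟨_, _, h'⟩ := hseg a b (hcov' ▸ hab)
      exact h'.trans ih
  exact sInf_le_sInf main

/-! ### Affine maps -/

theorem hasFDerivAt_of_pieces (hG : IsCompact G.region)
    [T2Space G.Surface] (f : G.Surface ≃ₜ H.Surface) (D : ℂ →L[ℝ] ℂ) {N : ℕ} (P : Fin N → Set ℂ)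
    (d : Fin N → ℂ) (hP : ∀ k, IsClosed (P k)) (hcov : G.region = ⋃ k, P k)
    (hm : ∀ k, ∀ x ∈ P k, D x + d k ∈ H.region)
    (hf : ∀ k, ∀ x : G.region, ∀ y : H.region, (x : ℂ) ∈ P k → (y : ℂ) = D x + d k →
      f (G.toSurface x) = H.toSurface y)
    {φ : OpenPartialHomeomorph G.Surface ℂ} {ψ : OpenPartialHomeomorph H.Surface ℂ}
    (hφ : G.IsTranslationChart φ) (hψ : H.IsTranslationChart ψ) {z : ℂ} (hz : z ∈ φ.target)
    (hs : f (φ.symm z) ∈ ψ.source) :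
    HasFDerivAt (fun w => ψ (f (φ.symm w))) D z := by
  have : CompactSpace G.region := isCompact_iff_compactSpace.1 hG
  set s := φ.symm z with hs_def
  have hsφ : s ∈ φ.source := φ.map_target hz
  let val : G.Surface → ℂ := fun s' => ψ (f s') - D (φ s')
  have hloc : ∀ x : G.region, G.toSurface x = s →
      ∃ V : Set ℂ, V.Finite ∧ ∀ᶠ y in 𝓝 x, val (G.toSurface y) ∈ V := by
    intro x hx
    obtain ⟨c, hc⟩ := hφ.2 x (hx ▸ hsφ)
    have hk : ∀ k, ∃ e : ℂ, ∀ᶠ y : G.region in 𝓝 x, (y : ℂ) ∈ P k → ψ (f (G.toSurface y)) = D y + d k + e := by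
      intro k
      by_cases hxk : (x : ℂ) ∈ P k
      · let T : {y : G.region // (y : ℂ) ∈ P k} → H.region := fun y => ⟨D y.1 + d k, hm k _ y.2⟩
        have hT : Continuous T := by
          refine Continuous.subtype_mk ?_ _
          exact (D.continuous.comp (continuous_subtype_val.comp continuous_subtype_val)).add
            continuous_const
        have hfT : ∀ y, f (G.toSurface y.1) = H.toSurface (T y) := fun y => hf k y.1 (T y) y.2 rfl
        obtain ⟨e, he⟩ := hψ.2 (T ⟨x, hxk⟩) (by rw [← hfT, hx]; exact hs)
        refine ⟨e, ?_⟩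
        have h2 := hT.continuousAt.eventually he
        rw [nhds_subtype_eq_comap, Filter.eventually_comap] at h2
        filter_upwards [h2] with y hy hyk
        have := hy ⟨y, hyk⟩ rfl
        rw [← hfT] at this
        exact this
      · refine ⟨0, ?_⟩
        have : ∀ᶠ y : G.region in 𝓝 x, (y : ℂ) ∉ P k :=
          continuous_subtype_val.continuousAt.eventually ((hP k).isOpen_compl.mem_nhds hxk)
        filter_upwards [this] with y hy hyk
        exact absurd hyk hy
    choose e he using hk
    refine ⟨Set.range fun k => d k + e k - D c, Set.finite_range _, ?_⟩
    filter_upwards [hc, Filter.eventually_all.2 he] with y hy hyk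
    obtain ⟨k, hk⟩ := Set.mem_iUnion.1 (hcov.subset y.2)
    refine ⟨k, ?_⟩
    simp only [val]
    rw [hyk k hk, hy, map_add]
    ring
  choose! V hVf hV using hloc
  have hF : IsCompact (G.toSurface ⁻¹' {s}) :=
    (isClosed_singleton.preimage continuous_toSurface).isCompact
  obtain ⟨t, ht, htF⟩ := hF.elim_nhds_subcover
    (fun x => {y | ∀ᶠ y' in 𝓝 y, val (G.toSurface y') ∈ V x})
    (fun x hx => eventually_eventually_nhds.2 (hV x hx))
  let W : Set ℂ := ⋃ x ∈ t, V x
  have hWf : W.Finite := t.finite_toSet.biUnion fun x hx => hVf x (ht x hx)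
  have hW : ∀ᶠ s' in 𝓝 s, val s' ∈ W := by
    have := (continuous_toSurface (G := G)).isClosedMap.eventually_nhds_fiber
      (p := fun y => val (G.toSurface y) ∈ W) s (by
        intro x hx
        obtain ⟨x', hx', hxx'⟩ := Set.mem_iUnion₂.1 (htF hx)
        filter_upwards [hxx'] with y hy
        exact Set.mem_biUnion (Finset.mem_coe.2 hx') hy)
    filter_upwards [this] with s' hs'
    obtain ⟨y, rfl⟩ := toSurface_surjective s'
    exact hs' y rfl
  have hcs : ContinuousAt φ.symm z := φ.continuousAt_symm hz
  have hψs : ∀ᶠ w in 𝓝 z, f (φ.symm w) ∈ ψ.source :=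
    (f.continuous.continuousAt.comp hcs).eventually (ψ.open_source.mem_nhds hs)
  obtain ⟨r, hr, hball⟩ := Metric.eventually_nhds_iff_ball.1
    ((φ.open_target.eventually_mem hz).and (hψs.and (hcs.eventually hW)))
  have hcont : ContinuousOn (fun w => ψ (f (φ.symm w)) - D w) (Metric.ball z r) := by
    refine ContinuousOn.sub ?_ D.continuous.continuousOn
    intro w hw
    refine ContinuousAt.continuousWithinAt ?_
    exact ContinuousAt.comp (f := fun w => f (φ.symm w)) (ψ.continuousAt (hball w hw).2.1)
      (f.continuous.continuousAt.comp (φ.continuousAt_symm (hball w hw).1))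
  have hmaps : Set.MapsTo (fun w => ψ (f (φ.symm w)) - D w) (Metric.ball z r) W := by
    intro w hw
    have := (hball w hw).2.2
    simp only [val] at this
    rwa [φ.right_inv (hball w hw).1] at this
  obtain ⟨c, -, hc⟩ := (convex_ball z r).isPreconnected.eqOn_const_of_mapsTo
    hWf.isDiscrete hcont hmaps ⟨_, hmaps (Metric.mem_ball_self hr)⟩
  refine (D.hasFDerivAt.add_const c).congr_of_eventuallyEq ?_
  filter_upwards [Metric.ball_mem_nhds z hr] with w hw
  have := hc hw
  simp only [Function.const_apply] at this
  rw [← this]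
  ring

end PolygonGluing

namespace PolygonGluing

variable {n : ℕ} {G : PolygonGluing n}

theorem exists_translationChart (hG : IsClosed G.region) {U : Set ℂ} {δ : ℂ} (hU : IsOpen U)
    (hcov : ∀ w ∈ U, w ∈ G.region ∨ w + δ ∈ G.region)
    (hfib : ∀ w ∈ U, ∀ x y : G.region, ((x : ℂ) = w ∨ (x : ℂ) = w + δ) →
      G.toSurface x = G.toSurface y → (y : ℂ) = w ∨ (y : ℂ) = w + δ)
    (hglue : ∀ w ∈ U, ∀ x y : G.region, (x : ℂ) = w → (y : ℂ) = w + δ →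
      G.toSurface x = G.toSurface y)
    (hdisj : ∀ w ∈ U, w + δ ∈ U → δ = 0)
    (hv : ∀ w ∈ U, ∀ x : G.region, ((x : ℂ) = w ∨ (x : ℂ) = w + δ) → G.toSurface x ∉ G.vertices)
    (x₀ : G.region) (hx₀ : (x₀ : ℂ) ∈ U) :
    ∃ φ, G.IsTranslationChart φ ∧ G.toSurface x₀ ∈ φ.source := by
  have hex : ∀ w : U, ∃ s : G.Surface, ∀ x : G.region, ((x : ℂ) = w ∨ (x : ℂ) = w + δ) →
      G.toSurface x = s := by
    intro w
    have key : ∀ x y : G.region, ((x : ℂ) = w ∨ (x : ℂ) = w + δ) →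
        ((y : ℂ) = w ∨ (y : ℂ) = w + δ) → G.toSurface x = G.toSurface y := by
      rintro x y (hx | hx) (hy | hy)
      · rw [Subtype.ext (hx.trans hy.symm)]
      · exact hglue w w.2 x y hx hy
      · exact (hglue w w.2 y x hy hx).symm
      · rw [Subtype.ext (hx.trans hy.symm)]
    rcases hcov w w.2 with h | h
    · exact ⟨G.toSurface ⟨w, h⟩, fun x hx => key x _ hx (.inl rfl)⟩
    · exact ⟨G.toSurface ⟨w + δ, h⟩, fun x hx => key x _ hx (.inr rfl)⟩
  choose ψ hψ using hex
  have hrep : ∀ w : U, ∃ x : G.region, ((x : ℂ) = w ∨ (x : ℂ) = w + δ) ∧ G.toSurface x = ψ w := by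
    intro w
    rcases hcov w w.2 with h | h
    · exact ⟨⟨w, h⟩, .inl rfl, hψ w _ (.inl rfl)⟩
    · exact ⟨⟨w + δ, h⟩, .inr rfl, hψ w _ (.inr rfl)⟩
  have hmem : ∀ (w : U) (y : G.region), ψ w = G.toSurface y → (y : ℂ) = w ∨ (y : ℂ) = w + δ := by
    intro w y h
    obtain ⟨x, hx, hxw⟩ := hrep w
    exact hfib w w.2 x y hx (hxw.trans h)
  have hinj : Function.Injective ψ := by
    intro w w' h
    obtain ⟨x, hx, hxw⟩ := hrep w'
    rcases hmem w x (h.trans hxw.symm) with h₁ | h₁ <;> rcases hx with h₂ | h₂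
    · exact Subtype.ext (h₁.symm.trans h₂)
    · have h₃ : (w : ℂ) = w' + δ := h₁.symm.trans h₂
      have := hdisj w' w'.2 (h₃ ▸ w.2)
      exact Subtype.ext (by simpa [this] using h₃)
    · have h₃ : (w' : ℂ) = w + δ := h₂.symm.trans h₁
      have := hdisj w w.2 (h₃ ▸ w'.2)
      exact Subtype.ext (by simpa [this] using h₃.symm)
    · exact Subtype.ext (add_right_cancel (h₁.symm.trans h₂))
  have hcont : Continuous ψ := by
    rw [continuous_iff_isClosed]
    intro C hC
    have hK : IsClosed (Subtype.val '' (G.toSurface ⁻¹' C)) :=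
      hG.isClosedEmbedding_subtypeVal.isClosedMap _ (hC.preimage continuous_toSurface)
    have : ψ ⁻¹' C = (fun w : U => (w : ℂ)) ⁻¹' (Subtype.val '' (G.toSurface ⁻¹' C)) ∪
        (fun w : U => (w : ℂ) + δ) ⁻¹' (Subtype.val '' (G.toSurface ⁻¹' C)) := by
      ext w
      constructor
      · intro hw
        obtain ⟨x, hx, hxw⟩ := hrep w
        have hxC : x ∈ G.toSurface ⁻¹' C := by
          rw [Set.mem_preimage, hxw]; exact hw
        rcases hx with hx | hx
        · exact .inl ⟨x, hxC, hx⟩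
        · exact .inr ⟨x, hxC, hx⟩
      · rintro (⟨x, hx, hxw⟩ | ⟨x, hx, hxw⟩)
        · rw [Set.mem_preimage, ← hψ w x (.inl hxw)]; exact hx
        · rw [Set.mem_preimage, ← hψ w x (.inr hxw)]; exact hx
    rw [this]
    exact (hK.preimage (by fun_prop)).union (hK.preimage (by fun_prop))
  have hopen : IsOpenMap ψ := by
    intro W hW
    have hq : Topology.IsQuotientMap G.toSurface := isQuotientMap_quotient_mk'
    rw [← hq.isOpen_preimage]
    have hW' : IsOpen (Subtype.val '' W) := hU.isOpenMap_subtype_val W hW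
    have : G.toSurface ⁻¹' (ψ '' W) = (fun y : G.region => (y : ℂ)) ⁻¹' (Subtype.val '' W) ∪
        (fun y : G.region => (y : ℂ) - δ) ⁻¹' (Subtype.val '' W) := by
      ext y
      constructor
      · rintro ⟨w, hw, h⟩
        rcases hmem w y h with h | h
        · exact .inl ⟨w, hw, h.symm⟩
        · exact .inr ⟨w, hw, by simp [h]⟩
      · rintro (⟨w, hw, h⟩ | ⟨w, hw, h⟩)
        · exact ⟨w, hw, (hψ w y (.inl h.symm)).symm⟩
        · exact ⟨w, hw, (hψ w y (.inr (by rw [h]; simp))).symm⟩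
    rw [this]
    exact (hW'.preimage (by fun_prop)).union (hW'.preimage (by fun_prop))
  have : Nonempty U := ⟨⟨x₀, hx₀⟩⟩
  let e₁ := (Topology.IsOpenEmbedding.of_continuous_injective_isOpenMap hcont hinj
    hopen).toOpenPartialHomeomorph
  let e₂ := hU.isOpenEmbedding_subtypeVal.toOpenPartialHomeomorph
  let φ := e₁.symm.trans e₂
  have hφ : ∀ w : U, φ (ψ w) = w := by
    intro w
    have : e₁.symm (e₁ w) = w := e₁.left_inv (by simp [e₁])
    have h' : φ (e₁ w) = (e₁.symm (e₁ w) : U) := rfl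
    rw [this] at h'
    exact h'
  have hsource : φ.source = Set.range ψ := by
    simp [φ, e₁, e₂]
  refine ⟨φ, ⟨?_, ?_⟩, ?_⟩
  · intro s hs
    rw [hsource] at hs
    obtain ⟨w, rfl⟩ := hs
    obtain ⟨x, hx, hxw⟩ := hrep w
    exact hxw ▸ hv w w.2 x hx
  · intro x hx
    rw [hsource] at hx
    obtain ⟨w, hw⟩ := hx
    rcases hmem w x hw with h | h
    · refine ⟨0, ?_⟩
      have : ∀ᶠ y : G.region in 𝓝 x, (y : ℂ) ∈ U :=
        continuous_subtype_val.continuousAt.eventually (hU.mem_nhds (h ▸ w.2))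
      filter_upwards [this] with y hy
      rw [hψ ⟨y, hy⟩ y (.inl rfl), hφ, add_zero]
    · refine ⟨-δ, ?_⟩
      have hc : Continuous fun y : G.region => (y : ℂ) - δ := by fun_prop
      have : ∀ᶠ y : G.region in 𝓝 x, (y : ℂ) - δ ∈ U := by
        refine hc.continuousAt.eventually (hU.mem_nhds ?_)
        simp [h]
      filter_upwards [this] with y hy
      rw [hψ ⟨y - δ, hy⟩ y (.inr (by simp)), hφ]
      exact sub_eq_add_neg _ _
  · rw [hsource]
    exact ⟨⟨x₀, hx₀⟩, (hψ _ x₀ (.inl rfl)).symm⟩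

end PolygonGluing

/-! ### Broken lines with edges directed to the right -/

section BrokenLine

variable {n : ℕ} {η : Fin n → ℂ}

theorem topVertex_zero (η : Fin n → ℂ) : topVertex η 0 = 0 := by
  simp [topVertex]

theorem topVertex_succ (η : Fin n → ℂ) (j : Fin n) :
    topVertex η (j + 1) = topVertex η j + η j := by
  classical
  have : (Finset.univ.filter fun i : Fin n => i.val < j + 1) =
      insert j (Finset.univ.filter fun i : Fin n => i.val < j) := by
    ext i
    simp only [Finset.mem_filter, Finset.mem_univ, true_and, Finset.mem_insert, Fin.ext_iff]
    omega
  rw [topVertex, this, Finset.sum_insert (by simp), add_comm, topVertex]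

theorem topVertex_last (η : Fin n → ℂ) : topVertex η n = ∑ j, η j := by
  simp [topVertex]

theorem botVertex_last (π : Equiv.Perm (Fin n)) (ζ : Fin n → ℂ) :
    botVertex π ζ n = topVertex ζ n := by
  rw [botVertex, topVertex_last, topVertex_last]
  exact Equiv.sum_comp π.symm ζ

/-- The point of the `j`-th edge of the broken line with edges `η` that has parameter `t`. -/
def edgePoint (η : Fin n → ℂ) (j : Fin n) (t : ℝ) : ℂ := topVertex η j + t * η j

/-- The imaginary part of the point with real part `x` on the line through the `j`-th edge. -/
def edgeHeight (η : Fin n → ℂ) (j : Fin n) (x : ℝ) : ℝ :=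
  (topVertex η j).im + (x - (topVertex η j).re) / (η j).re * (η j).im

theorem edgePoint_zero (η : Fin n → ℂ) (j : Fin n) : edgePoint η j 0 = topVertex η j := by
  simp [edgePoint]

theorem edgePoint_one (η : Fin n → ℂ) (j : Fin n) : edgePoint η j 1 = topVertex η (j + 1) := by
  simp [edgePoint, topVertex_succ]

theorem edgePoint_re (η : Fin n → ℂ) (j : Fin n) (t : ℝ) :
    (edgePoint η j t).re = (topVertex η j).re + t * (η j).re := by
  simp [edgePoint]

theorem edgePoint_im (η : Fin n → ℂ) (j : Fin n) (t : ℝ) :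
    (edgePoint η j t).im = (topVertex η j).im + t * (η j).im := by
  simp [edgePoint]

theorem continuous_edgeHeight (η : Fin n → ℂ) (j : Fin n) : Continuous (edgeHeight η j) := by
  unfold edgeHeight
  fun_prop

theorem segment_topVertex (η : Fin n → ℂ) (j : Fin n) :
    segment ℝ (topVertex η j) (topVertex η (j + 1)) = edgePoint η j '' Set.Icc (0 : ℝ) 1 := by
  rw [segment_eq_image', topVertex_succ]
  simp only [add_sub_cancel_left, Complex.real_smul]
  rfl

theorem topVertex_re_lt (hη : ∀ j, 0 < (η j).re) {i k : ℕ} (hik : i < k) (hk : k ≤ n) :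
    (topVertex η i).re < (topVertex η k).re := by
  induction k, hik using Nat.le_induction with
  | base =>
    have := topVertex_succ η ⟨i, hk⟩
    simp only at this
    rw [this, Complex.add_re]
    linarith [hη ⟨i, hk⟩]
  | succ k hik ih =>
    have := topVertex_succ η ⟨k, hk⟩
    simp only at this
    rw [this, Complex.add_re]
    linarith [hη ⟨k, hk⟩, ih (by omega)]

theorem topVertex_re_le (hη : ∀ j, 0 < (η j).re) {i k : ℕ} (hik : i ≤ k) (hk : k ≤ n) :
    (topVertex η i).re ≤ (topVertex η k).re := by
  rcases hik.eq_or_lt with rfl | h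
  · exact le_rfl
  · exact (topVertex_re_lt hη h hk).le

theorem topVertex_injOn (hη : ∀ j, 0 < (η j).re) {i k : ℕ} (hi : i ≤ n) (hk : k ≤ n)
    (h : (topVertex η i).re = (topVertex η k).re) : i = k := by
  rcases lt_trichotomy i k with h' | h' | h'
  · exact absurd h (topVertex_re_lt hη h' hk).ne
  · exact h'
  · exact absurd h (topVertex_re_lt hη h' hi).ne'

theorem edgePoint_re_mem (hη : ∀ j, 0 < (η j).re) {j : Fin n} {t : ℝ} (ht : t ∈ Set.Icc (0 : ℝ) 1) :
    (topVertex η j).re ≤ (edgePoint η j t).re ∧ (edgePoint η j t).re ≤ (topVertex η (j + 1)).re := by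
  rw [edgePoint_re, topVertex_succ, Complex.add_re]
  constructor <;> nlinarith [hη j, ht.1, ht.2]

theorem edgePoint_re_mem_Ioo (hη : ∀ j, 0 < (η j).re) {j : Fin n} {t : ℝ} (ht : t ∈ Set.Ioo (0 : ℝ) 1) :
    (topVertex η j).re < (edgePoint η j t).re ∧ (edgePoint η j t).re < (topVertex η (j + 1)).re := by
  rw [edgePoint_re, topVertex_succ, Complex.add_re]
  constructor <;> nlinarith [hη j, ht.1, ht.2]

theorem edgePoint_im_eq (hη : ∀ j, 0 < (η j).re) (j : Fin n) (t : ℝ) :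
    (edgePoint η j t).im = edgeHeight η j (edgePoint η j t).re := by
  have := (hη j).ne'
  rw [edgeHeight, edgePoint_re, edgePoint_im]
  field_simp
  ring

theorem eq_edgePoint (hη : ∀ j, 0 < (η j).re) {j : Fin n} {z : ℂ} (h₁ : (topVertex η j).re ≤ z.re)
    (h₂ : z.re ≤ (topVertex η (j + 1)).re) (h₃ : z.im = edgeHeight η j z.re) :
    ∃ t ∈ Set.Icc (0 : ℝ) 1, z = edgePoint η j t := by
  have hj := hη j
  rw [topVertex_succ, Complex.add_re] at h₂
  refine ⟨(z.re - (topVertex η j).re) / (η j).re, ⟨div_nonneg (by linarith) hj.le,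
    (div_le_one hj).2 (by linarith)⟩, ?_⟩
  apply Complex.ext
  · rw [edgePoint_re]
    field_simp
    ring
  · rw [edgePoint_im, h₃, edgeHeight]

theorem edgePoint_re_eq (hη : ∀ j, 0 < (η j).re) {i j : Fin n} {s t : ℝ} (hs : s ∈ Set.Icc (0 : ℝ) 1)
    (ht : t ∈ Set.Icc (0 : ℝ) 1) (h : (edgePoint η i s).re = (edgePoint η j t).re) :
    (i = j ∧ s = t) ∨ (s = 1 ∧ t = 0 ∧ (j : ℕ) = i + 1) ∨ (s = 0 ∧ t = 1 ∧ (i : ℕ) = j + 1) := by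
  have aux : ∀ {i j : Fin n} {s t : ℝ}, s ∈ Set.Icc (0 : ℝ) 1 → t ∈ Set.Icc (0 : ℝ) 1 →
      (edgePoint η i s).re = (edgePoint η j t).re → i < j → s = 1 ∧ t = 0 ∧ (j : ℕ) = i + 1 := by
    intro i j s t hs ht h hij
    have h₁ := topVertex_re_le hη (show (i : ℕ) + 1 ≤ j from hij) j.2.le
    have h₂ := edgePoint_re_mem hη (j := i) hs
    have h₃ := edgePoint_re_mem hη (j := j) ht
    have hi := hη i
    have hj := hη j
    have e₁ : (topVertex η (i + 1)).re = (topVertex η j).re := by linarith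
    have e₂ : (edgePoint η i s).re = (topVertex η (i + 1)).re := by linarith
    have e₃ : (edgePoint η j t).re = (topVertex η j).re := by linarith
    refine ⟨?_, ?_, (topVertex_injOn hη (by omega) (by omega) e₁).symm⟩
    · rw [edgePoint_re, topVertex_succ, Complex.add_re] at e₂
      nlinarith
    · rw [edgePoint_re] at e₃
      have : t * (η j).re = 0 := by linarith
      simpa [hj.ne'] using this
  rcases lt_trichotomy i j with hij | rfl | hij
  · exact .inr (.inl (aux hs ht h hij))
  · left
    refine ⟨rfl, ?_⟩
    rw [edgePoint_re, edgePoint_re] at h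
    exact mul_right_cancel₀ (hη i).ne' (by linarith)
  · have := aux ht hs h.symm hij
    exact .inr (.inr ⟨this.2.1, this.1, this.2.2⟩)

theorem edgeHeight_eq (hη : ∀ j, 0 < (η j).re) {i j : Fin n} {x : ℝ}
    (h₁ : (topVertex η i).re ≤ x ∧ x ≤ (topVertex η (i + 1)).re)
    (h₂ : (topVertex η j).re ≤ x ∧ x ≤ (topVertex η (j + 1)).re) :
    edgeHeight η i x = edgeHeight η j x := by
  obtain ⟨s, hs, e₁⟩ := eq_edgePoint hη (z := ⟨x, edgeHeight η i x⟩) h₁.1 h₁.2 rfl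
  obtain ⟨t, ht, e₂⟩ := eq_edgePoint hη (z := ⟨x, edgeHeight η j x⟩) h₂.1 h₂.2 rfl
  have h : (edgePoint η i s).re = (edgePoint η j t).re := by rw [← e₁, ← e₂]
  have : edgePoint η i s = edgePoint η j t := by
    rcases edgePoint_re_eq hη hs ht h with ⟨rfl, rfl⟩ | ⟨rfl, rfl, h'⟩ | ⟨rfl, rfl, h'⟩
    · rfl
    · rw [edgePoint_one, edgePoint_zero, h']
    · rw [edgePoint_one, edgePoint_zero, h']
  rw [← e₁, ← e₂] at this
  exact congrArg Complex.im this

theorem exists_edge (hn : 0 < n) {x : ℝ} (h₀ : 0 ≤ x) (h₁ : x ≤ (topVertex η n).re) :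
    ∃ j : Fin n, (topVertex η j).re ≤ x ∧ x ≤ (topVertex η (j + 1)).re := by
  by_contra! H
  have : ∀ k : ℕ, k ≤ n → (topVertex η k).re ≤ x := by
    intro k
    induction k with
    | zero => intro _; simpa [topVertex_zero] using h₀
    | succ k ih =>
      intro hk
      exact (H ⟨k, hk⟩ (ih (by omega))).le
  have h := H ⟨n - 1, by omega⟩ (this _ (by simp))
  simp only [Nat.sub_add_cancel hn] at h
  linarith

theorem topVertex_edge {k : ℕ} (hn : 0 < n) (hk : k ≤ n) :
    ∃ j : Fin n, ∃ t ∈ Set.Icc (0 : ℝ) 1, topVertex η k = edgePoint η j t := by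
  rcases hk.eq_or_lt with rfl | h
  · refine ⟨⟨k - 1, by omega⟩, 1, by simp, ?_⟩
    rw [edgePoint_one]
    simp [Nat.sub_add_cancel hn]
  · exact ⟨⟨k, h⟩, 0, by simp, (edgePoint_zero η ⟨k, h⟩).symm⟩

end BrokenLine

/-! ### Suspensions bounded by a simple closed polygon -/

section SimpleSuspension

variable {n : ℕ} {π : Equiv.Perm (Fin n)} {ζ : Fin n → ℂ}

/-- The edges of the polygon of `M(π, ζ)` are directed to the right, and the top broken line lies
strictly above the bottom one, except at the common end points. -/
structure IsSimpleSuspension (π : Equiv.Perm (Fin n)) (ζ : Fin n → ℂ) : Prop where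
  pos : 0 < n
  re_pos : ∀ j, 0 < (ζ j).re
  sep : ∀ i j, ∀ s ∈ Set.Icc (0 : ℝ) 1, ∀ t ∈ Set.Icc (0 : ℝ) 1,
    (edgePoint ζ i s).re = (edgePoint (fun j => ζ (π.symm j)) j t).re →
    0 < (edgePoint ζ i s).re → (edgePoint ζ i s).re < (topVertex ζ n).re →
    (edgePoint (fun j => ζ (π.symm j)) j t).im < (edgePoint ζ i s).im

namespace IsSimpleSuspension

variable (h : IsSimpleSuspension π ζ)

theorem bot_re_pos (h : IsSimpleSuspension π ζ) (j : Fin n) : 0 < (ζ (π.symm j)).re := h.re_pos _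

theorem mem_region_iff (h : IsSimpleSuspension π ζ) {z : ℂ} :
    z ∈ (suspension π ζ).region ↔ 0 ≤ z.re ∧ z.re ≤ (topVertex ζ n).re ∧
      (∀ i : Fin n, (topVertex ζ i).re ≤ z.re ∧ z.re ≤ (topVertex ζ (i + 1)).re →
        z.im ≤ edgeHeight ζ i z.re) ∧
      ∀ j : Fin n, (botVertex π ζ j).re ≤ z.re ∧ z.re ≤ (botVertex π ζ (j + 1)).re →
        edgeHeight (fun j => ζ (π.symm j)) j z.re ≤ z.im := by
  have hT := h.re_pos
  have hB := h.bot_re_pos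
  have hle : ∀ i j : Fin n, ∀ s ∈ Set.Icc (0 : ℝ) 1, ∀ t ∈ Set.Icc (0 : ℝ) 1,
    (edgePoint ζ i s).re = (edgePoint (fun j => ζ (π.symm j)) j t).re →
    (edgePoint (fun j => ζ (π.symm j)) j t).im ≤ (edgePoint ζ i s).im := by
    intro i j s hs t ht he
    have h₀ : 0 ≤ (topVertex ζ i).re := by
      simpa [topVertex_zero] using topVertex_re_le hT (Nat.zero_le i) i.2.le
    have h₁ := edgePoint_re_mem hT (j := i) hs
    have h₂ := topVertex_re_le hT (show (i : ℕ) + 1 ≤ n from i.2) le_rfl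
    have hend : ∀ k : ℕ, k ≤ n → topVertex ζ k = botVertex π ζ k →
        (edgePoint ζ i s).re = (topVertex ζ k).re →
        (edgePoint (fun j => ζ (π.symm j)) j t).im ≤ (edgePoint ζ i s).im := by
      intro k hk hTB hk'
      obtain ⟨i', s', hs', e₁⟩ := topVertex_edge (η := ζ) h.pos hk
      obtain ⟨j', t', ht', e₂⟩ := topVertex_edge (η := fun j => ζ (π.symm j)) h.pos hk
      have a₁ : edgePoint ζ i s = topVertex ζ k := by
        apply Complex.ext hk'
        rw [edgePoint_im_eq hT, hk', edgeHeight_eq hT (i := i) (j := i') (hk' ▸ h₁)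
          (by rw [e₁]; exact edgePoint_re_mem hT hs'), e₁, ← edgePoint_im_eq hT]
      have a₂ : edgePoint (fun j => ζ (π.symm j)) j t = botVertex π ζ k := by
        have hk'' : (edgePoint (fun j => ζ (π.symm j)) j t).re = (botVertex π ζ k).re := by
          rw [← he, hk', hTB]
        apply Complex.ext hk''
        rw [edgePoint_im_eq hB, hk'', botVertex, edgeHeight_eq hB (i := j) (j := j')
          (by
            have := edgePoint_re_mem hB (j := j) ht
            rw [hk''] at this; exact this)
          (by rw [e₂]; exact edgePoint_re_mem hB ht'), e₂, ← edgePoint_im_eq hB]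
      rw [a₁, a₂, hTB]
    rcases (h₀.trans h₁.1).eq_or_lt with h0 | h0
    · exact hend 0 (Nat.zero_le _) (by simp [botVertex, topVertex_zero])
        (by simp [topVertex_zero, ← h0])
    rcases (h₁.2.trans h₂).eq_or_lt with hn | hn
    · exact hend n le_rfl (botVertex_last π ζ).symm hn
    · exact (h.sep i j s hs t ht he h0 hn).le
  constructor
  · rintro ⟨a, ha, b, hb, hra, hrb, hia, hib⟩
    have cases' : ∀ c ∈ (⋃ j : Fin n, segment ℝ (topVertex ζ j) (topVertex ζ (j + 1))) ∪
      ⋃ j : Fin n, segment ℝ (botVertex π ζ j) (botVertex π ζ (j + 1)),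
      (∃ i, ∃ s ∈ Set.Icc (0 : ℝ) 1, c = edgePoint ζ i s) ∨
      ∃ j, ∃ t ∈ Set.Icc (0 : ℝ) 1, c = edgePoint (fun j => ζ (π.symm j)) j t := by
      intro c hc
      simp only [botVertex, segment_topVertex, Set.mem_union, Set.mem_iUnion, Set.mem_image] at hc
      rcases hc with ⟨i, s, hs, rfl⟩ | ⟨i, s, hs, rfl⟩
      · exact .inl ⟨i, s, hs, rfl⟩
      · exact .inr ⟨i, s, hs, rfl⟩
    have hre : 0 ≤ z.re ∧ z.re ≤ (topVertex ζ n).re := by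
      rw [← hra]
      rcases cases' a ha with ⟨i, s, hs, rfl⟩ | ⟨i, s, hs, rfl⟩
      · have h₀ : 0 ≤ (topVertex ζ i).re := by
          simpa [topVertex_zero] using topVertex_re_le hT (Nat.zero_le i) i.2.le
        have h₁ := edgePoint_re_mem hT (j := i) hs
        have h₂ := topVertex_re_le hT (show (i : ℕ) + 1 ≤ n from i.2) le_rfl
        exact ⟨h₀.trans h₁.1, h₁.2.trans h₂⟩
      · have h₀ : 0 ≤ (topVertex (fun j => ζ (π.symm j)) i).re := by
          simpa [topVertex_zero] using topVertex_re_le hB (Nat.zero_le i) i.2.le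
        have h₁ := edgePoint_re_mem hB (j := i) hs
        have h₂ := topVertex_re_le hB (show (i : ℕ) + 1 ≤ n from i.2) le_rfl
        have h₃ := congrArg Complex.re (botVertex_last π ζ)
        rw [botVertex] at h₃
        exact ⟨h₀.trans h₁.1, (h₁.2.trans h₂).trans h₃.le⟩
    refine ⟨hre.1, hre.2, fun i hi => ?_, fun j hj => ?_⟩
    · obtain ⟨s, hs, e₁⟩ := eq_edgePoint hT (j := i) (z := ⟨z.re, edgeHeight ζ i z.re⟩) hi.1 hi.2 rfl
      have : b.im ≤ (edgePoint ζ i s).im := by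
        rcases cases' b hb with ⟨i', s', hs', rfl⟩ | ⟨i', s', hs', rfl⟩
        · have hi' := edgePoint_re_mem hT (j := i') hs'
          rw [edgePoint_im_eq hT, edgePoint_im_eq hT, ← e₁, hrb]
          rw [hrb] at hi'
          exact (edgeHeight_eq hT hi' hi).le
        · exact hle i i' s hs s' hs' (by rw [← e₁, hrb])
      rw [← e₁] at this
      exact hib.trans this
    · obtain ⟨s, hs, e₁⟩ := eq_edgePoint hB (j := j)
        (z := ⟨z.re, edgeHeight (fun j => ζ (π.symm j)) j z.re⟩) hj.1 hj.2 rfl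
      have : (edgePoint (fun j => ζ (π.symm j)) j s).im ≤ a.im := by
        rcases cases' a ha with ⟨i', s', hs', rfl⟩ | ⟨i', s', hs', rfl⟩
        · exact hle i' j s' hs' s hs (by rw [← e₁, hra])
        · have hi' := edgePoint_re_mem hB (j := i') hs'
          rw [edgePoint_im_eq hB, edgePoint_im_eq hB, ← e₁, hra]
          rw [hra] at hi'
          exact (edgeHeight_eq hB hj hi').le
      rw [← e₁] at this
      exact this.trans hia
  · rintro ⟨h₀, h₁, htop, hbot⟩
    obtain ⟨i, hi⟩ := exists_edge (η := ζ) h.pos h₀ h₁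
    obtain ⟨j, hj⟩ := exists_edge (η := fun j => ζ (π.symm j)) h.pos h₀
      (h₁.trans (congrArg Complex.re (botVertex_last π ζ)).ge)
    obtain ⟨s, hs, e₁⟩ := eq_edgePoint hT (j := i) (z := ⟨z.re, edgeHeight ζ i z.re⟩) hi.1 hi.2 rfl
    obtain ⟨t, ht, e₂⟩ := eq_edgePoint hB (j := j)
        (z := ⟨z.re, edgeHeight (fun j => ζ (π.symm j)) j z.re⟩) hj.1 hj.2 rfl
    refine ⟨⟨z.re, edgeHeight (fun j => ζ (π.symm j)) j z.re⟩, .inr (Set.mem_iUnion.2 ⟨j, ?_⟩),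
      ⟨z.re, edgeHeight ζ i z.re⟩, .inl (Set.mem_iUnion.2 ⟨i, ?_⟩), rfl, rfl,
      hbot j hj, htop i hi⟩
    · rw [botVertex, botVertex, segment_topVertex]
      exact ⟨t, ht, e₂.symm⟩
    · rw [segment_topVertex]
      exact ⟨s, hs, e₁.symm⟩

theorem isFiniteConvexUnion_region (π : Equiv.Perm (Fin n)) (ζ : Fin n → ℂ) :
    IsFiniteConvexUnion (suspension π ζ).region := by
  refine IsFiniteConvexUnion.verticalHull ?_
  refine .of_finite (ι := Fin n ⊕ Fin n)
    (Sum.elim (fun j => segment ℝ (topVertex ζ j) (topVertex ζ (j + 1)))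
      (fun j => segment ℝ (botVertex π ζ j) (botVertex π ζ (j + 1)))) ?_ ?_ ?_
  · rintro (j | j) <;> exact isCompact_segment _ _
  · rintro (j | j) <;> exact convex_segment _ _
  · rw [Set.iUnion_sum]
    rfl

theorem edgePoint_top_mem (π : Equiv.Perm (Fin n)) (ζ : Fin n → ℂ) (j : Fin n) {t : ℝ}
    (ht : t ∈ Set.Icc (0 : ℝ) 1) : edgePoint ζ j t ∈ (suspension π ζ).region := by
  refine subset_verticalHull _ (.inl (Set.mem_iUnion.2 ⟨j, ?_⟩))
  rw [segment_topVertex]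
  exact ⟨t, ht, rfl⟩

theorem edgePoint_bot_mem (π : Equiv.Perm (Fin n)) (ζ : Fin n → ℂ) (j : Fin n) {t : ℝ}
    (ht : t ∈ Set.Icc (0 : ℝ) 1) :
    edgePoint (fun j => ζ (π.symm j)) j t ∈ (suspension π ζ).region := by
  refine subset_verticalHull _ (.inr (Set.mem_iUnion.2 ⟨j, ?_⟩))
  rw [botVertex, botVertex, segment_topVertex]
  exact ⟨t, ht, rfl⟩

theorem sideRel_iff {x y : (suspension π ζ).region} :
    (suspension π ζ).sideRel x y ↔ ∃ j, ∃ t ∈ Set.Icc (0 : ℝ) 1,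
      (x : ℂ) = edgePoint ζ j t ∧ (y : ℂ) = edgePoint (fun j => ζ (π.symm j)) (π j) t := by
  simp [PolygonGluing.sideRel, edgePoint, suspension, botVertex]

/-- The vertices of the polygon of `M(π, ζ)`. -/
def IsVertexPoint (π : Equiv.Perm (Fin n)) (ζ : Fin n → ℂ) (z : ℂ) : Prop :=
  ∃ k ≤ n, z = topVertex ζ k ∨ z = botVertex π ζ k

theorem isVertexPoint_top (π : Equiv.Perm (Fin n)) (ζ : Fin n → ℂ) {j : Fin n} {t : ℝ}
    (ht : t = 0 ∨ t = 1) : IsVertexPoint π ζ (edgePoint ζ j t) := by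
  rcases ht with rfl | rfl
  · exact ⟨j, j.2.le, .inl (edgePoint_zero _ _)⟩
  · exact ⟨j + 1, j.2, .inl (edgePoint_one _ _)⟩

theorem isVertexPoint_bot (π : Equiv.Perm (Fin n)) (ζ : Fin n → ℂ) {j : Fin n} {t : ℝ}
    (ht : t = 0 ∨ t = 1) : IsVertexPoint π ζ (edgePoint (fun j => ζ (π.symm j)) j t) := by
  rcases ht with rfl | rfl
  · exact ⟨j, j.2.le, .inr (edgePoint_zero _ _)⟩
  · exact ⟨j + 1, j.2, .inr (edgePoint_one _ _)⟩

theorem finite_isVertexPoint (π : Equiv.Perm (Fin n)) (ζ : Fin n → ℂ) :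
    {z | IsVertexPoint π ζ z}.Finite := by
  have : {z | IsVertexPoint π ζ z} ⊆
      (topVertex ζ '' Set.Iic n) ∪ (botVertex π ζ '' Set.Iic n) := by
    rintro z ⟨k, hk, rfl | rfl⟩
    · exact .inl ⟨k, hk, rfl⟩
    · exact .inr ⟨k, hk, rfl⟩
  exact (((Set.finite_Iic n).image _).union ((Set.finite_Iic n).image _)).subset this

theorem finite_isVertexPoint_region (π : Equiv.Perm (Fin n)) (ζ : Fin n → ℂ) :
    {x : (suspension π ζ).region | IsVertexPoint π ζ x}.Finite :=
  Set.Finite.of_finite_image ((finite_isVertexPoint π ζ).subset (by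
    rintro _ ⟨x, hx, rfl⟩
    exact hx)) Subtype.val_injective.injOn

/-- The top edges other than their end points lie strictly between the vertical lines bounding the
polygon. -/
theorem edgePoint_re_bounds {η : Fin n → ℂ} (hη : ∀ j, 0 < (η j).re) {j : Fin n} {t : ℝ}
    (ht : t ∈ Set.Ioo (0 : ℝ) 1) :
    0 < (edgePoint η j t).re ∧ (edgePoint η j t).re < (topVertex η n).re := by
  have h₀ : 0 ≤ (topVertex η j).re := by
    simpa [topVertex_zero] using topVertex_re_le hη (Nat.zero_le j) j.2.le
  have h₁ := edgePoint_re_mem_Ioo hη (j := j) ht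
  have h₂ := topVertex_re_le hη (show (j : ℕ) + 1 ≤ n from j.2) le_rfl
  exact ⟨h₀.trans_lt h₁.1, h₁.2.trans_le h₂⟩

theorem Ioo_of_ne {t : ℝ} (ht : t ∈ Set.Icc (0 : ℝ) 1) (h : ¬ (t = 0 ∨ t = 1)) :
    t ∈ Set.Ioo (0 : ℝ) 1 := by
  rw [not_or] at h
  exact ⟨ht.1.lt_of_ne' h.1, ht.2.lt_of_ne h.2⟩

theorem top_ne_bot (h : IsSimpleSuspension π ζ) {i j : Fin n} {s t : ℝ}
    (hs : s ∈ Set.Icc (0 : ℝ) 1) (ht : t ∈ Set.Icc (0 : ℝ) 1)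
    (he : edgePoint ζ i s = edgePoint (fun j => ζ (π.symm j)) j t) :
    (s = 0 ∨ s = 1) ∧ (t = 0 ∨ t = 1) := by
  have hlast := congrArg Complex.re (botVertex_last π ζ)
  rw [botVertex] at hlast
  constructor
  · by_contra hs'
    have := edgePoint_re_bounds h.re_pos (j := i) (Ioo_of_ne hs hs')
    have h' := h.sep i j s hs t ht (by rw [he]) this.1 this.2
    rw [he] at h'
    exact lt_irrefl _ h'
  · by_contra ht'
    have := edgePoint_re_bounds h.bot_re_pos (j := j) (Ioo_of_ne ht ht')
    have h' := h.sep i j s hs t ht (by rw [he]) (by rw [he]; exact this.1)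
      (by rw [he, ← hlast]; exact this.2)
    rw [he] at h'
    exact lt_irrefl _ h'

theorem edgePoint_eq {η : Fin n → ℂ} (hη : ∀ j, 0 < (η j).re) {i j : Fin n} {s t : ℝ}
    (hs : s ∈ Set.Icc (0 : ℝ) 1) (ht : t ∈ Set.Icc (0 : ℝ) 1)
    (h : edgePoint η i s = edgePoint η j t) :
    (i = j ∧ s = t) ∨ ((s = 0 ∨ s = 1) ∧ (t = 0 ∨ t = 1)) := by
  rcases edgePoint_re_eq hη hs ht (congrArg Complex.re h) with h | h | h
  · exact .inl h
  · exact .inr ⟨.inr h.1, .inl h.2.1⟩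
  · exact .inr ⟨.inl h.1, .inr h.2.1⟩

theorem isVertexPoint_top_iff (h : IsSimpleSuspension π ζ) {j : Fin n} {t : ℝ}
    (ht : t ∈ Set.Icc (0 : ℝ) 1) :
    IsVertexPoint π ζ (edgePoint ζ j t) ↔ t = 0 ∨ t = 1 := by
  refine ⟨?_, isVertexPoint_top π ζ⟩
  rintro ⟨k, hk, hk' | hk'⟩
  · obtain ⟨i, s, hs, e⟩ := topVertex_edge (η := ζ) h.pos hk
    rcases hk.eq_or_lt with rfl | hk₁
    · by_contra hc
      have := (edgePoint_re_bounds h.re_pos (j := j) (Ioo_of_ne ht hc)).2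
      rw [hk'] at this
      exact lt_irrefl _ this
    · rw [← edgePoint_zero ζ ⟨k, hk₁⟩] at hk'
      rcases edgePoint_eq h.re_pos ht (by simp) hk' with h' | h'
      · exact .inl h'.2
      · exact h'.1
  · obtain ⟨i, s, hs, e⟩ := topVertex_edge (η := fun j => ζ (π.symm j)) h.pos hk
    rw [botVertex, e] at hk'
    exact (h.top_ne_bot ht hs hk').1

theorem isVertexPoint_bot_iff (h : IsSimpleSuspension π ζ) {j : Fin n} {t : ℝ}
    (ht : t ∈ Set.Icc (0 : ℝ) 1) :
    IsVertexPoint π ζ (edgePoint (fun j => ζ (π.symm j)) j t) ↔ t = 0 ∨ t = 1 := by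
  refine ⟨?_, isVertexPoint_bot π ζ⟩
  rintro ⟨k, hk, hk' | hk'⟩
  · obtain ⟨i, s, hs, e⟩ := topVertex_edge (η := ζ) h.pos hk
    rw [e] at hk'
    exact (h.top_ne_bot hs ht hk'.symm).2
  · rcases hk.eq_or_lt with rfl | hk₁
    · by_contra hc
      have := (edgePoint_re_bounds h.bot_re_pos (j := j) (Ioo_of_ne ht hc)).2
      rw [hk'] at this
      exact lt_irrefl _ this
    · rw [botVertex, ← edgePoint_zero (fun j => ζ (π.symm j)) ⟨k, hk₁⟩] at hk'
      rcases edgePoint_eq h.bot_re_pos ht (by simp) hk' with h' | h'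
      · exact .inl h'.2
      · exact h'.1

theorem sideRel_vertex (h : IsSimpleSuspension π ζ) {x y : (suspension π ζ).region}
    (hxy : (suspension π ζ).sideRel x y) : IsVertexPoint π ζ x ↔ IsVertexPoint π ζ y := by
  obtain ⟨j, t, ht, hx, hy⟩ := sideRel_iff.1 hxy
  rw [hx, hy, h.isVertexPoint_top_iff ht, h.isVertexPoint_bot_iff ht]

theorem eqvGen_cases (h : IsSimpleSuspension π ζ) {x y : (suspension π ζ).region}
    (hxy : Relation.EqvGen (suspension π ζ).sideRel x y) :
    x = y ∨ (suspension π ζ).sideRel x y ∨ (suspension π ζ).sideRel y x ∨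
      (IsVertexPoint π ζ x ∧ IsVertexPoint π ζ y) := by
  have hinjT : ∀ x y z : (suspension π ζ).region, (suspension π ζ).sideRel y x →
      (suspension π ζ).sideRel y z → x = z ∨ (IsVertexPoint π ζ x ∧ IsVertexPoint π ζ z) := by
    intro x y z h₁ h₂
    obtain ⟨j, t, ht, hy, hx⟩ := sideRel_iff.1 h₁
    obtain ⟨i, s, hs, hy', hz⟩ := sideRel_iff.1 h₂
    rcases edgePoint_eq h.re_pos ht hs (hy.symm.trans hy') with ⟨rfl, rfl⟩ | h'
    · exact .inl (Subtype.ext (hx.trans hz.symm))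
    · refine .inr ⟨(h.sideRel_vertex h₁).1 ?_, (h.sideRel_vertex h₂).1 ?_⟩ <;>
      · rw [hy]; exact isVertexPoint_top π ζ h'.1
  have hinjB : ∀ x y z : (suspension π ζ).region, (suspension π ζ).sideRel x y →
      (suspension π ζ).sideRel z y → x = z ∨ (IsVertexPoint π ζ x ∧ IsVertexPoint π ζ z) := by
    intro x y z h₁ h₂
    obtain ⟨j, t, ht, hx, hy⟩ := sideRel_iff.1 h₁
    obtain ⟨i, s, hs, hz, hy'⟩ := sideRel_iff.1 h₂
    rcases edgePoint_eq h.bot_re_pos ht hs (hy.symm.trans hy') with ⟨h', rfl⟩ | h'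
    · obtain rfl := π.injective h'
      exact .inl (Subtype.ext (hx.trans hz.symm))
    · refine .inr ⟨(h.sideRel_vertex h₁).2 ?_, (h.sideRel_vertex h₂).2 ?_⟩ <;>
      · rw [hy]; exact isVertexPoint_bot π ζ h'.1
  have hboth : ∀ x y z : (suspension π ζ).region, (suspension π ζ).sideRel x y →
      (suspension π ζ).sideRel y z → IsVertexPoint π ζ x ∧ IsVertexPoint π ζ z := by
    intro x y z h₁ h₂
    obtain ⟨j, t, ht, hx, hy⟩ := sideRel_iff.1 h₁
    obtain ⟨i, s, hs, hy', hz⟩ := sideRel_iff.1 h₂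
    have hv : IsVertexPoint π ζ y := by
      rw [hy]
      exact isVertexPoint_bot π ζ (h.top_ne_bot hs ht (hy'.symm.trans hy)).2
    exact ⟨(h.sideRel_vertex h₁).2 hv, (h.sideRel_vertex h₂).1 hv⟩
  induction hxy with
  | rel x y h' => exact .inr (.inl h')
  | refl x => exact .inl rfl
  | symm x y _ ih =>
    rcases ih with rfl | ih | ih | ih
    · exact .inl rfl
    · exact .inr (.inr (.inl ih))
    · exact .inr (.inl ih)
    · exact .inr (.inr (.inr ih.symm))
  | trans x y z _ _ ih₁ ih₂ =>
    have fin : (x = z ∨ (IsVertexPoint π ζ x ∧ IsVertexPoint π ζ z)) → x = z ∨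
        (suspension π ζ).sideRel x z ∨ (suspension π ζ).sideRel z x ∨
        (IsVertexPoint π ζ x ∧ IsVertexPoint π ζ z) := by
      rintro (h' | h')
      · exact .inl h'
      · exact .inr (.inr (.inr h'))
    rcases ih₁ with rfl | h₁ | h₁ | h₁
    · exact ih₂
    all_goals rcases ih₂ with rfl | h₂ | h₂ | h₂
    · exact .inr (.inl h₁)
    · exact fin (.inr (hboth x y z h₁ h₂))
    · exact fin (hinjB x y z h₁ h₂)
    · exact fin (.inr ⟨(h.sideRel_vertex h₁).2 h₂.1, h₂.2⟩)
    · exact .inr (.inr (.inl h₁))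
    · exact fin (hinjT x y z h₁ h₂)
    · exact fin (.inr (hboth z y x h₂ h₁).symm)
    · exact fin (.inr ⟨(h.sideRel_vertex h₁).1 h₂.1, h₂.2⟩)
    · exact .inr (.inr (.inr h₁))
    · exact fin (.inr ⟨h₁.1, (h.sideRel_vertex h₂).1 h₁.2⟩)
    · exact fin (.inr ⟨h₁.1, (h.sideRel_vertex h₂).2 h₁.2⟩)
    · exact fin (.inr ⟨h₁.1, h₂.2⟩)

theorem toSurface_eq_cases (h : IsSimpleSuspension π ζ) {x y : (suspension π ζ).region}
    (hxy : (suspension π ζ).toSurface x = (suspension π ζ).toSurface y) :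
    x = y ∨ (suspension π ζ).sideRel x y ∨ (suspension π ζ).sideRel y x ∨
      (IsVertexPoint π ζ x ∧ IsVertexPoint π ζ y) :=
  h.eqvGen_cases (Quotient.exact hxy)

theorem isVertexPoint_iff_exists_side (hn : 0 < n) (z : ℂ) : IsVertexPoint π ζ z ↔
    ∃ j, z ∈ ({(suspension π ζ).startA j, (suspension π ζ).startA j + (suspension π ζ).vec j,
      (suspension π ζ).startB j, (suspension π ζ).startB j + (suspension π ζ).vec j} : Set ℂ) := by
  have hB : ∀ j : Fin n, botVertex π ζ (π j) + ζ j = botVertex π ζ (π j + 1) := by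
    intro j
    rw [botVertex, botVertex, topVertex_succ]
    simp
  simp only [suspension, Set.mem_insert_iff, Set.mem_singleton_iff, ← topVertex_succ, hB]
  constructor
  · rintro ⟨k, hk, hk'⟩
    rcases hk.eq_or_lt with rfl | hk
    · rcases hk' with rfl | rfl
      · exact ⟨⟨k - 1, by omega⟩, .inr (.inl (by simp [Nat.sub_add_cancel hn]))⟩
      · exact ⟨π.symm ⟨k - 1, by omega⟩, .inr (.inr (.inr (by simp [Nat.sub_add_cancel hn])))⟩
    · rcases hk' with rfl | rfl
      · exact ⟨⟨k, hk⟩, .inl rfl⟩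
      · exact ⟨π.symm ⟨k, hk⟩, .inr (.inr (.inl (by simp)))⟩
  · rintro ⟨j, rfl | rfl | rfl | rfl⟩
    · exact ⟨j, j.2.le, .inl rfl⟩
    · exact ⟨j + 1, j.2, .inl rfl⟩
    · exact ⟨π j, (π j).2.le, .inr rfl⟩
    · exact ⟨π j + 1, (π j).2, .inr rfl⟩

theorem mem_vertices_iff (h : IsSimpleSuspension π ζ) (x : (suspension π ζ).region) :
    (suspension π ζ).toSurface x ∈ (suspension π ζ).vertices ↔ IsVertexPoint π ζ x := by
  constructor
  · rintro ⟨y, hyx, hy⟩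
    rw [← isVertexPoint_iff_exists_side h.pos] at hy
    rcases h.toSurface_eq_cases hyx with rfl | h' | h' | h'
    · exact hy
    · exact (h.sideRel_vertex h').1 hy
    · exact (h.sideRel_vertex h').2 hy
    · exact h'.2
  · intro hx
    exact ⟨x, rfl, (isVertexPoint_iff_exists_side h.pos _).1 hx⟩

theorem finite_vertices (h : IsSimpleSuspension π ζ) : (suspension π ζ).vertices.Finite := by
  have hfin := finite_isVertexPoint_region π ζ
  refine (hfin.image (suspension π ζ).toSurface).subset ?_
  intro s hs
  obtain ⟨x, rfl⟩ := PolygonGluing.toSurface_surjective s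
  exact ⟨x, (h.mem_vertices_iff x).1 hs, rfl⟩

theorem isClosed_glue (h : IsSimpleSuspension π ζ) :
    IsClosed {p : (suspension π ζ).region × (suspension π ζ).region |
      (suspension π ζ).glueSetoid p.1 p.2} := by
  let G := suspension π ζ
  have hside : IsClosed {p : G.region × G.region | G.sideRel p.1 p.2} := by
    have : {p : G.region × G.region | G.sideRel p.1 p.2} = ⋃ j : Fin n,
        (fun p : G.region × G.region => ((p.1 : ℂ), (p.2 : ℂ))) ⁻¹'
          ((fun t : ℝ => (edgePoint ζ j t, edgePoint (fun j => ζ (π.symm j)) (π j) t)) ''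
            Set.Icc 0 1) := by
      ext ⟨x, y⟩
      simp only [Set.mem_ofPred_eq, Set.mem_iUnion, Set.mem_preimage, Set.mem_image, Prod.mk.injEq]
      rw [sideRel_iff]
      simp only [eq_comm]
    rw [this]
    refine isClosed_iUnion_of_finite fun j => IsClosed.preimage (by fun_prop) ?_
    refine (isCompact_Icc.image ?_).isClosed
    unfold edgePoint
    fun_prop
  have hvfin := finite_isVertexPoint_region π ζ
  have hv : ({p : G.region × G.region | G.glueSetoid p.1 p.2} ∩
      {x : G.region | IsVertexPoint π ζ x} ×ˢ {x : G.region | IsVertexPoint π ζ x}).Finite :=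
    (hvfin.prod hvfin).inter_of_right _
  have hunion : {p : G.region × G.region | G.glueSetoid p.1 p.2} =
      ({p : G.region × G.region | p.1 = p.2} ∪ ({p : G.region × G.region | G.sideRel p.1 p.2} ∪
        Prod.swap ⁻¹' {p : G.region × G.region | G.sideRel p.1 p.2})) ∪
      ({p : G.region × G.region | G.glueSetoid p.1 p.2} ∩
      {x : G.region | IsVertexPoint π ζ x} ×ˢ {x : G.region | IsVertexPoint π ζ x}) := by
    ext ⟨x, y⟩
    constructor
    · intro hxy
      rcases h.eqvGen_cases hxy with h' | h' | h' | h'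
      · exact .inl (.inl h')
      · exact .inl (.inr (.inl h'))
      · exact .inl (.inr (.inr h'))
      · exact .inr ⟨hxy, h'⟩
    · rintro ((h' | h' | h') | h')
      · obtain rfl : x = y := h'
        exact Relation.EqvGen.refl _
      · exact Relation.EqvGen.rel _ _ h'
      · exact Relation.EqvGen.symm _ _ (Relation.EqvGen.rel _ _ h')
      · exact h'.1
  show IsClosed {p : G.region × G.region | G.glueSetoid p.1 p.2}
  rw [hunion]
  refine ((isClosed_eq continuous_fst continuous_snd).union
    (hside.union (hside.preimage continuous_swap))).union hv.isClosed

end IsSimpleSuspension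

end SimpleSuspension

namespace IsSimpleSuspension

variable {n : ℕ} {π : Equiv.Perm (Fin n)} {ζ : Fin n → ℂ}

/-- The points lying strictly below all edges of a broken line that they meet vertically. -/
def strictlyBelow (η : Fin n → ℂ) : Set ℂ :=
  {z | ∀ i : Fin n, (topVertex η i).re ≤ z.re ∧ z.re ≤ (topVertex η (i + 1)).re →
    z.im < edgeHeight η i z.re}

/-- The points lying strictly above all edges of a broken line that they meet vertically. -/
def strictlyAbove (η : Fin n → ℂ) : Set ℂ :=
  {z | ∀ i : Fin n, (topVertex η i).re ≤ z.re ∧ z.re ≤ (topVertex η (i + 1)).re →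
    edgeHeight η i z.re < z.im}

theorem isOpen_strictlyBelow (η : Fin n → ℂ) : IsOpen (strictlyBelow η) := by
  have : strictlyBelow η = ⋂ i : Fin n, ({z | (topVertex η i).re ≤ z.re} ∩
      {z | z.re ≤ (topVertex η (i + 1)).re} ∩ {z | edgeHeight η i z.re ≤ z.im})ᶜ := by
    ext z
    simp only [strictlyBelow, Set.mem_ofPred_eq, Set.mem_iInter, Set.mem_compl_iff,
      Set.mem_inter_iff]
    exact forall_congr' fun i => ⟨fun h h' => (h h'.1).not_ge h'.2,
      fun h h' => not_le.1 fun h'' => h ⟨h', h''⟩⟩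
  rw [this]
  refine isOpen_iInter_of_finite fun i => IsClosed.isOpen_compl (self := ?_)
  exact ((isClosed_le continuous_const Complex.continuous_re).inter
    (isClosed_le Complex.continuous_re continuous_const)).inter
    (isClosed_le ((continuous_edgeHeight η i).comp Complex.continuous_re) Complex.continuous_im)

theorem isOpen_strictlyAbove (η : Fin n → ℂ) : IsOpen (strictlyAbove η) := by
  have : strictlyAbove η = ⋂ i : Fin n, ({z | (topVertex η i).re ≤ z.re} ∩
      {z | z.re ≤ (topVertex η (i + 1)).re} ∩ {z | z.im ≤ edgeHeight η i z.re})ᶜ := by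
    ext z
    simp only [strictlyAbove, Set.mem_ofPred_eq, Set.mem_iInter, Set.mem_compl_iff,
      Set.mem_inter_iff]
    exact forall_congr' fun i => ⟨fun h h' => (h h'.1).not_ge h'.2,
      fun h h' => not_le.1 fun h'' => h ⟨h', h''⟩⟩
  rw [this]
  refine isOpen_iInter_of_finite fun i => IsClosed.isOpen_compl (self := ?_)
  exact ((isClosed_le continuous_const Complex.continuous_re).inter
    (isClosed_le Complex.continuous_re continuous_const)).inter
    (isClosed_le Complex.continuous_im ((continuous_edgeHeight η i).comp Complex.continuous_re))

theorem edgePoint_notMem_strictlyBelow {η : Fin n → ℂ} (hη : ∀ j, 0 < (η j).re) {j : Fin n} {t : ℝ}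
    (ht : t ∈ Set.Icc (0 : ℝ) 1) : edgePoint η j t ∉ strictlyBelow η := fun h =>
  (h j (edgePoint_re_mem hη ht)).ne (edgePoint_im_eq hη j t)

theorem edgePoint_notMem_strictlyAbove {η : Fin n → ℂ} (hη : ∀ j, 0 < (η j).re) {j : Fin n} {t : ℝ}
    (ht : t ∈ Set.Icc (0 : ℝ) 1) : edgePoint η j t ∉ strictlyAbove η := fun h =>
  (h j (edgePoint_re_mem hη ht)).ne' (edgePoint_im_eq hη j t)

theorem top_strictlyAbove (h : IsSimpleSuspension π ζ) {j : Fin n} {t : ℝ}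
    (ht : t ∈ Set.Ioo (0 : ℝ) 1) :
    edgePoint ζ j t ∈ strictlyAbove fun j => ζ (π.symm j) := by
  intro i hi
  have hb := edgePoint_re_bounds h.re_pos (j := j) ht
  obtain ⟨s, hs, e⟩ := eq_edgePoint h.bot_re_pos (j := i)
    (z := ⟨(edgePoint ζ j t).re, edgeHeight (fun j => ζ (π.symm j)) i (edgePoint ζ j t).re⟩)
    hi.1 hi.2 rfl
  have := h.sep j i t ⟨ht.1.le, ht.2.le⟩ s hs (by rw [← e]) hb.1 hb.2
  rwa [← e] at this

theorem bot_strictlyBelow (h : IsSimpleSuspension π ζ) {j : Fin n} {t : ℝ}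
    (ht : t ∈ Set.Ioo (0 : ℝ) 1) :
    edgePoint (fun j => ζ (π.symm j)) j t ∈ strictlyBelow ζ := by
  intro i hi
  have hb := edgePoint_re_bounds h.bot_re_pos (j := j) ht
  have hlast := congrArg Complex.re (botVertex_last π ζ)
  rw [botVertex] at hlast
  rw [hlast] at hb
  obtain ⟨s, hs, e⟩ := eq_edgePoint h.re_pos (j := i)
    (z := ⟨(edgePoint (fun j => ζ (π.symm j)) j t).re,
      edgeHeight ζ i (edgePoint (fun j => ζ (π.symm j)) j t).re⟩) hi.1 hi.2 rfl
  have := h.sep i j s hs t ⟨ht.1.le, ht.2.le⟩ (by rw [← e]) (by rw [← e]; exact hb.1)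
    (by rw [← e]; exact hb.2)
  rwa [← e] at this

theorem eq_edge {η : Fin n → ℂ} (hη : ∀ j, 0 < (η j).re) {i j : Fin n} {x : ℝ}
    (h₁ : (topVertex η j).re < x) (h₂ : x < (topVertex η (j + 1)).re)
    (h₃ : (topVertex η i).re ≤ x) (h₄ : x ≤ (topVertex η (i + 1)).re) : i = j := by
  rcases lt_trichotomy i j with hij | hij | hij
  · have := topVertex_re_le hη (show (i : ℕ) + 1 ≤ j from hij) j.2.le
    linarith
  · exact hij
  · have := topVertex_re_le hη (show (j : ℕ) + 1 ≤ i from hij) i.2.le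
    linarith

theorem edge_bounds {η : Fin n → ℂ} (hη : ∀ j, 0 < (η j).re) {j : Fin n} {x : ℝ}
    (h₁ : (topVertex η j).re ≤ x) (h₂ : x ≤ (topVertex η (j + 1)).re) :
    0 ≤ x ∧ x ≤ (topVertex η n).re := by
  have h₀ : 0 ≤ (topVertex η j).re := by
    simpa [topVertex_zero] using topVertex_re_le hη (Nat.zero_le j) j.2.le
  exact ⟨h₀.trans h₁, h₂.trans (topVertex_re_le hη (show (j : ℕ) + 1 ≤ n from j.2) le_rfl)⟩

theorem vertex_notMem_open_edge (h : IsSimpleSuspension π ζ) {z : ℂ} (hz : IsVertexPoint π ζ z)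
    {j : Fin n} (h₁ : (topVertex ζ j).re < z.re) (h₂ : z.re < (topVertex ζ (j + 1)).re) :
    z ∉ strictlyAbove fun j => ζ (π.symm j) := by
  obtain ⟨k, hk, rfl | rfl⟩ := hz
  · rcases le_or_gt k j with hkj | hkj
    · have := topVertex_re_le h.re_pos hkj j.2.le
      linarith
    · have := topVertex_re_le h.re_pos (show (j : ℕ) + 1 ≤ k from hkj) hk
      linarith
  · obtain ⟨i, t, ht, e⟩ := topVertex_edge (η := fun j => ζ (π.symm j)) h.pos hk
    rw [botVertex, e]
    exact edgePoint_notMem_strictlyAbove h.bot_re_pos ht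

theorem vertex_notMem_open_edge' (h : IsSimpleSuspension π ζ) {z : ℂ} (hz : IsVertexPoint π ζ z)
    {j : Fin n} (h₁ : (botVertex π ζ j).re < z.re) (h₂ : z.re < (botVertex π ζ (j + 1)).re) :
    z ∉ strictlyBelow ζ := by
  obtain ⟨k, hk, rfl | rfl⟩ := hz
  · obtain ⟨i, t, ht, e⟩ := topVertex_edge (η := ζ) h.pos hk
    rw [e]
    exact edgePoint_notMem_strictlyBelow h.re_pos ht
  · rcases le_or_gt k j with hkj | hkj
    · have := topVertex_re_le h.bot_re_pos hkj j.2.le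
      rw [botVertex] at h₁
      rw [botVertex] at h₁
      linarith
    · have := topVertex_re_le h.bot_re_pos (show (j : ℕ) + 1 ≤ k from hkj) hk
      rw [botVertex] at h₂
      rw [botVertex] at h₂
      linarith

theorem exists_chart_interior (h : IsSimpleSuspension π ζ) (x : (suspension π ζ).region)
    (hx₁ : (x : ℂ) ∈ strictlyBelow ζ) (hx₂ : (x : ℂ) ∈ strictlyAbove fun j => ζ (π.symm j))
    (hx₃ : 0 < (x : ℂ).re) (hx₄ : (x : ℂ).re < (topVertex ζ n).re) :
    ∃ φ, (suspension π ζ).IsTranslationChart φ ∧ (suspension π ζ).toSurface x ∈ φ.source := by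
  have hnot : ∀ w ∈ strictlyBelow ζ ∩ strictlyAbove fun j => ζ (π.symm j),
      ¬ IsVertexPoint π ζ w := by
    rintro w ⟨hw₁, hw₂⟩ ⟨k, hk, rfl | rfl⟩
    · obtain ⟨i, t, ht, e⟩ := topVertex_edge (η := ζ) h.pos hk
      exact edgePoint_notMem_strictlyBelow h.re_pos ht (e ▸ hw₁)
    · obtain ⟨i, t, ht, e⟩ := topVertex_edge (η := fun j => ζ (π.symm j)) h.pos hk
      rw [botVertex, e] at hw₂
      exact edgePoint_notMem_strictlyAbove h.bot_re_pos ht hw₂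
  refine PolygonGluing.exists_translationChart
    (isFiniteConvexUnion_region π ζ).isCompact.isClosed
    (U := (strictlyBelow ζ ∩ strictlyAbove fun j => ζ (π.symm j)) ∩
      {z | 0 < z.re ∧ z.re < (topVertex ζ n).re}) (δ := 0) ?_ ?_ ?_ ?_ ?_ ?_ x
      ⟨⟨hx₁, hx₂⟩, hx₃, hx₄⟩
  · refine ((isOpen_strictlyBelow _).inter (isOpen_strictlyAbove _)).inter ?_
    exact (isOpen_lt continuous_const Complex.continuous_re).inter
      (isOpen_lt Complex.continuous_re continuous_const)
  · rintro w ⟨⟨hw₁, hw₂⟩, hw₃, hw₄⟩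
    exact .inl (h.mem_region_iff.2 ⟨hw₃.le, hw₄.le, fun i hi => (hw₁ i hi).le,
      fun i hi => (hw₂ i hi).le⟩)
  · rintro w ⟨hw, -⟩ x y hx hxy
    have hxw : (x : ℂ) = w := by simpa using hx
    left
    rcases h.toSurface_eq_cases hxy with rfl | h' | h' | h'
    · exact hxw
    · obtain ⟨j, t, ht, e, -⟩ := sideRel_iff.1 h'
      rw [← hxw, e] at hw
      exact absurd hw.1 (edgePoint_notMem_strictlyBelow h.re_pos ht)
    · obtain ⟨j, t, ht, -, e⟩ := sideRel_iff.1 h'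
      rw [← hxw, e] at hw
      exact absurd hw.2 (edgePoint_notMem_strictlyAbove h.bot_re_pos ht)
    · exact absurd (hxw ▸ h'.1) (hnot w hw)
  · intro w _ x y hx hy
    rw [Subtype.ext (hx.trans (by simpa using hy.symm))]
  · intros; rfl
  · rintro w ⟨hw, -⟩ x hx
    have hxw : (x : ℂ) = w := by simpa using hx
    rw [h.mem_vertices_iff, hxw]
    exact hnot w hw

theorem exists_chart_side (h : IsSimpleSuspension π ζ) (x : (suspension π ζ).region) {j : Fin n}
    {t : ℝ} (ht : t ∈ Set.Ioo (0 : ℝ) 1) (hx : (x : ℂ) = edgePoint ζ j t) :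
    ∃ φ, (suspension π ζ).IsTranslationChart φ ∧ (suspension π ζ).toSurface x ∈ φ.source := by
  have hT := h.re_pos
  have hB := h.bot_re_pos
  have htc : t ∈ Set.Icc (0 : ℝ) 1 := ⟨ht.1.le, ht.2.le⟩
  obtain ⟨δ, hδ⟩ : ∃ δ, δ = botVertex π ζ (π j) - topVertex ζ j := ⟨_, rfl⟩
  have hshift : ∀ s, edgePoint ζ j s + δ = edgePoint (fun j => ζ (π.symm j)) (π j) s := by
    intro s
    rw [hδ, edgePoint, edgePoint, botVertex, Equiv.symm_apply_apply]
    ring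
  have hδ0 : δ ≠ 0 := by
    rintro rfl
    have := hshift t
    rw [add_zero] at this
    have h' := (h.top_ne_bot htc htc this).1
    rcases h' with h' | h'
    · exact ht.1.ne' h'
    · exact ht.2.ne h'
  have hBj : botVertex π ζ (π j) = topVertex ζ j + δ := by rw [hδ]; ring
  have hBj' : botVertex π ζ (π j + 1) = topVertex ζ (j + 1) + δ := by
    rw [botVertex, topVertex_succ, topVertex_succ, ← botVertex, hBj, Equiv.symm_apply_apply]
    ring
  have hheight : ∀ w : ℂ, edgeHeight (fun j => ζ (π.symm j)) (π j) (w + δ).re =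
      edgeHeight ζ j w.re + δ.im := by
    intro w
    rw [edgeHeight, edgeHeight, ← botVertex, hBj, Equiv.symm_apply_apply]
    simp
    ring
  let U : Set ℂ := ({z | (topVertex ζ j).re < z.re} ∩ {z | z.re < (topVertex ζ (j + 1)).re}) ∩
    (strictlyAbove (fun j => ζ (π.symm j)) ∩ (fun z => z + δ) ⁻¹' strictlyBelow ζ) ∩
    Metric.ball (x : ℂ) (‖δ‖ / 2)
  have hbot : ∀ w ∈ U, (botVertex π ζ (π j)).re < (w + δ).re ∧
      (w + δ).re < (botVertex π ζ (π j + 1)).re := by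
    rintro w ⟨⟨⟨hw₁, hw₂⟩, -⟩, -⟩
    rw [hBj, hBj', Complex.add_re, Complex.add_re, Complex.add_re]
    exact ⟨by simpa using hw₁, by simpa using hw₂⟩
  have hnv : ∀ w ∈ U, ¬ IsVertexPoint π ζ w := by
    rintro w ⟨⟨⟨hw₁, hw₂⟩, hw₃, -⟩, -⟩ hv
    exact h.vertex_notMem_open_edge hv hw₁ hw₂ hw₃
  have hnv' : ∀ w ∈ U, ¬ IsVertexPoint π ζ (w + δ) := by
    intro w hw hv
    exact h.vertex_notMem_open_edge' hv (hbot w hw).1 (hbot w hw).2 hw.1.2.2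
  have hxU : (x : ℂ) ∈ U := by
    refine ⟨⟨?_, ?_, ?_⟩, Metric.mem_ball_self (by positivity)⟩
    · rw [hx]; exact edgePoint_re_mem_Ioo hT ht
    · rw [hx]; exact h.top_strictlyAbove ht
    · rw [hx, Set.mem_preimage, hshift]; exact h.bot_strictlyBelow ht
  refine PolygonGluing.exists_translationChart
    (isFiniteConvexUnion_region π ζ).isCompact.isClosed (U := U) (δ := δ) ?_ ?_ ?_ ?_ ?_ ?_ x hxU
  · exact (((isOpen_lt continuous_const Complex.continuous_re).inter
      (isOpen_lt Complex.continuous_re continuous_const)).inter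
      ((isOpen_strictlyAbove _).inter ((isOpen_strictlyBelow _).preimage (by fun_prop)))).inter
      Metric.isOpen_ball
  · intro w hw
    have hw' := hbot w hw
    obtain ⟨⟨⟨hw₁, hw₂⟩, hw₃, hw₄⟩, -⟩ := hw
    rcases le_or_gt w.im (edgeHeight ζ j w.re) with hle | hgt
    · left
      have hb := edge_bounds hT (le_of_lt hw₁) (le_of_lt hw₂)
      refine h.mem_region_iff.2 ⟨hb.1, hb.2, fun i hi => ?_, fun i hi => (hw₃ i hi).le⟩
      rw [eq_edge hT hw₁ hw₂ hi.1 hi.2]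
      exact hle
    · right
      have hb := edge_bounds hB (le_of_lt hw'.1) (le_of_lt hw'.2)
      refine h.mem_region_iff.2 ⟨hb.1, ?_, fun i hi => (hw₄ i hi).le, fun i hi => ?_⟩
      · exact hb.2.trans (congrArg Complex.re (botVertex_last π ζ)).le
      · rw [eq_edge hB hw'.1 hw'.2 hi.1 hi.2, hheight, Complex.add_im]
        linarith
  · intro w hw x y hx hxy
    have hw' := hbot w hw
    have hv : ¬ IsVertexPoint π ζ x := by
      rcases hx with hx | hx <;> rw [hx]
      · exact hnv w hw
      · exact hnv' w hw
    rcases h.toSurface_eq_cases hxy with rfl | h' | h' | h'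
    · exact hx
    · obtain ⟨i, s, hs, e₁, e₂⟩ := sideRel_iff.1 h'
      rcases hx with hx | hx
      · right
        have he : edgePoint ζ i s = w := e₁.symm.trans hx
        have := edgePoint_re_mem hT (j := i) hs
        rw [he] at this
        obtain rfl := eq_edge hT hw.1.1.1 hw.1.1.2 this.1 this.2
        rw [e₂, ← hshift, he]
      · refine absurd hw.1.2.2 ?_
        rw [Set.mem_preimage, ← hx, e₁]
        exact edgePoint_notMem_strictlyBelow hT hs
    · obtain ⟨i, s, hs, e₁, e₂⟩ := sideRel_iff.1 h'
      rcases hx with hx | hx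
      · refine absurd hw.1.2.1 ?_
        rw [← hx, e₂]
        exact edgePoint_notMem_strictlyAbove hB hs
      · left
        have he : edgePoint (fun j => ζ (π.symm j)) (π i) s = w + δ := e₂.symm.trans hx
        have := edgePoint_re_mem hB (j := π i) hs
        rw [he] at this
        obtain rfl := π.injective (eq_edge hB hw'.1 hw'.2 this.1 this.2)
        rw [e₁]
        exact add_right_cancel ((hshift s).trans he)
    · exact absurd h'.1 hv
  · intro w hw x y hxw hyw
    have hw' := hbot w hw
    have hx := (h.mem_region_iff.1 x.2).2.2.1 j
      (by rw [hxw]; exact ⟨le_of_lt hw.1.1.1, le_of_lt hw.1.1.2⟩)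
    have hy := (h.mem_region_iff.1 y.2).2.2.2 (π j)
      (by rw [hyw]; exact ⟨hw'.1.le, hw'.2.le⟩)
    rw [hxw] at hx
    rw [hyw, hheight, Complex.add_im] at hy
    obtain ⟨s, hs, e⟩ := eq_edgePoint hT (j := j) (z := w) (le_of_lt hw.1.1.1) (le_of_lt hw.1.1.2)
      (by linarith)
    refine Quotient.sound (Relation.EqvGen.rel _ _ (sideRel_iff.2 ⟨j, s, hs, hxw.trans e, ?_⟩))
    rw [hyw, ← hshift, e]
  · rintro w ⟨-, hw⟩ ⟨-, hw'⟩
    exfalso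
    rw [Metric.mem_ball] at hw hw'
    have : ‖δ‖ ≤ dist (w + δ) x + dist w x := by
      have h1 : ‖δ‖ = dist (w + δ) w := by simp [dist_eq_norm]
      rw [h1, dist_comm w x]
      exact dist_triangle _ _ _
    linarith
  · intro w hw x hx
    rw [h.mem_vertices_iff]
    rcases hx with hx | hx <;> rw [hx]
    · exact hnv w hw
    · exact hnv' w hw

theorem exists_chart (h : IsSimpleSuspension π ζ) (x : (suspension π ζ).region)
    (hx : ¬ IsVertexPoint π ζ x) :
    ∃ φ, (suspension π ζ).IsTranslationChart φ ∧ (suspension π ζ).toSurface x ∈ φ.source := by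
  have hT := h.re_pos
  have hB := h.bot_re_pos
  obtain ⟨h₀, h₁, htop, hbot⟩ := h.mem_region_iff.1 x.2
  have htop' : ∀ j : Fin n, ∀ t ∈ Set.Icc (0 : ℝ) 1, (x : ℂ) = edgePoint ζ j t →
      ∃ φ, (suspension π ζ).IsTranslationChart φ ∧ (suspension π ζ).toSurface x ∈ φ.source := by
    intro j t ht e
    refine h.exists_chart_side x (Ioo_of_ne ht fun ht' => hx ?_) e
    rw [e]
    exact isVertexPoint_top π ζ ht'
  by_cases hbelow : (x : ℂ) ∈ strictlyBelow ζ
  swap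
  · simp only [strictlyBelow, Set.mem_ofPred_eq, not_forall, not_lt] at hbelow
    obtain ⟨i, hi, hle⟩ := hbelow
    obtain ⟨t, ht, e⟩ := eq_edgePoint hT hi.1 hi.2 (le_antisymm (htop i hi) hle)
    exact htop' i t ht e
  by_cases habove : (x : ℂ) ∈ strictlyAbove fun j => ζ (π.symm j)
  swap
  · simp only [strictlyAbove, Set.mem_ofPred_eq, not_forall, not_lt] at habove
    obtain ⟨i, hi, hle⟩ := habove
    obtain ⟨t, ht, e⟩ := eq_edgePoint hB hi.1 hi.2 (le_antisymm hle (hbot i hi))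
    have ht' : t ∈ Set.Ioo (0 : ℝ) 1 := Ioo_of_ne ht fun ht' => hx (by
      rw [e]
      exact isVertexPoint_bot π ζ ht')
    have hside : (suspension π ζ).sideRel ⟨_, edgePoint_top_mem π ζ (π.symm i) ht⟩ x :=
      sideRel_iff.2 ⟨π.symm i, t, ht, rfl, by simpa using e⟩
    have heq : (suspension π ζ).toSurface ⟨_, edgePoint_top_mem π ζ (π.symm i) ht⟩ =
        (suspension π ζ).toSurface x := Quotient.sound (Relation.EqvGen.rel _ _ hside)
    rw [← heq]
    exact h.exists_chart_side _ ht' rfl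
  have hzero : ∀ k ≤ n, topVertex ζ k = botVertex π ζ k → (x : ℂ).re ≠ (topVertex ζ k).re := by
    intro k hk hk' he
    obtain ⟨i, s, hs, e₁⟩ := topVertex_edge (η := ζ) h.pos hk
    obtain ⟨j, t, ht, e₂⟩ := topVertex_edge (η := fun j => ζ (π.symm j)) h.pos hk
    have b₁ := hbelow i (by rw [he, e₁]; exact edgePoint_re_mem hT hs)
    have b₂ := habove j (by
      rw [he, hk', botVertex, e₂]; exact edgePoint_re_mem hB ht)
    rw [he, e₁, ← edgePoint_im_eq hT, ← e₁] at b₁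
    rw [he, hk', botVertex, e₂, ← edgePoint_im_eq hB, ← e₂, ← botVertex, ← hk'] at b₂
    exact lt_asymm b₁ b₂
  refine h.exists_chart_interior x hbelow habove (h₀.lt_of_ne' ?_) (h₁.lt_of_ne ?_)
  · simpa [topVertex_zero] using hzero 0 (Nat.zero_le _) (by simp [botVertex, topVertex_zero])
  · exact hzero n le_rfl (botVertex_last π ζ).symm

theorem isPathConnected_region (h : IsSimpleSuspension π ζ) :
    IsPathConnected (suspension π ζ).region := by
  have hverts : ∀ k ≤ n, JoinedIn (suspension π ζ).region 0 (topVertex ζ k) := by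
    intro k
    induction k with
    | zero =>
      intro _
      rw [topVertex_zero]
      refine JoinedIn.refl ?_
      have := edgePoint_top_mem π ζ ⟨0, h.pos⟩ (t := 0) (by simp)
      simpa [edgePoint_zero, topVertex_zero] using this
    | succ k ih =>
      intro hk
      refine (ih (by omega)).trans (JoinedIn.of_segment_subset ?_)
      have := segment_topVertex ζ ⟨k, hk⟩
      simp only at this
      rw [this]
      rintro _ ⟨t, ht, rfl⟩
      exact edgePoint_top_mem π ζ _ ht
  refine ⟨0, (hverts 0 (Nat.zero_le _)).source_mem, fun {z} hz => ?_⟩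
  obtain ⟨h₀, h₁, htop, hbot⟩ := h.mem_region_iff.1 hz
  obtain ⟨i, hi⟩ := exists_edge (η := ζ) h.pos h₀ h₁
  obtain ⟨t, ht, e⟩ := eq_edgePoint h.re_pos (j := i) (z := ⟨z.re, edgeHeight ζ i z.re⟩)
    hi.1 hi.2 rfl
  have j₁ : JoinedIn (suspension π ζ).region (topVertex ζ i) (edgePoint ζ i t) := by
    refine JoinedIn.of_segment_subset ?_
    refine ((convex_segment _ _).segment_subset (left_mem_segment ℝ _ (topVertex ζ (i + 1)))
      ?_).trans ?_
    · rw [segment_topVertex]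
      exact ⟨t, ht, rfl⟩
    · rw [segment_topVertex]
      rintro _ ⟨t, ht, rfl⟩
      exact edgePoint_top_mem π ζ _ ht
  refine ((hverts i i.2.le).trans j₁).trans (JoinedIn.of_segment_subset ?_)
  rw [← e]
  intro w hw
  obtain ⟨s, hs, rfl⟩ := (segment_eq_image' ℝ _ _).subset hw
  have hre : ((⟨z.re, edgeHeight ζ i z.re⟩ : ℂ) +
      s • (z - ⟨z.re, edgeHeight ζ i z.re⟩)).re = z.re := by simp
  have him : ((⟨z.re, edgeHeight ζ i z.re⟩ : ℂ) + s • (z - ⟨z.re, edgeHeight ζ i z.re⟩)).im =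
      edgeHeight ζ i z.re + s * (z.im - edgeHeight ζ i z.re) := by simp
  have hzi := htop i hi
  refine h.mem_region_iff.2 ⟨by rwa [hre], by rwa [hre], fun k hk => ?_, fun k hk => ?_⟩
  · rw [hre] at hk ⊢
    rw [edgeHeight_eq h.re_pos hk hi, him]
    nlinarith [hs.1]
  · rw [hre] at hk ⊢
    rw [him]
    nlinarith [hs.1, hs.2, hbot k hk]

theorem isTranslationSurface (h : IsSimpleSuspension π ζ) :
    (suspension π ζ).IsTranslationSurface := by
  have hc : CompactSpace (suspension π ζ).region :=
    isCompact_iff_compactSpace.1 (isFiniteConvexUnion_region π ζ).isCompact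
  have hp : PathConnectedSpace (suspension π ζ).region :=
    isPathConnected_iff_pathConnectedSpace.1 h.isPathConnected_region
  refine ⟨inferInstanceAs (CompactSpace (Quotient (suspension π ζ).glueSetoid)),
    inferInstanceAs (ConnectedSpace (Quotient (suspension π ζ).glueSetoid)),
    t2Space_quotient_of_isClosed _ h.isClosed_glue, h.finite_vertices, fun s hs => ?_⟩
  obtain ⟨x, rfl⟩ := PolygonGluing.toSurface_surjective s
  exact h.exists_chart x fun hx => hs ((h.mem_vertices_iff x).2 hx)

theorem topVertex_eq_botVertex (h : IsSimpleSuspension π ζ) {k l : ℕ} (hk : k ≤ n) (hl : l ≤ n)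
    (he : topVertex ζ k = botVertex π ζ l) : (k = 0 ∧ l = 0) ∨ (k = n ∧ l = n) := by
  obtain ⟨i, s, hs, e₁⟩ := topVertex_edge (η := ζ) h.pos hk
  obtain ⟨j, t, ht, e₂⟩ := topVertex_edge (η := fun j => ζ (π.symm j)) h.pos hl
  have hlast := congrArg Complex.re (botVertex_last π ζ)
  have h0 : ∀ m ≤ n, (topVertex ζ k).re = (topVertex ζ m).re →
      (botVertex π ζ m).re = (topVertex ζ m).re → k = m ∧ l = m := by
    intro m hm h₁ h₂
    refine ⟨topVertex_injOn h.re_pos hk hm h₁, topVertex_injOn h.bot_re_pos hl hm ?_⟩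
    exact (congrArg Complex.re he).symm.trans (h₁.trans h₂.symm)
  have hb := edge_bounds h.re_pos (edgePoint_re_mem h.re_pos (j := i) hs).1
    (edgePoint_re_mem h.re_pos (j := i) hs).2
  rw [← e₁] at hb
  rcases hb.1.eq_or_lt with h₁ | h₁
  · exact .inl (h0 0 (Nat.zero_le _) (by simpa [topVertex_zero] using h₁.symm)
      (by simp [botVertex, topVertex_zero]))
  rcases hb.2.eq_or_lt with h₂ | h₂
  · exact .inr (h0 n le_rfl h₂ hlast)
  have := h.sep i j s hs t ht (by rw [← e₁, ← e₂, he, botVertex]) (e₁ ▸ h₁) (e₁ ▸ h₂)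
  rw [← e₁, ← e₂, he, botVertex] at this
  exact absurd this (lt_irrefl _)

/-- A colouring of the vertices of the polygon that is compatible with the gluing of the sides
descends to the vertices of the surface. -/
theorem vertex_color (h : IsSimpleSuspension π ζ) (cT cB : ℕ → Prop)
    (h₁ : ∀ j : Fin n, cT j ↔ cB (π j)) (h₂ : ∀ j : Fin n, cT (j + 1) ↔ cB (π j + 1))
    (h₀ : cT 0 ↔ cB 0) (hn : cT n ↔ cB n) {x y : (suspension π ζ).region}
    (hxy : (suspension π ζ).toSurface x = (suspension π ζ).toSurface y) :
    (∃ k ≤ n, ((x : ℂ) = topVertex ζ k ∧ cT k) ∨ ((x : ℂ) = botVertex π ζ k ∧ cB k)) ↔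
    (∃ k ≤ n, ((y : ℂ) = topVertex ζ k ∧ cT k) ∨ ((y : ℂ) = botVertex π ζ k ∧ cB k)) := by
  let S : ℂ → Prop := fun z => ∃ k ≤ n, (z = topVertex ζ k ∧ cT k) ∨ (z = botVertex π ζ k ∧ cB k)
  have hST : ∀ k ≤ n, S (topVertex ζ k) ↔ cT k := by
    refine fun k hk => ⟨?_, fun hc => ⟨k, hk, .inl ⟨rfl, hc⟩⟩⟩
    rintro ⟨l, hl, ⟨e, hc⟩ | ⟨e, hc⟩⟩
    · rwa [topVertex_injOn h.re_pos hk hl (congrArg Complex.re e)]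
    · rcases h.topVertex_eq_botVertex hk hl e with ⟨rfl, rfl⟩ | ⟨rfl, rfl⟩
      · exact h₀.2 hc
      · exact hn.2 hc
  have hSB : ∀ k ≤ n, S (botVertex π ζ k) ↔ cB k := by
    refine fun k hk => ⟨?_, fun hc => ⟨k, hk, .inr ⟨rfl, hc⟩⟩⟩
    rintro ⟨l, hl, ⟨e, hc⟩ | ⟨e, hc⟩⟩
    · rcases h.topVertex_eq_botVertex hl hk e.symm with ⟨rfl, rfl⟩ | ⟨rfl, rfl⟩
      · exact h₀.1 hc
      · exact hn.1 hc
    · rwa [topVertex_injOn h.bot_re_pos hk hl (congrArg Complex.re e)]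
  have hSV : ∀ z, S z → IsVertexPoint π ζ z := by
    rintro z ⟨k, hk, ⟨e, -⟩ | ⟨e, -⟩⟩
    · exact ⟨k, hk, .inl e⟩
    · exact ⟨k, hk, .inr e⟩
  have hgen : Relation.EqvGen (suspension π ζ).sideRel x y := Quotient.exact hxy
  show S x ↔ S y
  induction hgen with
  | rel x y hside =>
    have hv := h.sideRel_vertex hside
    obtain ⟨j, t, ht, e₁, e₂⟩ := sideRel_iff.1 hside
    by_cases hxv : IsVertexPoint π ζ x
    · rw [e₁, h.isVertexPoint_top_iff ht] at hxv
      rw [e₁, e₂]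
      rcases hxv with rfl | rfl
      · rw [edgePoint_zero, edgePoint_zero, ← botVertex, hST _ j.2.le, hSB _ (π j).2.le, h₁]
      · rw [edgePoint_one, edgePoint_one, ← botVertex, hST _ j.2, hSB _ (π j).2, h₂]
    · exact iff_of_false (fun h' => hxv (hSV _ h')) fun h' => hxv (hv.2 (hSV _ h'))
  | refl x => rfl
  | symm x y h' ih => exact (ih (Quotient.sound h')).symm
  | trans x y z h' h'' ih ih' => exact (ih (Quotient.sound h')).trans (ih' (Quotient.sound h''))

end IsSimpleSuspension

/-! ### Piecewise linear functions and regions between two of them -/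

/-- The affine function whose graph is the line through `u` and `v`. -/
def lineAt (u v : ℂ) (x : ℝ) : ℝ := u.im + (v.im - u.im) / (v.re - u.re) * (x - u.re)

theorem lineAt_left (u v : ℂ) : lineAt u v u.re = u.im := by simp [lineAt]

theorem lineAt_right {u v : ℂ} (h : u.re < v.re) : lineAt u v v.re = v.im := by
  have : v.re - u.re ≠ 0 := by linarith
  rw [lineAt]
  field_simp
  ring

theorem mem_segment_iff_lineAt {u v z : ℂ} (h : u.re < v.re) :
    z ∈ segment ℝ u v ↔ u.re ≤ z.re ∧ z.re ≤ v.re ∧ z.im = lineAt u v z.re := by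
  have hne : 0 < v.re - u.re := by linarith
  rw [segment_eq_image']
  constructor
  · rintro ⟨t, ⟨h₀, h₁⟩, rfl⟩
    refine ⟨?_, ?_, ?_⟩
    · simp only [Complex.add_re, Complex.real_smul, Complex.re_ofReal_mul, Complex.sub_re]
      nlinarith
    · simp only [Complex.add_re, Complex.real_smul, Complex.re_ofReal_mul, Complex.sub_re]
      nlinarith
    · simp only [lineAt, Complex.add_re, Complex.real_smul, Complex.re_ofReal_mul, Complex.sub_re,
        Complex.add_im, Complex.im_ofReal_mul, Complex.sub_im]
      field_simp
      ring
  · rintro ⟨h₀, h₁, h₂⟩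
    refine ⟨(z.re - u.re) / (v.re - u.re), ⟨div_nonneg (by linarith) hne.le,
      (div_le_one hne).2 (by linarith)⟩, ?_⟩
    apply Complex.ext
    · simp only [Complex.add_re, Complex.real_smul, Complex.re_ofReal_mul, Complex.sub_re]
      field_simp
      ring
    · simp only [Complex.add_im, Complex.real_smul, Complex.im_ofReal_mul, Complex.sub_im, h₂,
        lineAt]
      ring

/-- The continuous piecewise linear function with the given breakpoints, constant to the left of
the first and to the right of the last one. -/
def pl : List ℂ → ℝ → ℝ
  | [], _ => 0
  | [u], _ => u.im
  | u :: v :: l, x =>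
    if x ≤ u.re then u.im else if x ≤ v.re then lineAt u v x else pl (v :: l) x

/-- The points of the list are ordered from left to right. -/
def IsMono (c : List ℂ) : Prop := c.Pairwise fun a b => a.re < b.re

theorem IsMono.sublist {c c' : List ℂ} (h : IsMono c) (h' : c'.Sublist c) : IsMono c' :=
  List.Pairwise.sublist h' h

theorem IsMono.tail {u : ℂ} {c : List ℂ} (h : IsMono (u :: c)) : IsMono c :=
  (List.pairwise_cons.1 h).2

theorem IsMono.head_lt {u v : ℂ} {c : List ℂ} (h : IsMono (u :: c)) (hv : v ∈ c) : u.re < v.re :=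
  (List.pairwise_cons.1 h).1 v hv

theorem pl_left {u : ℂ} {x : ℝ} (c : List ℂ) (h : x ≤ u.re) : pl (u :: c) x = u.im := by
  cases c with
  | nil => rfl
  | cons v c => simp [pl, h]

theorem pl_mid {u v : ℂ} {x : ℝ} (c : List ℂ) (h₁ : u.re ≤ x) (h₂ : x ≤ v.re) :
    pl (u :: v :: c) x = lineAt u v x := by
  rw [pl]
  split_ifs with h
  · obtain rfl := le_antisymm h h₁
    rw [lineAt_left]
  · rfl

theorem pl_right {u v : ℂ} {x : ℝ} (c : List ℂ) (h : u.re < v.re) (h₂ : v.re ≤ x) :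
    pl (u :: v :: c) x = pl (v :: c) x := by
  rw [pl, if_neg (by linarith)]
  split_ifs with h'
  · obtain rfl := le_antisymm h' h₂
    rw [lineAt_right h, pl_left _ le_rfl]
  · rfl

theorem pl_append_left {u : ℂ} {x : ℝ} (hx : x ≤ u.re) (c₂ : List ℂ) :
    ∀ c₁ : List ℂ, pl (c₁ ++ u :: c₂) x = pl (c₁ ++ [u]) x
  | [] => by rw [List.nil_append, List.nil_append, pl_left _ hx, pl_left _ hx]
  | [w] => by
    simp only [List.cons_append, List.nil_append, pl]
    simp [hx]
  | w :: w' :: c₁ => by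
    have := pl_append_left hx c₂ (w' :: c₁)
    simp only [List.cons_append, pl] at this ⊢
    rw [this]

theorem pl_append_right {u : ℂ} {x : ℝ} (hx : u.re ≤ x) {c₂ : List ℂ} :
    ∀ {c₁ : List ℂ}, IsMono (c₁ ++ u :: c₂) → pl (c₁ ++ u :: c₂) x = pl (u :: c₂) x
  | [], _ => rfl
  | [w], h => pl_right _ (h.head_lt (by simp)) hx
  | w :: w' :: c₁, h => by
    have hw' : w'.re ≤ x := (IsMono.head_lt (v := u) h.tail (by simp)).le.trans hx
    simp only [List.cons_append]
    rw [pl_right _ (h.head_lt (by simp)) hw']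
    exact pl_append_right (c₁ := w' :: c₁) hx h.tail

theorem pl_at {c : List ℂ} (h : IsMono c) {u : ℂ} (hu : u ∈ c) : pl c u.re = u.im := by
  obtain ⟨c₁, c₂, rfl⟩ := List.append_of_mem hu
  rw [pl_append_right le_rfl h, pl_left _ le_rfl]

theorem affine_le {p q p' q' a b x : ℝ} (ha : p + q * a ≤ p' + q' * a)
    (hb : p + q * b ≤ p' + q' * b) (h₁ : a ≤ x) (h₂ : x ≤ b) : p + q * x ≤ p' + q' * x := by
  rcases le_total q q' with h | h
  · nlinarith
  · nlinarith

theorem lineAt_eq (u v : ℂ) (x : ℝ) : lineAt u v x =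
    (u.im - (v.im - u.im) / (v.re - u.re) * u.re) + (v.im - u.im) / (v.re - u.re) * x := by
  rw [lineAt]; ring

theorem affine_le_pl {p q : ℝ} : ∀ {u : ℂ} {c : List ℂ}, IsMono (u :: c) → ∀ {a b : ℝ}, u.re ≤ a →
    p + q * a ≤ pl (u :: c) a → p + q * b ≤ pl (u :: c) b →
    (∀ w ∈ c, a < w.re → w.re < b → p + q * w.re ≤ w.im) →
    ∀ x, a ≤ x → x ≤ b → p + q * x ≤ pl (u :: c) x
  | u, [], _, a, b, _, ha, hb, _, x, h₁, h₂ => by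
    simp only [pl] at ha hb ⊢
    have := affine_le (p := p) (q := q) (p' := u.im) (q' := 0) (by linarith) (by linarith) h₁ h₂
    linarith
  | u, v :: c, h, a, b, hua, ha, hb, hw, x, h₁, h₂ => by
    have huv : u.re < v.re := h.head_lt (by simp)
    have hmid : ∀ b', a ≤ b' → b' ≤ v.re → p + q * b' ≤ pl (u :: v :: c) b' → ∀ x, a ≤ x →
        x ≤ b' → p + q * x ≤ pl (u :: v :: c) x := by
      intro b' hab' hb'v hb' x h₁ h₂
      rw [pl_mid _ hua (hab'.trans hb'v), lineAt_eq] at ha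
      rw [pl_mid _ (hua.trans hab') hb'v, lineAt_eq] at hb'
      rw [pl_mid _ (hua.trans h₁) (h₂.trans hb'v), lineAt_eq]
      exact affine_le ha hb' h₁ h₂
    rcases le_or_gt b v.re with hbv | hbv
    · exact hmid b (h₁.trans h₂) hbv hb x h₁ h₂
    rcases le_or_gt v.re a with hva | hva
    · rw [pl_right _ huv hva] at ha
      rw [pl_right _ huv hbv.le] at hb
      rw [pl_right _ huv (hva.trans h₁)]
      exact affine_le_pl h.tail hva ha hb (fun w hw' => hw w (List.mem_cons_of_mem _ hw')) x h₁ h₂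
    have hv : p + q * v.re ≤ v.im := hw v (by simp) hva hbv
    rcases le_total x v.re with hxv | hxv
    · refine hmid v.re hva.le le_rfl ?_ x h₁ hxv
      rwa [pl_right _ huv le_rfl, pl_left _ le_rfl]
    · rw [pl_right _ huv hbv.le] at hb
      rw [pl_right _ huv hxv]
      refine affine_le_pl h.tail le_rfl (by rwa [pl_left _ le_rfl]) hb
        (fun w hw' h' => hw w (List.mem_cons_of_mem _ hw') (hva.trans h')) x hxv h₂

theorem pl_map_conj : ∀ (c : List ℂ) (x : ℝ), pl (c.map (starRingEnd ℂ)) x = -pl c x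
  | [], _ => by simp [pl]
  | [u], _ => by simp [pl]
  | u :: v :: l, x => by
    have := pl_map_conj (v :: l) x
    simp only [List.map_cons] at this
    simp only [List.map_cons, pl, this, Complex.conj_re, Complex.conj_im]
    split_ifs
    · rfl
    · simp only [lineAt, Complex.conj_re, Complex.conj_im]; ring
    · rfl

theorem IsMono.map_conj {c : List ℂ} (h : IsMono c) : IsMono (c.map (starRingEnd ℂ)) :=
  List.pairwise_map.2 (by simpa [IsMono] using h)

theorem pl_le_affine {p q : ℝ} {u : ℂ} {c : List ℂ} (h : IsMono (u :: c)) {a b : ℝ}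
    (hu : u.re ≤ a) (ha : pl (u :: c) a ≤ p + q * a) (hb : pl (u :: c) b ≤ p + q * b)
    (hw : ∀ w ∈ c, a < w.re → w.re < b → w.im ≤ p + q * w.re) (x : ℝ) (h₁ : a ≤ x) (h₂ : x ≤ b) :
    pl (u :: c) x ≤ p + q * x := by
  have h' := h.map_conj
  rw [List.map_cons] at h'
  have := affine_le_pl (p := -p) (q := -q) h' (a := a) (b := b) (by simpa using hu)
    (by rw [← List.map_cons, pl_map_conj]; linarith)
    (by rw [← List.map_cons, pl_map_conj]; linarith)
    (by
      intro w₀ hw₀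
      obtain ⟨w, hw', rfl⟩ := List.mem_map.1 hw₀
      simp only [Complex.conj_re, Complex.conj_im]
      intro h₁ h₂
      linarith [hw w hw' h₁ h₂]) x h₁ h₂
  rw [← List.map_cons, pl_map_conj] at this
  linarith

/-- The region between the graphs of two functions over an interval. -/
def cell (a b : ℝ) (f g : ℝ → ℝ) : Set ℂ :=
  {z | a ≤ z.re ∧ z.re ≤ b ∧ f z.re ≤ z.im ∧ z.im ≤ g z.re}

theorem cell_split {a b a₁ b₁ a₂ b₂ : ℝ} {f g f₁ g₁ f₂ g₂ : ℝ → ℝ} {u v : ℂ} (huv : u.re < v.re)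
    (hmid : ∀ x, u.re ≤ x → x ≤ v.re → f₁ x = lineAt u v x ∧ g₁ x = g x ∧ f₂ x = f x ∧
      g₂ x = lineAt u v x ∧ f x ≤ lineAt u v x ∧ lineAt u v x ≤ g x)
    (h₁ : ∀ x, a₁ ≤ x → x ≤ b₁ → (u.re ≤ x ∧ x ≤ v.re) ∨ (f₁ x = f x ∧ g₁ x = g x))
    (h₂ : ∀ x, a₂ ≤ x → x ≤ b₂ → (u.re ≤ x ∧ x ≤ v.re) ∨ (f₂ x = f x ∧ g₂ x = g x))
    (hcov : ∀ x, a ≤ x → x ≤ b → (a₁ ≤ x ∧ x ≤ b₁) ∨ (a₂ ≤ x ∧ x ≤ b₂))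
    (hle₁ : a ≤ a₁ ∧ b₁ ≤ b ∧ a₁ ≤ u.re ∧ v.re ≤ b₁)
    (hle₂ : a ≤ a₂ ∧ b₂ ≤ b ∧ a₂ ≤ u.re ∧ v.re ≤ b₂)
    (hinter : (a₁ = u.re ∨ a₂ = u.re) ∧ (b₁ = v.re ∨ b₂ = v.re))
    (hfg : ∀ x, a ≤ x → x ≤ b → f x ≤ g x) :
    (∀ x, a₁ ≤ x → x ≤ b₁ → f₁ x ≤ g₁ x) ∧ (∀ x, a₂ ≤ x → x ≤ b₂ → f₂ x ≤ g₂ x) ∧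
    cell a b f g = cell a₁ b₁ f₁ g₁ ∪ cell a₂ b₂ f₂ g₂ ∧
    cell a₁ b₁ f₁ g₁ ∩ cell a₂ b₂ f₂ g₂ ⊆ segment ℝ u v := by
  refine ⟨fun x hx hx' => ?_, fun x hx hx' => ?_, Set.Subset.antisymm ?_ ?_, ?_⟩
  · rcases h₁ x hx hx' with h | ⟨e₁, e₂⟩
    · obtain ⟨e₁, e₂, -, -, -, h'⟩ := hmid x h.1 h.2
      rwa [e₁, e₂]
    · rw [e₁, e₂]
      exact hfg x (hle₁.1.trans hx) (hx'.trans hle₁.2.1)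
  · rcases h₂ x hx hx' with h | ⟨e₁, e₂⟩
    · obtain ⟨-, -, e₁, e₂, h', -⟩ := hmid x h.1 h.2
      rwa [e₁, e₂]
    · rw [e₁, e₂]
      exact hfg x (hle₂.1.trans hx) (hx'.trans hle₂.2.1)
  · rintro z ⟨ha, hb, hf, hg⟩
    by_cases hz : u.re ≤ z.re ∧ z.re ≤ v.re
    · obtain ⟨e₁, e₂, e₃, e₄, -, -⟩ := hmid z.re hz.1 hz.2
      rcases le_total (lineAt u v z.re) z.im with h | h
      · exact .inl ⟨hle₁.2.2.1.trans hz.1, hz.2.trans hle₁.2.2.2, e₁ ▸ h, e₂ ▸ hg⟩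
      · exact .inr ⟨hle₂.2.2.1.trans hz.1, hz.2.trans hle₂.2.2.2, e₃ ▸ hf, e₄ ▸ h⟩
    · rcases hcov z.re ha hb with h | h
      · obtain ⟨e₁, e₂⟩ := (h₁ z.re h.1 h.2).resolve_left hz
        exact .inl ⟨h.1, h.2, e₁ ▸ hf, e₂ ▸ hg⟩
      · obtain ⟨e₁, e₂⟩ := (h₂ z.re h.1 h.2).resolve_left hz
        exact .inr ⟨h.1, h.2, e₁ ▸ hf, e₂ ▸ hg⟩
  · rintro z (⟨ha, hb, hf, hg⟩ | ⟨ha, hb, hf, hg⟩)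
    · refine ⟨hle₁.1.trans ha, hb.trans hle₁.2.1, ?_⟩
      rcases h₁ z.re ha hb with h | ⟨e₁, e₂⟩
      · obtain ⟨e₁, e₂, -, -, h', -⟩ := hmid z.re h.1 h.2
        rw [e₁] at hf
        rw [e₂] at hg
        exact ⟨h'.trans hf, hg⟩
      · exact ⟨e₁ ▸ hf, e₂ ▸ hg⟩
    · refine ⟨hle₂.1.trans ha, hb.trans hle₂.2.1, ?_⟩
      rcases h₂ z.re ha hb with h | ⟨e₁, e₂⟩
      · obtain ⟨-, -, e₁, e₂, -, h'⟩ := hmid z.re h.1 h.2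
        rw [e₁] at hf
        rw [e₂] at hg
        exact ⟨hf, hg.trans h'⟩
      · exact ⟨e₁ ▸ hf, e₂ ▸ hg⟩
  · rintro z ⟨⟨ha, hb, hf, hg⟩, ha', hb', hf', hg'⟩
    have hz₁ : u.re ≤ z.re := by
      rcases hinter.1 with h | h <;> linarith
    have hz₂ : z.re ≤ v.re := by
      rcases hinter.2 with h | h <;> linarith
    obtain ⟨e₁, e₂, e₃, e₄, -, -⟩ := hmid z.re hz₁ hz₂
    rw [e₁] at hf
    rw [e₄] at hg'
    exact (mem_segment_iff_lineAt huv).2 ⟨hz₁, hz₂, le_antisymm hg' hf⟩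

/-- `U` and `L` are the upper and the lower boundary of a polygon lying over `[a, b]`. -/
structure IsPolygonChain (a b : ℝ) (U L : List ℂ) : Prop where
  monoU : IsMono U
  monoL : IsMono L
  headU : U.head?.map Complex.re = some a
  headL : L.head?.map Complex.re = some a
  lastU : U.getLast?.map Complex.re = some b
  lastL : L.getLast?.map Complex.re = some b
  le : ∀ x, a ≤ x → x ≤ b → pl L x ≤ pl U x

theorem IsMono.head_le {c : List ℂ} (h : IsMono c) {a : ℝ} (ha : c.head?.map Complex.re = some a)
    {w : ℂ} (hw : w ∈ c) : a ≤ w.re := by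
  cases c with
  | nil => simp at hw
  | cons u c =>
    simp only [List.head?_cons, Option.map_some, Option.some.injEq] at ha
    rcases List.mem_cons.1 hw with rfl | hw
    · exact ha.ge
    · exact ha ▸ (h.head_lt hw).le

theorem IsMono.le_last {c : List ℂ} (h : IsMono c) {b : ℝ}
    (hb : c.getLast?.map Complex.re = some b) {w : ℂ} (hw : w ∈ c) : w.re ≤ b := by
  rcases List.eq_nil_or_concat' c with rfl | ⟨c', u, rfl⟩
  · simp at hw
  · simp only [List.getLast?_concat, Option.map_some, Option.some.injEq] at hb
    rcases List.mem_append.1 hw with hw | hw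
    · rw [IsMono, List.pairwise_append] at h
      exact hb ▸ (h.2.2 w hw u (by simp)).le
    · obtain rfl : w = u := by simpa using hw
      exact hb.le

theorem lineAt_le_pl {c : List ℂ} (h : IsMono c) {u v : ℂ} (huv : u.re < v.re) {a : ℝ}
    (ha : c.head?.map Complex.re = some a) (hau : a ≤ u.re)
    (hu : u.im ≤ pl c u.re) (hv : v.im ≤ pl c v.re)
    (hw : ∀ w ∈ c, u.re < w.re → w.re < v.re → lineAt u v w.re ≤ w.im) (x : ℝ) (h₁ : u.re ≤ x)
    (h₂ : x ≤ v.re) : lineAt u v x ≤ pl c x := by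
  cases c with
  | nil => simp at ha
  | cons w c =>
    simp only [List.head?_cons, Option.map_some, Option.some.injEq] at ha
    rw [lineAt_eq]
    refine affine_le_pl h (a := u.re) (b := v.re) (ha ▸ hau) ?_ ?_ ?_ x h₁ h₂
    · rwa [← lineAt_eq, lineAt_left]
    · rwa [← lineAt_eq, lineAt_right huv]
    · intro w hw' h₁ h₂
      rw [← lineAt_eq]
      exact hw w (List.mem_cons_of_mem _ hw') h₁ h₂

theorem pl_le_lineAt {c : List ℂ} (h : IsMono c) {u v : ℂ} (huv : u.re < v.re) {a : ℝ}
    (ha : c.head?.map Complex.re = some a) (hau : a ≤ u.re)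
    (hu : pl c u.re ≤ u.im) (hv : pl c v.re ≤ v.im)
    (hw : ∀ w ∈ c, u.re < w.re → w.re < v.re → w.im ≤ lineAt u v w.re) (x : ℝ) (h₁ : u.re ≤ x)
    (h₂ : x ≤ v.re) : pl c x ≤ lineAt u v x := by
  cases c with
  | nil => simp at ha
  | cons w c =>
    simp only [List.head?_cons, Option.map_some, Option.some.injEq] at ha
    rw [lineAt_eq]
    refine pl_le_affine h (a := u.re) (b := v.re) (ha ▸ hau) ?_ ?_ ?_ x h₁ h₂
    · rwa [← lineAt_eq, lineAt_left]
    · rwa [← lineAt_eq, lineAt_right huv]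
    · intro w hw' h₁ h₂
      rw [← lineAt_eq]
      exact hw w (List.mem_cons_of_mem _ hw') h₁ h₂

/-- The value of a piecewise linear function with a shortcut from `u` to `v`. -/
theorem pl_shortcut {u v : ℂ} {c₁ c m c₂ : List ℂ} (hc : c = c₁ ++ u :: (m ++ v :: c₂))
    (h : IsMono c) (x : ℝ) :
    (x ≤ u.re → pl (c₁ ++ u :: v :: c₂) x = pl c x) ∧
    (u.re ≤ x → x ≤ v.re → pl (c₁ ++ u :: v :: c₂) x = lineAt u v x) ∧
    (v.re ≤ x → pl (c₁ ++ u :: v :: c₂) x = pl c x) ∧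
    (u.re ≤ x → x ≤ v.re → pl (u :: (m ++ [v])) x = pl c x) := by
  subst hc
  have hs : IsMono (c₁ ++ u :: v :: c₂) := h.sublist
    (((List.sublist_append_right m (v :: c₂)).cons_cons u).append_left c₁)
  refine ⟨fun hx => ?_, fun hx hx' => ?_, fun hx => ?_, fun hx hx' => ?_⟩
  · rw [pl_append_left hx (v :: c₂), pl_append_left hx (m ++ v :: c₂)]
  · rw [pl_append_right hx hs, pl_mid _ hx hx']
  · have e₁ : c₁ ++ u :: v :: c₂ = (c₁ ++ [u]) ++ v :: c₂ := by simp
    have e₂ : c₁ ++ u :: (m ++ v :: c₂) = (c₁ ++ u :: m) ++ v :: c₂ := by simp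
    rw [e₁, pl_append_right hx (e₁ ▸ hs), e₂, pl_append_right hx (e₂ ▸ h)]
  · rw [pl_append_right hx h]
    have := pl_append_left hx' c₂ (u :: m)
    simpa using this.symm

theorem IsPolygonChain.split_top {a b : ℝ} {U L : List ℂ} (h : IsPolygonChain a b U L)
    (U₁ : List ℂ) (u : ℂ) (m : List ℂ) (v : ℂ) (U₂ : List ℂ) (hU : U = U₁ ++ u :: (m ++ v :: U₂))
    (hm : ∀ w ∈ m, lineAt u v w.re ≤ w.im)
    (hL : ∀ w ∈ L, u.re < w.re → w.re < v.re → w.im ≤ lineAt u v w.re) :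
    IsPolygonChain u.re v.re (u :: (m ++ [v])) [u, v] ∧
    IsPolygonChain a b (U₁ ++ u :: v :: U₂) L ∧
    cell a b (pl L) (pl U) = cell u.re v.re (pl [u, v]) (pl (u :: (m ++ [v]))) ∪
      cell a b (pl L) (pl (U₁ ++ u :: v :: U₂)) ∧
    cell u.re v.re (pl [u, v]) (pl (u :: (m ++ [v]))) ∩
      cell a b (pl L) (pl (U₁ ++ u :: v :: U₂)) ⊆ segment ℝ u v := by
  have hsub : (u :: (m ++ [v])).Sublist U := by
    rw [hU]
    refine List.Sublist.trans ?_ (List.sublist_append_right U₁ _)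
    exact ((List.Sublist.refl m).append ((List.nil_sublist U₂).cons_cons v)).cons_cons u
  have hsub' : (U₁ ++ u :: v :: U₂).Sublist U := by
    rw [hU]
    exact ((List.sublist_append_right m (v :: U₂)).cons_cons u).append_left U₁
  have hmonoA := h.monoU.sublist hsub
  have hmonoB := h.monoU.sublist hsub'
  have huv : u.re < v.re := hmonoA.head_lt (by simp)
  have huU : u ∈ U := hsub.subset (by simp)
  have hvU : v ∈ U := hsub.subset (by simp)
  have hau := h.monoU.head_le h.headU huU
  have hvb := h.monoU.le_last h.lastU hvU
  have hLline := pl_le_lineAt h.monoL huv h.headL hau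
    (by rw [← pl_at h.monoU huU]; exact h.le _ hau (huv.le.trans hvb))
    (by rw [← pl_at h.monoU hvU]; exact h.le _ (hau.trans huv.le) hvb) hL
  have hUline := lineAt_le_pl hmonoA huv (a := u.re) (by simp) le_rfl
    (by rw [pl_at hmonoA (by simp)]) (by rw [pl_at hmonoA (by simp)])
    (by
      intro w hw h₁ h₂
      rcases List.mem_cons.1 hw with rfl | hw
      · exact absurd h₁ (lt_irrefl _)
      rcases List.mem_append.1 hw with hw | hw
      · exact hm w hw
      · obtain rfl : w = v := by simpa using hw
        exact absurd h₂ (lt_irrefl _))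
  have hsh := pl_shortcut hU h.monoU
  obtain ⟨c₁, c₂, c₃, c₄⟩ := cell_split (a := a) (b := b) (a₁ := u.re) (b₁ := v.re) (a₂ := a)
    (b₂ := b) (f := pl L) (g := pl U) (f₁ := pl [u, v]) (g₁ := pl (u :: (m ++ [v]))) (f₂ := pl L)
    (g₂ := pl (U₁ ++ u :: v :: U₂)) huv
    (fun x h₁ h₂ => ⟨pl_mid _ h₁ h₂, (hsh x).2.2.2 h₁ h₂, rfl, (hsh x).2.1 h₁ h₂, hLline x h₁ h₂,
      (hUline x h₁ h₂).trans ((hsh x).2.2.2 h₁ h₂).le⟩)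
    (fun x h₁ h₂ => .inl ⟨h₁, h₂⟩)
    (fun x h₁ h₂ => by
      rcases le_total x u.re with hx | hx
      · exact .inr ⟨rfl, (hsh x).1 hx⟩
      rcases le_total x v.re with hx' | hx'
      · exact .inl ⟨hx, hx'⟩
      · exact .inr ⟨rfl, (hsh x).2.2.1 hx'⟩)
    (fun x h₁ h₂ => .inr ⟨h₁, h₂⟩) ⟨hau, hvb, le_rfl, le_rfl⟩ ⟨le_rfl, le_rfl, hau, hvb⟩
    ⟨.inl rfl, .inl rfl⟩ h.le
  refine ⟨⟨hmonoA, by simp [IsMono, huv], by simp, by simp, ?_, by simp, c₁⟩,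
    ⟨hmonoB, h.monoL, ?_, h.headL, ?_, h.lastL, c₂⟩, c₃, c₄⟩
  · rw [← List.cons_append, List.getLast?_concat, Option.map_some]
  · rw [← h.headU, hU]; cases U₁ <;> rfl
  · rw [← h.lastU, hU]
    simp [List.getLast?_append, List.getLast?_cons]

theorem IsPolygonChain.split_bot_top {a b : ℝ} {U L : List ℂ} (h : IsPolygonChain a b U L)
    (U₁ : List ℂ) (v : ℂ) (U₂ L₁ : List ℂ) (u : ℂ) (L₂ : List ℂ) (hU : U = U₁ ++ v :: U₂)
    (hL : L = L₁ ++ u :: L₂) (huv : u.re < v.re)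
    (hUw : ∀ w ∈ U, u.re < w.re → w.re < v.re → lineAt u v w.re ≤ w.im)
    (hLw : ∀ w ∈ L, u.re < w.re → w.re < v.re → w.im ≤ lineAt u v w.re) :
    IsPolygonChain a v.re (U₁ ++ [v]) (L₁ ++ [u, v]) ∧
    IsPolygonChain u.re b (u :: v :: U₂) (u :: L₂) ∧
    cell a b (pl L) (pl U) = cell a v.re (pl (L₁ ++ [u, v])) (pl (U₁ ++ [v])) ∪
      cell u.re b (pl (u :: L₂)) (pl (u :: v :: U₂)) ∧
    cell a v.re (pl (L₁ ++ [u, v])) (pl (U₁ ++ [v])) ∩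
      cell u.re b (pl (u :: L₂)) (pl (u :: v :: U₂)) ⊆ segment ℝ u v := by
  have huL : u ∈ L := by simp [hL]
  have hvU : v ∈ U := by simp [hU]
  have hau := h.monoL.head_le h.headL huL
  have hvb := h.monoU.le_last h.lastU hvU
  have hLline := pl_le_lineAt h.monoL huv h.headL hau (pl_at h.monoL huL).le
    (by rw [← pl_at h.monoU hvU]; exact h.le _ (hau.trans huv.le) hvb) hLw
  have hUline := lineAt_le_pl h.monoU huv h.headU hau
    (by rw [← pl_at h.monoL huL]; exact h.le _ hau (huv.le.trans hvb))
    (pl_at h.monoU hvU).ge hUw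
  have hmU₁ : IsMono (U₁ ++ [v]) := h.monoU.sublist (by
    rw [hU]; exact ((List.nil_sublist U₂).cons_cons v).append_left U₁)
  have hmU₂ : IsMono (v :: U₂) := h.monoU.sublist (by rw [hU]; exact List.sublist_append_right _ _)
  have hmL₁ : IsMono (L₁ ++ [u]) := h.monoL.sublist (by
    rw [hL]; exact ((List.nil_sublist L₂).cons_cons u).append_left L₁)
  have hmL₂ : IsMono (u :: L₂) := h.monoL.sublist (by rw [hL]; exact List.sublist_append_right _ _)
  have hmA : IsMono (L₁ ++ [u, v]) := by
    rw [IsMono, List.pairwise_append] at hmL₁ ⊢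
    refine ⟨hmL₁.1, by simp [huv], fun w hw w' hw' => ?_⟩
    have := hmL₁.2.2 w hw u (by simp)
    simp only [List.mem_cons, List.not_mem_nil, or_false] at hw'
    rcases hw' with rfl | rfl
    · exact this
    · exact this.trans huv
  have hmB : IsMono (u :: v :: U₂) := by
    refine List.pairwise_cons.2 ⟨fun w hw => ?_, hmU₂⟩
    rcases List.mem_cons.1 hw with rfl | hw
    · exact huv
    · exact huv.trans (hmU₂.head_lt hw)
  have hmid : ∀ x, u.re ≤ x → x ≤ v.re → pl (L₁ ++ [u, v]) x = lineAt u v x ∧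
      pl (U₁ ++ [v]) x = pl U x ∧ pl (u :: L₂) x = pl L x ∧ pl (u :: v :: U₂) x = lineAt u v x ∧
      pl L x ≤ lineAt u v x ∧ lineAt u v x ≤ pl U x := by
    refine fun x h₁ h₂ => ⟨?_, ?_, ?_, pl_mid _ h₁ h₂, hLline x h₁ h₂, hUline x h₁ h₂⟩
    · rw [pl_append_right h₁ hmA, pl_mid _ h₁ h₂]
    · rw [hU, pl_append_left h₂ U₂]
    · rw [hL, pl_append_right h₁ (hL ▸ h.monoL)]
  have hA : ∀ x, a ≤ x → x ≤ v.re → (u.re ≤ x ∧ x ≤ v.re) ∨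
      (pl (L₁ ++ [u, v]) x = pl L x ∧ pl (U₁ ++ [v]) x = pl U x) := by
    intro x h₁ h₂
    rcases le_total x u.re with hx | hx
    · refine .inr ⟨?_, ?_⟩
      · rw [hL, pl_append_left hx [v], pl_append_left hx L₂]
      · rw [hU, pl_append_left h₂ U₂]
    · exact .inl ⟨hx, h₂⟩
  have hB : ∀ x, u.re ≤ x → x ≤ b → (u.re ≤ x ∧ x ≤ v.re) ∨
      (pl (u :: L₂) x = pl L x ∧ pl (u :: v :: U₂) x = pl U x) := by
    intro x h₁ h₂
    rcases le_total x v.re with hx | hx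
    · exact .inl ⟨h₁, hx⟩
    · refine .inr ⟨?_, ?_⟩
      · rw [hL, pl_append_right h₁ (hL ▸ h.monoL)]
      · rw [pl_right _ huv hx, hU, pl_append_right hx (hU ▸ h.monoU)]
  have hcov : ∀ x, a ≤ x → x ≤ b → (a ≤ x ∧ x ≤ v.re) ∨ (u.re ≤ x ∧ x ≤ b) := by
    intro x h₁ h₂
    rcases le_total x v.re with hx | hx
    · exact .inl ⟨h₁, hx⟩
    · exact .inr ⟨huv.le.trans hx, h₂⟩
  obtain ⟨c₁, c₂, c₃, c₄⟩ := cell_split huv hmid hA hB hcov ⟨le_rfl, hvb, hau, le_rfl⟩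
    ⟨hau, le_rfl, le_rfl, hvb⟩ ⟨.inr rfl, .inl rfl⟩ h.le
  refine ⟨⟨hmU₁, hmA, ?_, ?_, ?_, ?_, c₁⟩, ⟨hmB, hmL₂, by simp, by simp, ?_, ?_, c₂⟩, c₃, c₄⟩
  · rw [← h.headU, hU]; cases U₁ <;> rfl
  · rw [← h.headL, hL]; cases L₁ <;> rfl
  · rw [List.getLast?_concat, Option.map_some]
  · simp [List.getLast?_append]
  · rw [← h.lastU, hU]
    simp [List.getLast?_append, List.getLast?_cons]
  · rw [← h.lastL, hL]
    simp [List.getLast?_append, List.getLast?_cons]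

theorem lineAt_conj (u v : ℂ) (x : ℝ) :
    lineAt (starRingEnd ℂ u) (starRingEnd ℂ v) x = -lineAt u v x := by
  simp only [lineAt, Complex.conj_re, Complex.conj_im]
  ring

theorem IsPolygonChain.conj {a b : ℝ} {U L : List ℂ} (h : IsPolygonChain a b U L) :
    IsPolygonChain a b (L.map (starRingEnd ℂ)) (U.map (starRingEnd ℂ)) where
  monoU := h.monoL.map_conj
  monoL := h.monoU.map_conj
  headU := by rw [← h.headL]; simp [Function.comp_def]
  headL := by rw [← h.headU]; simp [Function.comp_def]
  lastU := by rw [← h.lastL]; simp [Function.comp_def]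
  lastL := by rw [← h.lastU]; simp [Function.comp_def]
  le x h₁ h₂ := by
    rw [pl_map_conj, pl_map_conj]
    linarith [h.le x h₁ h₂]

theorem cell_conj (a b : ℝ) (U L : List ℂ) :
    cell a b (pl (U.map (starRingEnd ℂ))) (pl (L.map (starRingEnd ℂ))) =
      starRingEnd ℂ ⁻¹' cell a b (pl L) (pl U) := by
  ext z
  simp only [cell, pl_map_conj, Set.mem_ofPred_eq, Set.mem_preimage, Complex.conj_re,
    Complex.conj_im]
  constructor
  · rintro ⟨h₁, h₂, h₃, h₄⟩
    exact ⟨h₁, h₂, by linarith, by linarith⟩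
  · rintro ⟨h₁, h₂, h₃, h₄⟩
    exact ⟨h₁, h₂, by linarith, by linarith⟩

theorem map_conj_conj (l : List ℂ) : (l.map (starRingEnd ℂ)).map (starRingEnd ℂ) = l := by
  simp [Function.comp_def]

theorem conj_mem_segment {u v z : ℂ} (h : starRingEnd ℂ z ∈ segment ℝ (starRingEnd ℂ u)
    (starRingEnd ℂ v)) : z ∈ segment ℝ u v := by
  obtain ⟨s, t, hs, ht, hst, h⟩ := h
  refine ⟨s, t, hs, ht, hst, ?_⟩
  have := congrArg (starRingEnd ℂ) h
  simpa using this

theorem conj_split {a b a₁ b₁ a₂ b₂ : ℝ} {U L U₁ L₁ U₂ L₂ : List ℂ} {u v : ℂ}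
    (h : IsPolygonChain a₁ b₁ (L₁.map (starRingEnd ℂ)) (U₁.map (starRingEnd ℂ)) ∧
      IsPolygonChain a₂ b₂ (L₂.map (starRingEnd ℂ)) (U₂.map (starRingEnd ℂ)) ∧
      cell a b (pl (U.map (starRingEnd ℂ))) (pl (L.map (starRingEnd ℂ))) =
        cell a₁ b₁ (pl (U₁.map (starRingEnd ℂ))) (pl (L₁.map (starRingEnd ℂ))) ∪
        cell a₂ b₂ (pl (U₂.map (starRingEnd ℂ))) (pl (L₂.map (starRingEnd ℂ))) ∧
      cell a₁ b₁ (pl (U₁.map (starRingEnd ℂ))) (pl (L₁.map (starRingEnd ℂ))) ∩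
        cell a₂ b₂ (pl (U₂.map (starRingEnd ℂ))) (pl (L₂.map (starRingEnd ℂ))) ⊆
        segment ℝ (starRingEnd ℂ u) (starRingEnd ℂ v)) :
    IsPolygonChain a₁ b₁ U₁ L₁ ∧ IsPolygonChain a₂ b₂ U₂ L₂ ∧
    cell a b (pl L) (pl U) = cell a₁ b₁ (pl L₁) (pl U₁) ∪ cell a₂ b₂ (pl L₂) (pl U₂) ∧
    cell a₁ b₁ (pl L₁) (pl U₁) ∩ cell a₂ b₂ (pl L₂) (pl U₂) ⊆ segment ℝ u v := by
  obtain ⟨h₁, h₂, h₃, h₄⟩ := h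
  rw [cell_conj, cell_conj, cell_conj, ← Set.preimage_union] at h₃
  rw [cell_conj, cell_conj] at h₄
  refine ⟨?_, ?_, ?_, ?_⟩
  · simpa only [map_conj_conj] using h₁.conj
  · simpa only [map_conj_conj] using h₂.conj
  · exact (Set.preimage_injective.2 (star_involutive (R := ℂ)).surjective) h₃
  · intro z hz
    refine conj_mem_segment (h₄ ?_)
    simpa using hz

theorem IsPolygonChain.split_bot {a b : ℝ} {U L : List ℂ} (h : IsPolygonChain a b U L)
    (L₁ : List ℂ) (u : ℂ) (m : List ℂ) (v : ℂ) (L₂ : List ℂ) (hL : L = L₁ ++ u :: (m ++ v :: L₂))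
    (hm : ∀ w ∈ m, w.im ≤ lineAt u v w.re)
    (hU : ∀ w ∈ U, u.re < w.re → w.re < v.re → lineAt u v w.re ≤ w.im) :
    IsPolygonChain u.re v.re [u, v] (u :: (m ++ [v])) ∧
    IsPolygonChain a b U (L₁ ++ u :: v :: L₂) ∧
    cell a b (pl L) (pl U) = cell u.re v.re (pl (u :: (m ++ [v]))) (pl [u, v]) ∪
      cell a b (pl (L₁ ++ u :: v :: L₂)) (pl U) ∧
    cell u.re v.re (pl (u :: (m ++ [v]))) (pl [u, v]) ∩
      cell a b (pl (L₁ ++ u :: v :: L₂)) (pl U) ⊆ segment ℝ u v := by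
  refine conj_split ?_
  have := h.conj.split_top (L₁.map (starRingEnd ℂ)) (starRingEnd ℂ u) (m.map (starRingEnd ℂ))
    (starRingEnd ℂ v) (L₂.map (starRingEnd ℂ)) (by simp [hL])
    (by
      intro w₀ hw₀
      obtain ⟨w, hw, rfl⟩ := List.mem_map.1 hw₀
      rw [lineAt_conj, Complex.conj_re, Complex.conj_im]
      linarith [hm w hw])
    (by
      intro w₀ hw₀
      obtain ⟨w, hw, rfl⟩ := List.mem_map.1 hw₀
      rw [lineAt_conj, Complex.conj_re, Complex.conj_im, Complex.conj_re, Complex.conj_re]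
      intro h₁ h₂
      linarith [hU w hw h₁ h₂])
  simpa only [List.map_append, List.map_cons, List.map_nil, Complex.conj_re] using this

theorem IsPolygonChain.split_top_bot {a b : ℝ} {U L : List ℂ} (h : IsPolygonChain a b U L)
    (U₁ : List ℂ) (u : ℂ) (U₂ L₁ : List ℂ) (v : ℂ) (L₂ : List ℂ) (hU : U = U₁ ++ u :: U₂)
    (hL : L = L₁ ++ v :: L₂) (huv : u.re < v.re)
    (hUw : ∀ w ∈ U, u.re < w.re → w.re < v.re → lineAt u v w.re ≤ w.im)
    (hLw : ∀ w ∈ L, u.re < w.re → w.re < v.re → w.im ≤ lineAt u v w.re) :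
    IsPolygonChain a v.re (U₁ ++ [u, v]) (L₁ ++ [v]) ∧
    IsPolygonChain u.re b (u :: U₂) (u :: v :: L₂) ∧
    cell a b (pl L) (pl U) = cell a v.re (pl (L₁ ++ [v])) (pl (U₁ ++ [u, v])) ∪
      cell u.re b (pl (u :: v :: L₂)) (pl (u :: U₂)) ∧
    cell a v.re (pl (L₁ ++ [v])) (pl (U₁ ++ [u, v])) ∩
      cell u.re b (pl (u :: v :: L₂)) (pl (u :: U₂)) ⊆ segment ℝ u v := by
  refine conj_split ?_
  have := h.conj.split_bot_top (L₁.map (starRingEnd ℂ)) (starRingEnd ℂ v) (L₂.map (starRingEnd ℂ))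
    (U₁.map (starRingEnd ℂ)) (starRingEnd ℂ u) (U₂.map (starRingEnd ℂ)) (by simp [hL])
    (by simp [hU]) (by simpa using huv)
    (by
      intro w₀ hw₀
      obtain ⟨w, hw, rfl⟩ := List.mem_map.1 hw₀
      rw [lineAt_conj, Complex.conj_re, Complex.conj_im, Complex.conj_re, Complex.conj_re]
      intro h₁ h₂
      linarith [hLw w hw h₁ h₂])
    (by
      intro w₀ hw₀
      obtain ⟨w, hw, rfl⟩ := List.mem_map.1 hw₀
      rw [lineAt_conj, Complex.conj_re, Complex.conj_im, Complex.conj_re, Complex.conj_re]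
      intro h₁ h₂
      linarith [hUw w hw h₁ h₂])
  simpa only [List.map_append, List.map_cons, List.map_nil, Complex.conj_re] using this

/-- The union of the segments joining consecutive points. -/
def brokenLine : List ℂ → Set ℂ
  | [] => ∅
  | [u] => {u}
  | u :: v :: l => segment ℝ u v ∪ brokenLine (v :: l)

theorem mem_brokenLine_iff : ∀ {c : List ℂ} {a b : ℝ}, IsMono c →
    c.head?.map Complex.re = some a → c.getLast?.map Complex.re = some b → ∀ z : ℂ,
    (z ∈ brokenLine c ↔ a ≤ z.re ∧ z.re ≤ b ∧ z.im = pl c z.re)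
  | [], _, _, _, h, _, _ => by simp at h
  | [u], a, b, _, ha, hb, z => by
    simp only [List.head?_cons, List.getLast?_singleton, Option.map_some, Option.some.injEq] at ha hb
    subst ha hb
    simp only [brokenLine, Set.mem_singleton_iff, pl, Complex.ext_iff]
    constructor
    · rintro ⟨h₁, h₂⟩
      exact ⟨h₁.ge, h₁.le, h₂⟩
    · rintro ⟨h₁, h₂, h₃⟩
      exact ⟨le_antisymm h₂ h₁, h₃⟩
  | u :: v :: l, a, b, h, ha, hb, z => by
    have huv : u.re < v.re := h.head_lt (by simp)
    have hb' : (v :: l).getLast?.map Complex.re = some b := by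
      rw [← hb, List.getLast?_cons_cons]
    have ih := mem_brokenLine_iff (c := v :: l) (a := v.re) h.tail (by simp) hb' z
    have hvb : v.re ≤ b := h.tail.le_last hb' (by simp)
    simp only [List.head?_cons, Option.map_some, Option.some.injEq] at ha
    rw [brokenLine, Set.mem_union, ih, mem_segment_iff_lineAt huv, ← ha]
    constructor
    · rintro (⟨h₁, h₂, h₃⟩ | ⟨h₁, h₂, h₃⟩)
      · exact ⟨h₁, h₂.trans hvb, by rwa [pl_mid _ h₁ h₂]⟩
      · exact ⟨huv.le.trans h₁, h₂, by rwa [pl_right _ huv h₁]⟩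
    · rintro ⟨h₁, h₂, h₃⟩
      rcases le_total z.re v.re with hz | hz
      · exact .inl ⟨h₁, hz, by rwa [pl_mid _ h₁ hz] at h₃⟩
      · exact .inr ⟨hz, h₂, by rwa [pl_right _ huv hz] at h₃⟩

theorem IsPolygonChain.verticalHull_eq {a b : ℝ} {U L : List ℂ} (h : IsPolygonChain a b U L)
    {S : Set ℂ} (hS : S = brokenLine U ∪ brokenLine L) :
    verticalHull S = cell a b (pl L) (pl U) := by
  have hm : ∀ z, z ∈ S ↔ (a ≤ z.re ∧ z.re ≤ b ∧ z.im = pl U z.re) ∨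
      (a ≤ z.re ∧ z.re ≤ b ∧ z.im = pl L z.re) := by
    intro z
    rw [hS, Set.mem_union, mem_brokenLine_iff h.monoU h.headU h.lastU,
      mem_brokenLine_iff h.monoL h.headL h.lastL]
  ext z
  constructor
  · rintro ⟨x, hx, y, hy, hxz, hyz, h₁, h₂⟩
    rw [hm, hxz] at hx
    rw [hm, hyz] at hy
    have hab : a ≤ z.re ∧ z.re ≤ b := by
      rcases hx with hx | hx <;> exact ⟨hx.1, hx.2.1⟩
    have hle := h.le z.re hab.1 hab.2
    refine ⟨hab.1, hab.2, ?_, ?_⟩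
    · rcases hx with hx | hx <;> linarith [hx.2.2]
    · rcases hy with hy | hy <;> linarith [hy.2.2]
  · rintro ⟨h₁, h₂, h₃, h₄⟩
    exact ⟨⟨z.re, pl L z.re⟩, (hm _).2 (.inr ⟨h₁, h₂, rfl⟩), ⟨z.re, pl U z.re⟩,
      (hm _).2 (.inl ⟨h₁, h₂, rfl⟩), rfl, rfl, h₃, h₄⟩

/-! ### Dissections -/

theorem interior_segment_eq_empty (u v : ℂ) : interior (segment ℝ u v) = ∅ := by
  by_contra h
  rw [← Ne, ← Set.nonempty_iff_ne_empty,
    (convex_segment u v).interior_nonempty_iff_affineSpan_eq_top] at h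
  have h₁ : affineSpan ℝ {u, v} = ⊤ := by
    rw [← convexHull_pair, affineSpan_convexHull] at h
    exact h
  have h₂ := (collinear_iff_finrank_le_one (k := ℝ) (s := ({u, v} : Set ℂ))).1
    (collinear_pair ℝ u v)
  rw [← direction_affineSpan, h₁, AffineSubspace.direction_top, finrank_top,
    Complex.finrank_real_complex] at h₂
  omega

/-- `S` is dissected into the sets `P k`, `k ∈ ks`, which are cut off one after the other along
segments `[u, v]` contained in the remaining set, with `E k l u v` if `[u, v]` is contained
in `P l`. -/
inductive Dissects {N : ℕ} (P : Fin N → Set ℂ) (E : Fin N → Fin N → ℂ → ℂ → Prop) :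
    List (Fin N) → Set ℂ → Prop
  | single (k : Fin N) : Dissects P E [k] (P k)
  | cons {k l : Fin N} {ks : List (Fin N)} {S : Set ℂ} {u v : ℂ} (hk : k ∉ ks) (hl : l ∈ ks)
      (hE : E k l u v) (hP : segment ℝ u v ⊆ P l) (hS : P k ∩ S ⊆ segment ℝ u v)
      (h : Dissects P E ks S) : Dissects P E (k :: ks) (P k ∪ S)

namespace Dissects

variable {N : ℕ} {P : Fin N → Set ℂ} {E : Fin N → Fin N → ℂ → ℂ → Prop} {ks : List (Fin N)}
  {S : Set ℂ}

theorem eq_iUnion (h : Dissects P E ks S) : S = ⋃ k ∈ ks, P k := by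
  induction h with
  | single k => simp
  | cons hk hl hE hP hS h ih => simp [ih]

theorem subset (h : Dissects P E ks S) {k : Fin N} (hk : k ∈ ks) : P k ⊆ S := by
  rw [h.eq_iUnion]
  exact Set.subset_biUnion_of_mem (u := P) hk

theorem connected (h : Dissects P E ks S) {x : ℂ} {T : Fin N → Fin N → Prop}
    (hT : ∀ k, x ∈ P k → T k k)
    (hsymm : ∀ k l, T k l → T l k) (htrans : ∀ k l m, T k l → T l m → T k m)
    (hE : ∀ k l u v, E k l u v → x ∈ segment ℝ u v → T k l) :
    ∀ k ∈ ks, ∀ l ∈ ks, x ∈ P k → x ∈ P l → T k l := by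
  induction h with
  | single k =>
    intro l hl m hm hxl hxm
    obtain rfl : l = k := by simpa using hl
    obtain rfl : m = l := by simpa using hm
    exact hT _ hxl
  | @cons k l ks S u v hk hl hEk hP hS h ih =>
    have key : ∀ m ∈ ks, x ∈ P k → x ∈ P m → T k m := by
      intro m hm hxk hxm
      have hx := hS ⟨hxk, h.subset hm hxm⟩
      exact htrans _ _ _ (hE k l u v hEk hx) (ih l hl m hm (hP hx) hxm)
    intro i hi j hj hxi hxj
    rcases List.mem_cons.1 hi with rfl | hi' <;> rcases List.mem_cons.1 hj with rfl | hj'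
    · exact hT _ hxi
    · exact key j hj' hxi hxj
    · exact hsymm _ _ (key i hi' hxj hxi)
    · exact ih i hi' j hj' hxi hxj

theorem disjoint_interior (h : Dissects P E ks S) :
    ∀ k ∈ ks, ∀ l ∈ ks, k ≠ l → Disjoint (interior (P k)) (interior (P l)) := by
  induction h with
  | single k =>
    intro l hl m hm hlm
    obtain rfl : l = k := by simpa using hl
    exact absurd (by simpa using hm) hlm.symm
  | @cons k l ks S u v hk hl hEk hP hS h ih =>
    have key : ∀ m ∈ ks, Disjoint (interior (P k)) (interior (P m)) := by
      intro m hm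
      rw [Set.disjoint_iff_inter_eq_empty, ← interior_inter, ← Set.subset_empty_iff,
        ← interior_segment_eq_empty u v]
      exact interior_mono ((Set.inter_subset_inter_right _ (h.subset hm)).trans hS)
    intro i hi j hj hij
    rcases List.mem_cons.1 hi with rfl | hi' <;> rcases List.mem_cons.1 hj with rfl | hj'
    · exact absurd rfl hij
    · exact key j hj'
    · exact (key i hi').symm
    · exact ih i hi' j hj' hij

end Dissects

namespace PolygonGluing

variable {n m : ℕ} {G : PolygonGluing n} {H : PolygonGluing m}

/-- The points `x` and `y` of the region represent the same point of the surface. -/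
def Same (G : PolygonGluing n) (x y : ℂ) : Prop :=
  ∃ (hx : x ∈ G.region) (hy : y ∈ G.region), G.toSurface ⟨x, hx⟩ = G.toSurface ⟨y, hy⟩

theorem Same.refl {x : ℂ} (hx : x ∈ G.region) : G.Same x x := ⟨hx, hx, rfl⟩

theorem Same.symm {x y : ℂ} (h : G.Same x y) : G.Same y x :=
  ⟨h.2.1, h.1, h.2.2.symm⟩

theorem Same.trans {x y z : ℂ} (h : G.Same x y) (h' : G.Same y z) : G.Same x z :=
  ⟨h.1, h'.2.1, h.2.2.trans h'.2.2⟩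

theorem Same.map {N : ℕ} (P : Fin N → Set ℂ) (f : Fin N → ℂ → ℂ) (hcov : G.region = ⋃ k, P k)
    (hconn : ∀ x k l, x ∈ P k → x ∈ P l → H.Same (f k x) (f l x))
    (hside : ∀ j, ∃ k l, ∀ t ∈ Set.Icc (0 : ℝ) 1, G.startA j + t * G.vec j ∈ P k ∧
      G.startB j + t * G.vec j ∈ P l ∧
      H.Same (f k (G.startA j + t * G.vec j)) (f l (G.startB j + t * G.vec j)))
    {x y : ℂ} (h : G.Same x y) : ∀ k l, x ∈ P k → y ∈ P l → H.Same (f k x) (f l y) := by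
  obtain ⟨hx, hy, h⟩ := h
  have hgen : Relation.EqvGen G.sideRel ⟨x, hx⟩ ⟨y, hy⟩ := Quotient.exact h
  suffices ∀ x y : G.region, Relation.EqvGen G.sideRel x y →
      ∀ k l, (x : ℂ) ∈ P k → (y : ℂ) ∈ P l → H.Same (f k x) (f l y) from this _ _ hgen
  intro x y h
  induction h with
  | rel x y h =>
    obtain ⟨j, t, ht, hx, hy⟩ := h
    obtain ⟨k', l', h'⟩ := hside j
    obtain ⟨h₁, h₂, h₃⟩ := h' t ht
    rw [← hx, ← hy] at h₃
    rw [← hx] at h₁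
    rw [← hy] at h₂
    intro k l hk hl
    exact ((hconn x k k' hk h₁).trans h₃).trans (hconn y l' l h₂ hl)
  | refl x => exact fun k l hk hl => hconn x k l hk hl
  | symm x y _ ih => exact fun k l hk hl => (ih l k hl hk).symm
  | trans x y z _ _ ih ih' =>
    intro k l hk hl
    obtain ⟨i, hi⟩ := Set.mem_iUnion.1 (hcov.subset y.2)
    exact (ih k i hk hi).trans (ih' i l hi hl)

end PolygonGluing

/-! ### Transition matrices and Perron eigenvalues -/

section Rauzy

variable {ι : Type} [Fintype ι] [DecidableEq ι]

/-- Add the column `a` to the column `b`. -/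
def addColumn (M : Matrix ι ι ℤ) (a b : ι) : Matrix ι ι ℤ :=
  fun i c => if c = b then M i c + M i a else M i c

theorem mul_transvection_one (M : Matrix ι ι ℤ) (a b : ι) :
    M * Matrix.transvection a b 1 = addColumn M a b := by
  ext i c
  by_cases h : c = b
  · subst h
    simp [addColumn]
  · simp [addColumn, h]

/-- `rauzyStep` with the matrix multiplication written as a column operation. -/
def rauzyColumnStep (s : List ι × List ι × Matrix ι ι ℤ) (ε : Fin 2) :
    List ι × List ι × Matrix ι ι ℤ :=
  match s.1.getLast?, s.2.1.getLast? with
  | some a, some b =>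
    if ε = 0 then (s.1, insertAfter a b s.2.1.dropLast, addColumn s.2.2 a b)
    else (insertAfter b a s.1.dropLast, s.2.1, addColumn s.2.2 b a)
  | _, _ => s

theorem rauzyStep_eq : rauzyStep (ι := ι) = rauzyColumnStep := by
  funext s ε
  simp only [rauzyStep, rauzyColumnStep, mul_transvection_one]

end Rauzy

/-- A positive eigenvector of a nonnegative matrix belongs to an eigenvalue of maximal modulus. -/
theorem norm_le_of_charpoly_isRoot {n : Type*} [Fintype n] [DecidableEq n] {B : Matrix n n ℝ}
    (hB : ∀ i j, 0 ≤ B i j) {w : n → ℝ} (hw : ∀ i, 0 < w i) {r : ℝ} (h : B.mulVec w = r • w)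
    {μ : ℂ} (hμ : (B.map (algebraMap ℝ ℂ)).charpoly.IsRoot μ) : ‖μ‖ ≤ r := by
  rw [← Matrix.charpoly_toLin', ← Module.End.hasEigenvalue_iff_isRoot_charpoly] at hμ
  obtain ⟨v, hv⟩ := hμ.exists_hasEigenvector
  have hv0 := hv.2
  have hv1 : ∀ i, ∑ j, (B i j : ℂ) * v j = μ * v i := by
    intro i
    have := congrFun hv.apply_eq_smul i
    simpa [Matrix.toLin'_apply, Matrix.mulVec, dotProduct] using this
  obtain ⟨i₀, hi₀⟩ := Function.ne_iff.1 hv0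
  have : Nonempty n := ⟨i₀⟩
  obtain ⟨i, hi⟩ := Finite.exists_max fun i => ‖v i‖ / w i
  have hc : 0 < ‖v i‖ / w i :=
    (div_pos (norm_pos_iff.2 hi₀) (hw i₀)).trans_le (hi i₀)
  have hle : ∀ j, ‖v j‖ ≤ ‖v i‖ / w i * w j := fun j => (div_le_iff₀ (hw j)).1 (hi j)
  have key : ‖μ‖ * ‖v i‖ ≤ r * ‖v i‖ := by
    calc ‖μ‖ * ‖v i‖ = ‖∑ j, (B i j : ℂ) * v j‖ := by rw [hv1, norm_mul]
      _ ≤ ∑ j, ‖(B i j : ℂ) * v j‖ := norm_sum_le _ _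
      _ ≤ ∑ j, B i j * (‖v i‖ / w i * w j) := by
        refine Finset.sum_le_sum fun j _ => ?_
        rw [norm_mul, Complex.norm_real, Real.norm_of_nonneg (hB i j)]
        exact mul_le_mul_of_nonneg_left (hle j) (hB i j)
      _ = ‖v i‖ / w i * (B.mulVec w) i := by
        rw [Matrix.mulVec, dotProduct, Finset.mul_sum]
        exact Finset.sum_congr rfl fun j _ => by ring
      _ = r * ‖v i‖ := by
        rw [h, Pi.smul_apply, smul_eq_mul]
        field_simp [(hw i).ne']
  have hvi : 0 < ‖v i‖ := by
    have := mul_pos hc (hw i)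
    rwa [div_mul_cancel₀ _ (hw i).ne'] at this
  exact le_of_mul_le_mul_right key hvi

namespace GenusFour

theorem isClosedRauzyPath : IsClosedRauzyPath perm path R := by
  unfold IsClosedRauzyPath
  rw [rauzyStep_eq]
  refine ⟨by decide +kernel, by decide +kernel, by decide +kernel⟩

theorem isRoot_iff (x : ℝ) : poly.IsRoot x ↔ x ^ 8 - x ^ 5 - x ^ 4 - x ^ 3 + 1 = 0 := by
  simp [poly, Polynomial.IsRoot]

theorem root_unique {x y : ℝ} (hx : 1 < x) (hy : 1 < y) (hx₀ : poly.IsRoot x)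
    (hy₀ : poly.IsRoot y) : x = y := by
  rw [isRoot_iff] at hx₀ hy₀
  have ht : ∀ z : ℝ, 1 < z → z ^ 8 - z ^ 5 - z ^ 4 - z ^ 3 + 1 = 0 →
      2 < z + z⁻¹ ∧ (z + z⁻¹) ^ 4 - 4 * (z + z⁻¹) ^ 2 - (z + z⁻¹) + 1 = 0 := by
    intro z hz h
    have hz0 : z ≠ 0 := by linarith
    constructor
    · have h1 : z + z⁻¹ - 2 = (z - 1) ^ 2 / z := by field_simp; ring
      have h2 : 0 < (z - 1) ^ 2 / z := div_pos (pow_pos (by linarith) 2) (by linarith)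
      linarith
    · have : (z + z⁻¹) ^ 4 - 4 * (z + z⁻¹) ^ 2 - (z + z⁻¹) + 1 =
          (z ^ 8 - z ^ 5 - z ^ 4 - z ^ 3 + 1) / z ^ 4 := by field_simp; ring
      rw [this, h, zero_div]
  obtain ⟨h₁, e₁⟩ := ht x hx hx₀
  obtain ⟨h₂, e₂⟩ := ht y hy hy₀
  set s := x + x⁻¹ with hs
  set t := y + y⁻¹ with ht'
  have hst : s = t := by
    have hprod : (s - t) * ((s + t) * (s ^ 2 + t ^ 2 - 4) - 1) = 0 := by linear_combination e₁ - e₂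
    rcases mul_eq_zero.1 hprod with h | h
    · linarith
    · nlinarith [mul_pos (sub_pos.2 h₁) (sub_pos.2 h₁), mul_pos (sub_pos.2 h₂) (sub_pos.2 h₂)]
  have hxy : (x - y) * (x * y - 1) = 0 := by
    have hx0 : x ≠ 0 := by linarith
    have hy0 : y ≠ 0 := by linarith
    have : (x - y) * (x * y - 1) = x * y * (s - t) := by
      rw [hs, ht']; field_simp; ring
    rw [this, hst]; ring
  rcases mul_eq_zero.1 hxy with h | h
  · linarith
  · nlinarith

theorem exists_root : ∃ x : ℝ, 1.28063815 < x ∧ x < 1.28063816 ∧ poly.IsRoot x := by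
  have hcont : ContinuousOn (fun x : ℝ => x ^ 8 - x ^ 5 - x ^ 4 - x ^ 3 + 1)
      (Set.Icc 1.28063815 1.28063816) := by fun_prop
  have := intermediate_value_Ioo (by norm_num) hcont
  obtain ⟨x, hx, h⟩ := this (show (0 : ℝ) ∈ Set.Ioo _ _ by constructor <;> norm_num)
  exact ⟨x, hx.1, hx.2, (isRoot_iff x).2 h⟩

theorem root_bounds {α : ℝ} (h : α < -1) (hα : poly.IsRoot (-α)) :
    -1.28063816 < α ∧ α < -1.28063815 := by
  obtain ⟨x, h₁, h₂, hx⟩ := exists_root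
  have := root_unique (by linarith) (by linarith) hx hα
  constructor <;> linarith

theorem existsUnique_root : ∃! α : ℝ, α < -1 ∧ poly.IsRoot (-α) := by
  obtain ⟨x, h₁, h₂, hx⟩ := exists_root
  refine ⟨-x, ⟨by linarith, by rwa [neg_neg]⟩, ?_⟩
  rintro y ⟨hy, hy'⟩
  have := root_unique (by linarith) (by linarith) hx hy'
  linarith

theorem isGreatest_abs {α : ℝ} (h : α < -1) (hα : poly.IsRoot (-α)) :
    IsGreatest {x : ℝ | poly.IsRoot x} |α| := by
  rw [abs_of_neg (by linarith)]
  refine ⟨hα, fun x hx => ?_⟩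
  rcases le_or_gt x 1 with hx1 | hx1
  · linarith
  · exact (root_unique hx1 (by linarith) hx hα).le

theorem minpoly_eq {α : ℝ} (hα : poly.IsRoot (-α)) : α ^ 8 + α ^ 5 - α ^ 4 + α ^ 3 + 1 = 0 := by
  rw [isRoot_iff] at hα
  linear_combination hα

theorem lam_eq (α : ℝ) : lam α = ![α - 2 * α ^ 2 + α ^ 3 - α ^ 4 + α ^ 6 - α ^ 7,
    -α + α ^ 2 + α ^ 4 - α ^ 6, -1 - α ^ 2 - α ^ 5,
    -1 + 2 * α - α ^ 2 + α ^ 3 - α ^ 5 + α ^ 6, 1 - α + α ^ 2 + α ^ 5,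
    -1 + α - α ^ 2 + α ^ 3 - α ^ 4 - α ^ 5 - α ^ 7,
    1 - 2 * α + 2 * α ^ 2 - 2 * α ^ 3 + α ^ 4 + α ^ 5 - α ^ 6 + α ^ 7,
    α ^ 2 - α ^ 3 + α ^ 4 + α ^ 7, 1] := by
  ext j
  fin_cases j <;> simp [lam, eval, Fin.sum_univ_eight] <;> ring

theorem tau_eq (α : ℝ) : tau α = ![-1 - α ^ 5, -α ^ 2 + α ^ 3 + α ^ 5 - α ^ 7,
    -α ^ 2 - α ^ 4 - α ^ 7, α + α ^ 6, α ^ 3, -α ^ 2 + α ^ 6, -α ^ 6, α, -1] := by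
  ext j
  fin_cases j <;> simp [tau, eval, Fin.sum_univ_eight] <;> ring

theorem mulVec_lam {α : ℝ} (hα : α ^ 8 + α ^ 5 - α ^ 4 + α ^ 3 + 1 = 0) :
    (R.map (Int.cast : ℤ → ℝ)).mulVec (lam α) = α ^ 4 • lam α := by
  rw [lam_eq]
  ext j
  fin_cases j <;> simp [R, Matrix.mulVec, dotProduct, Fin.sum_univ_succ]
  · linear_combination (α ^ 3 - α ^ 2) * hα
  · linear_combination (α ^ 2 - 1) * hα
  · linear_combination α * hα
  · linear_combination (-α ^ 2 + α) * hα
  · linear_combination -α * hα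
  · linear_combination (α ^ 3 + α) * hα
  · linear_combination (-α ^ 3 + α ^ 2 - α) * hα
  · linear_combination (-α ^ 3) * hα
  · ring

theorem mulVec_tau {α : ℝ} (hα : α ^ 8 + α ^ 5 - α ^ 4 + α ^ 3 + 1 = 0) :
    (R.map (Int.cast : ℤ → ℝ)).mulVec (tau α) = (α ^ 4)⁻¹ • tau α := by
  have h0 : α ^ 4 ≠ 0 := by
    intro h
    have h' : α = 0 := by simpa using h
    simp [h'] at hα
  rw [eq_inv_smul_iff₀ h0, tau_eq]
  ext j
  fin_cases j <;> simp [R, Matrix.mulVec, dotProduct, Fin.sum_univ_succ]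
  · linear_combination (-α ^ 3 + 1) * hα
  · linear_combination (-α ^ 3 + α ^ 2) * hα
  · linear_combination α ^ 2 * hα
  · linear_combination -α * hα
  · linear_combination (-α ^ 3) * hα
  · linear_combination α ^ 2 * hα
  · ring
  · linear_combination -α * hα
  · linear_combination (-α ^ 3 + 1) * hα

end GenusFour

namespace GenusFour

/-! ### The vertices of the polygon -/

/-- The coordinates of the vertex `pᵢ` of the polygon. -/
def coord (α : ℝ) : ℕ → ℂ
  | 2 => ⟨α - 2 * α ^ 2 + α ^ 3 - α ^ 4 + α ^ 6 - α ^ 7,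
      -1 - α ^ 5⟩
  | 3 => ⟨-α ^ 2 + α ^ 3 - α ^ 7,
      -1 - α ^ 2 + α ^ 3 - α ^ 7⟩
  | 4 => ⟨-1 - 2 * α ^ 2 + α ^ 3 - α ^ 5 - α ^ 7,
      -1 - 2 * α ^ 2 + α ^ 3 - α ^ 4 - 2 * α ^ 7⟩
  | 5 => ⟨-2 + 2 * α - 3 * α ^ 2 + 2 * α ^ 3 - 2 * α ^ 5 + α ^ 6 - α ^ 7,
      -1 + α - 2 * α ^ 2 + α ^ 3 - α ^ 4 + α ^ 6 - 2 * α ^ 7⟩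
  | 6 => ⟨-1 + α - 2 * α ^ 2 + 2 * α ^ 3 - α ^ 5 + α ^ 6 - α ^ 7,
      -1 + α - 2 * α ^ 2 + 2 * α ^ 3 - α ^ 4 + α ^ 6 - 2 * α ^ 7⟩
  | 7 => ⟨-2 + 2 * α - 3 * α ^ 2 + 3 * α ^ 3 - α ^ 4 - 2 * α ^ 5 + α ^ 6 - 2 * α ^ 7,
      -1 + α - 3 * α ^ 2 + 2 * α ^ 3 - α ^ 4 + 2 * α ^ 6 - 2 * α ^ 7⟩
  | 8 => ⟨-1 - α ^ 2 + α ^ 3 - α ^ 5 - α ^ 7,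
      -1 + α - 3 * α ^ 2 + 2 * α ^ 3 - α ^ 4 + α ^ 6 - 2 * α ^ 7⟩
  | 9 => ⟨-1 + α ^ 4 - α ^ 5,
      -1 + 2 * α - 3 * α ^ 2 + 2 * α ^ 3 - α ^ 4 + α ^ 6 - 2 * α ^ 7⟩
  | 10 => ⟨α ^ 4 - α ^ 5,
      -2 + 2 * α - 3 * α ^ 2 + 2 * α ^ 3 - α ^ 4 + α ^ 6 - 2 * α ^ 7⟩
  | 11 => ⟨1 - 2 * α + α ^ 2 - α ^ 3 + α ^ 4 - α ^ 6,
      -2 + α - 3 * α ^ 2 + 2 * α ^ 3 - α ^ 4 - 2 * α ^ 7⟩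
  | 12 => ⟨1 - 3 * α + 3 * α ^ 2 - 2 * α ^ 3 + 2 * α ^ 4 - 2 * α ^ 6 + α ^ 7,
      -1 + α - 3 * α ^ 2 + 2 * α ^ 3 - α ^ 4 + α ^ 5 - 2 * α ^ 7⟩
  | 13 => ⟨-α + α ^ 2 + α ^ 4 - α ^ 5 - α ^ 6,
      -1 + α - 3 * α ^ 2 + 2 * α ^ 3 - α ^ 4 + α ^ 5 + α ^ 6 - 2 * α ^ 7⟩
  | 14 => ⟨-α ^ 5,
      -1 + α - 2 * α ^ 2 + α ^ 3 - α ^ 4 + α ^ 6 - α ^ 7⟩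
  | 15 => ⟨1 - α + α ^ 2 - α ^ 3 + α ^ 4 + α ^ 7,
      -1 + α - α ^ 2 + α ^ 3 - α ^ 4 - α ^ 7⟩
  | 16 => ⟨1 - α,
      -1 - α ^ 2 + α ^ 3 - α ^ 4 - α ^ 7⟩
  | 17 => ⟨-α,
      -α ^ 2 + α ^ 3 - α ^ 4 - α ^ 7⟩
  | 18 => ⟨1 - α + α ^ 2 + α ^ 5,
      α ^ 3⟩
  | _ => 0

theorem zeta_eq (α : ℝ) (j : Fin 9) : zeta α j = ⟨lam α j, tau α j⟩ := rfl

theorem topVertex_coord (α : ℝ) : ∀ k ≤ 9, topVertex (zeta α) k = coord α (k + 1) := by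
  intro k hk
  induction k with
  | zero => exact topVertex_zero _
  | succ k ih =>
    have h := topVertex_succ (zeta α) ⟨k, hk⟩
    simp only at h
    rw [h, ih (by omega), zeta_eq, lam_eq, tau_eq]
    have : k < 9 := hk
    clear h ih
    interval_cases k <;> apply Complex.ext <;> simp [coord] <;> ring

/-- The index of the vertex `botVertex k`. -/
def botIndex (k : ℕ) : ℕ := if k = 0 then 1 else 19 - k

theorem botVertex_coord (α : ℝ) : ∀ k ≤ 9, botVertex perm (zeta α) k = coord α (botIndex k) := by
  intro k hk
  induction k with
  | zero => exact topVertex_zero _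
  | succ k ih =>
    have h := topVertex_succ (fun j => zeta α (perm.symm j)) ⟨k, hk⟩
    simp only at h
    rw [botVertex] at ih ⊢
    rw [h, ih (by omega), zeta_eq, lam_eq, tau_eq]
    have : k < 9 := hk
    clear h ih
    interval_cases k <;> apply Complex.ext <;> simp [coord, perm, botIndex] <;> ring

theorem p_eq (α : ℝ) {i : ℕ} (h₁ : 1 ≤ i) (h₂ : i ≤ 18) : p α i = coord α i := by
  rw [p]
  split_ifs with h
  · rw [topVertex_coord α _ (by omega), Nat.sub_add_cancel h₁]
  · rw [botVertex_coord α _ (by omega), botIndex, if_neg (by omega)]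
    congr 1
    omega

/-- The coordinates of the vertices, rounded, in units of `1 / 10000`. -/
def approxRe (i : ℕ) : ℤ :=
  [0, 0, 7097, 19089, 27134, 32675, 37437, 41267, 43534, 51343, 61343, 55801, 48704, 46437, 34445, 30615, 22806, 12806, 4761].getD i 0

/-- See `approxRe`. -/
def approxIm (i : ℕ) : ℤ :=
  [0, 0, 24445, 9089, 22283, 53589, 32586, 60298, 16185, 3379, -6621, -37927, -62372, -18260, -2903, -30615, -17809, -7809, -21003].getD i 0

theorem pow_bounds {α : ℝ} (h₁ : -1.28063816 < α) (h₂ : α < -1.28063815) :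
    (1.6400340 < α ^ 2 ∧ α ^ 2 < 1.6400341) ∧ (-2.1002903 < α ^ 3 ∧ α ^ 3 < -2.1002901) ∧
    (2.6897116 < α ^ 4 ∧ α ^ 4 < 2.6897119) ∧ (-3.4445477 < α ^ 5 ∧ α ^ 5 < -3.4445473) ∧
    (4.4112187 < α ^ 6 ∧ α ^ 6 < 4.4112194) ∧ (-5.6491760 < α ^ 7 ∧ α ^ 7 < -5.6491749) := by
  have lo : ∀ k : ℕ, (1.28063815 : ℝ) ^ k ≤ (-α) ^ k :=
    fun k => pow_le_pow_left₀ (by norm_num) (by linarith) k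
  have hi : ∀ k : ℕ, (-α) ^ k ≤ (1.28063816 : ℝ) ^ k :=
    fun k => pow_le_pow_left₀ (by linarith) (by linarith) k
  have e2 : (-α) ^ 2 = α ^ 2 := by ring
  have e3 : (-α) ^ 3 = -α ^ 3 := by ring
  have e4 : (-α) ^ 4 = α ^ 4 := by ring
  have e5 : (-α) ^ 5 = -α ^ 5 := by ring
  have e6 : (-α) ^ 6 = α ^ 6 := by ring
  have e7 : (-α) ^ 7 = -α ^ 7 := by ring
  have l2 := lo 2
  have l3 := lo 3
  have l4 := lo 4
  have l5 := lo 5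
  have l6 := lo 6
  have l7 := lo 7
  have u2 := hi 2
  have u3 := hi 3
  have u4 := hi 4
  have u5 := hi 5
  have u6 := hi 6
  have u7 := hi 7
  rw [e2] at l2 u2
  rw [e3] at l3 u3
  rw [e4] at l4 u4
  rw [e5] at l5 u5
  rw [e6] at l6 u6
  rw [e7] at l7 u7
  norm_num at l2 l3 l4 l5 l6 l7 u2 u3 u4 u5 u6 u7
  refine ⟨⟨?_, ?_⟩, ⟨?_, ?_⟩, ⟨?_, ?_⟩, ⟨?_, ?_⟩, ⟨?_, ?_⟩, ?_, ?_⟩ <;> norm_num <;> linarith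

theorem coord_approx {α : ℝ} (h₁ : -1.28063816 < α) (h₂ : α < -1.28063815) {i : ℕ} (hi : i ≤ 18) :
    (|(coord α i).re * 10000 - approxRe i| ≤ 1) ∧ (|(coord α i).im * 10000 - approxIm i| ≤ 1) := by
  obtain ⟨⟨_, _⟩, ⟨_, _⟩, ⟨_, _⟩, ⟨_, _⟩, ⟨_, _⟩, _, _⟩ := pow_bounds h₁ h₂
  rw [abs_le, abs_le]
  interval_cases i <;> simp only [coord, approxRe, approxIm, List.getD_cons_zero,
    List.getD_cons_succ, Complex.zero_re, Complex.zero_im] <;> push_cast <;>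
    refine ⟨⟨?_, ?_⟩, ?_, ?_⟩ <;> linarith

end GenusFour

namespace GenusFour

/-- `α` is the real root of `X⁸ + X⁵ - X⁴ + X³ + 1` that is smaller than `-1`. -/
structure IsSmallRoot (α : ℝ) : Prop where
  lt : α < -1
  root : poly.IsRoot (-α)

/-- The point with index `w` is safely above the line through those with index `u` and `v`. -/
def IsAbove (u v w : ℕ) : Prop :=
  2 * (|approxRe v - approxRe u| + |approxIm v - approxIm u| + |approxRe w - approxRe u| +
    |approxIm w - approxIm u|) + 8 ≤
  (approxRe v - approxRe u) * (approxIm w - approxIm u) -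
    (approxIm v - approxIm u) * (approxRe w - approxRe u)

/-- The point with index `w` is safely below the line through those with index `u` and `v`. -/
def IsBelow (u v w : ℕ) : Prop :=
  2 * (|approxRe v - approxRe u| + |approxIm v - approxIm u| + |approxRe w - approxRe u| +
    |approxIm w - approxIm u|) + 8 ≤
  (approxIm v - approxIm u) * (approxRe w - approxRe u) -
    (approxRe v - approxRe u) * (approxIm w - approxIm u)

instance (u v w : ℕ) : Decidable (IsAbove u v w) := inferInstanceAs (Decidable (_ ≤ _))

instance (u v w : ℕ) : Decidable (IsBelow u v w) := inferInstanceAs (Decidable (_ ≤ _))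

theorem cross_error {a b c d a' b' c' d' : ℝ} (ha : |a - a'| ≤ 2) (hb : |b - b'| ≤ 2)
    (hc : |c - c'| ≤ 2) (hd : |d - d'| ≤ 2)
    (h : 2 * (|a'| + |b'| + |c'| + |d'|) + 8 ≤ a' * d' - b' * c') : 0 ≤ a * d - b * c := by
  have key : ∀ x y x' y' : ℝ, |x - x'| ≤ 2 → |y - y'| ≤ 2 →
      |x * y - x' * y'| ≤ 2 * |x'| + 2 * |y'| + 4 := by
    intro x y x' y' hx hy
    have e : x * y - x' * y' = (x - x') * (y - y') + x' * (y - y') + (x - x') * y' := by ring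
    rw [e]
    refine (abs_add_three _ _ _).trans ?_
    rw [abs_mul, abs_mul, abs_mul]
    nlinarith [abs_nonneg (x - x'), abs_nonneg (y - y'), abs_nonneg x', abs_nonneg y']
  have h₁ := abs_le.1 (key a d a' d' ha hd)
  have h₂ := abs_le.1 (key b c b' c' hb hc)
  linarith [h₁.1, h₂.2]

namespace IsSmallRoot

variable {α : ℝ}

theorem bounds (h : IsSmallRoot α) : -1.28063816 < α ∧ α < -1.28063815 := root_bounds h.lt h.root

theorem eq_zero (h : IsSmallRoot α) : α ^ 8 + α ^ 5 - α ^ 4 + α ^ 3 + 1 = 0 := minpoly_eq h.root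

theorem re_approx (h : IsSmallRoot α) {i : ℕ} (hi : i ≤ 18) :
    |(coord α i).re * 10000 - approxRe i| ≤ 1 := (coord_approx h.bounds.1 h.bounds.2 hi).1

theorem im_approx (h : IsSmallRoot α) {i : ℕ} (hi : i ≤ 18) :
    |(coord α i).im * 10000 - approxIm i| ≤ 1 := (coord_approx h.bounds.1 h.bounds.2 hi).2

theorem re_lt (h : IsSmallRoot α) {i j : ℕ} (hij : i ≤ 18 ∧ j ≤ 18 ∧ approxRe i + 2 < approxRe j) :
    (coord α i).re < (coord α j).re := by
  have h₁ := abs_le.1 (h.re_approx hij.1)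
  have h₂ := abs_le.1 (h.re_approx hij.2.1)
  have : (approxRe i : ℝ) + 2 < approxRe j := by exact_mod_cast hij.2.2
  linarith [h₁.1, h₁.2, h₂.1, h₂.2]

theorem im_lt (h : IsSmallRoot α) {i j : ℕ} (hij : i ≤ 18 ∧ j ≤ 18 ∧ approxIm i + 2 < approxIm j) :
    (coord α i).im < (coord α j).im := by
  have h₁ := abs_le.1 (h.im_approx hij.1)
  have h₂ := abs_le.1 (h.im_approx hij.2.1)
  have : (approxIm i : ℝ) + 2 < approxIm j := by exact_mod_cast hij.2.2
  linarith [h₁.1, h₁.2, h₂.1, h₂.2]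

theorem re_sub_approx (h : IsSmallRoot α) {i j : ℕ} (hi : i ≤ 18) (hj : j ≤ 18) :
    |((coord α j).re - (coord α i).re) * 10000 - ((approxRe j - approxRe i : ℤ) : ℝ)| ≤ 2 := by
  have h₁ := abs_le.1 (h.re_approx hi)
  have h₂ := abs_le.1 (h.re_approx hj)
  rw [abs_le]
  push_cast
  constructor <;> linarith [h₁.1, h₁.2, h₂.1, h₂.2]

theorem im_sub_approx (h : IsSmallRoot α) {i j : ℕ} (hi : i ≤ 18) (hj : j ≤ 18) :
    |((coord α j).im - (coord α i).im) * 10000 - ((approxIm j - approxIm i : ℤ) : ℝ)| ≤ 2 := by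
  have h₁ := abs_le.1 (h.im_approx hi)
  have h₂ := abs_le.1 (h.im_approx hj)
  rw [abs_le]
  push_cast
  constructor <;> linarith [h₁.1, h₁.2, h₂.1, h₂.2]

theorem lineAt_le (h : IsSmallRoot α) {u v w : ℕ} (hu : u ≤ 18) (hv : v ≤ 18) (hw : w ≤ 18)
    (huv : approxRe u + 2 < approxRe v) (hle : IsAbove u v w) :
    lineAt (coord α u) (coord α v) (coord α w).re ≤ (coord α w).im := by
  have hlt := h.re_lt ⟨hu, hv, huv⟩
  have := cross_error (h.re_sub_approx hu hv) (h.im_sub_approx hu hv) (h.re_sub_approx hu hw)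
    (h.im_sub_approx hu hw) (by unfold IsAbove at hle; exact_mod_cast hle)
  have hd : 0 < (coord α v).re - (coord α u).re := by linarith
  rw [lineAt, div_mul_eq_mul_div, ← le_sub_iff_add_le', div_le_iff₀ hd]
  linarith

theorem le_lineAt (h : IsSmallRoot α) {u v w : ℕ} (hu : u ≤ 18) (hv : v ≤ 18) (hw : w ≤ 18)
    (huv : approxRe u + 2 < approxRe v) (hle : IsBelow u v w) :
    (coord α w).im ≤ lineAt (coord α u) (coord α v) (coord α w).re := by
  have hlt := h.re_lt ⟨hu, hv, huv⟩
  have := cross_error (h.im_sub_approx hu hv) (h.re_sub_approx hu hv) (h.im_sub_approx hu hw)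
    (h.re_sub_approx hu hw) (by
      unfold IsBelow at hle
      have : 2 * (|approxIm v - approxIm u| + |approxRe v - approxRe u| +
        |approxIm w - approxIm u| + |approxRe w - approxRe u|) + 8 ≤
        (approxIm v - approxIm u) * (approxRe w - approxRe u) -
        (approxRe v - approxRe u) * (approxIm w - approxIm u) := by linarith
      exact_mod_cast this)
  have hd : 0 < (coord α v).re - (coord α u).re := by linarith
  rw [lineAt, div_mul_eq_mul_div, ← sub_le_iff_le_add', le_div_iff₀ hd]
  linarith

/-! ### The suspension datum -/

theorem lam_pos (h : IsSmallRoot α) (j : Fin 9) : 0 < lam α j := by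
  have h₁ := congrArg Complex.re (topVertex_succ (zeta α) j)
  have h₂ := j.2
  rw [topVertex_coord α _ (by omega), topVertex_coord α _ (by omega), Complex.add_re] at h₁
  have key : ∀ j : Fin 9, (j : ℕ) + 1 ≤ 18 ∧ (j : ℕ) + 1 + 1 ≤ 18 ∧
      approxRe (j + 1) + 2 < approxRe (j + 1 + 1) := by decide
  have h₃ := h.re_lt (key j)
  have : (zeta α j).re = lam α j := rfl
  linarith

theorem topVertex_im_pos (h : IsSmallRoot α) {k : ℕ} (h₁ : 1 ≤ k) (h₂ : k ≤ 8) :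
    0 < (topVertex (zeta α) k).im := by
  rw [topVertex_coord α k (by omega)]
  exact h.im_lt (i := 0) (by interval_cases k <;> decide)

theorem botVertex_im_neg (h : IsSmallRoot α) {k : ℕ} (h₁ : 1 ≤ k) (h₂ : k ≤ 9) :
    (botVertex perm (zeta α) k).im < 0 := by
  rw [botVertex_coord α k (by omega)]
  exact h.im_lt (j := 0) (by interval_cases k <;> decide)

theorem isSuspensionDatum (h : IsSmallRoot α) : IsSuspensionDatum perm (zeta α) (lam α) :=
  ⟨h.lam_pos, fun _ => rfl, fun _ h₁ h₂ => h.topVertex_im_pos h₁ (by omega),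
    fun _ h₁ h₂ => h.botVertex_im_neg h₁ h₂.le⟩

theorem norm_le (h : IsSmallRoot α) (μ : ℂ)
    (hμ : (R.map (Int.cast : ℤ → ℂ)).charpoly.IsRoot μ) : ‖μ‖ ≤ α ^ 4 := by
  refine norm_le_of_charpoly_isRoot (B := R.map (Int.cast : ℤ → ℝ)) ?_ h.lam_pos
    (mulVec_lam h.eq_zero) (μ := μ) ?_
  · intro i j
    fin_cases i <;> fin_cases j <;> simp [R]
  · convert hμ using 2
    ext i j
    simp

theorem edge_bot_im_le (h : IsSmallRoot α) (j : Fin 9) {t : ℝ} (ht : t ∈ Set.Icc (0 : ℝ) 1) :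
    (edgePoint (fun j => zeta α (perm.symm j)) j t).im ≤ 0 := by
  have h₀ := topVertex_succ (fun j => zeta α (perm.symm j)) j
  have h₁ : (botVertex perm (zeta α) j).im ≤ 0 := by
    rcases Nat.eq_zero_or_pos (j : ℕ) with h' | h'
    · rw [h', botVertex, topVertex_zero, Complex.zero_im]
    · exact (h.botVertex_im_neg h' (by omega)).le
  have h₂ : (botVertex perm (zeta α) (j + 1)).im ≤ 0 := (h.botVertex_im_neg (by omega) j.2).le
  rw [botVertex] at h₁ h₂
  rw [h₀, Complex.add_im] at h₂
  rw [edgePoint_im]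
  nlinarith [ht.1, ht.2]

theorem edge_top_im_pos (h : IsSmallRoot α) {j : Fin 9} (hj : (j : ℕ) ≤ 7) {t : ℝ}
    (ht : t ∈ Set.Icc (0 : ℝ) 1) (hpos : 0 < (edgePoint (zeta α) j t).re) :
    0 < (edgePoint (zeta α) j t).im := by
  have h₀ := congrArg Complex.im (topVertex_succ (zeta α) j)
  have h₂ := h.topVertex_im_pos (show 1 ≤ (j : ℕ) + 1 by omega) (by omega)
  rw [Complex.add_im] at h₀
  rcases Nat.eq_zero_or_pos (j : ℕ) with h' | h'
  · rw [edgePoint_re, h', topVertex_zero, Complex.zero_re, zero_add] at hpos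
    have ht0 : 0 < t := by
      rcases ht.1.eq_or_lt with rfl | h''
      · simp at hpos
      · exact h''
    rw [h', topVertex_zero, Complex.zero_im] at h₀
    rw [edgePoint_im, h', topVertex_zero, Complex.zero_im, zero_add]
    rw [h'] at h₂
    nlinarith
  · have h₁ := h.topVertex_im_pos h' (by omega)
    rw [edgePoint_im]
    rcases le_total 0 (zeta α j).im with hz | hz
    · nlinarith [ht.1]
    · nlinarith [ht.2]

theorem isSimpleSuspension (h : IsSmallRoot α) : IsSimpleSuspension perm (zeta α) where
  pos := by norm_num
  re_pos := h.lam_pos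
  sep := by
    intro i j s hs t ht hst hpos hlt
    rcases (show (i : ℕ) ≤ 7 ∨ i = 8 by omega) with hi | rfl
    · exact (h.edge_bot_im_le j ht).trans_lt (h.edge_top_im_pos hi hs hpos)
    have hB : ∀ j, 0 < (zeta α (perm.symm j)).re := fun j => h.lam_pos _
    have h9 := topVertex_succ (zeta α) 8
    have h9' := botVertex_last perm (zeta α)
    have ht1 := edgePoint_re_mem (η := zeta α) h.lam_pos hs (j := 8)
    have hb1 := edgePoint_re_mem hB ht (j := j)
    have hz : zeta α 8 = ⟨1, -1⟩ := by rw [zeta_eq, lam_eq, tau_eq]; rfl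
    have e8 : ((8 : Fin 9) : ℕ) = 8 := rfl
    rw [e8] at h9 ht1
    have hs1 : s < 1 := by
      rcases hs.2.eq_or_lt with rfl | h'
      · rw [edgePoint_one] at hlt
        exact absurd hlt (lt_irrefl _)
      · exact h'
    have htop : (topVertex (zeta α) 9).im < (edgePoint (zeta α) 8 s).im := by
      rw [edgePoint_im, e8, h9, hz]
      simp only [Complex.add_im]
      linarith
    refine lt_of_le_of_lt ?_ htop
    rw [← h9', edgePoint_im]
    have hj2 : ∀ k ≤ 9, topVertex (fun j => zeta α (perm.symm j)) k = coord α (botIndex k) :=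
      botVertex_coord α
    rcases (show (j : ℕ) ≤ 6 ∨ j = 7 ∨ j = 8 by omega) with hj | rfl | rfl
    · exfalso
      have h₁ : (topVertex (fun j => zeta α (perm.symm j)) ((j : ℕ) + 1)).re <
          (topVertex (zeta α) 8).re := by
        rw [hj2 _ (by omega), topVertex_coord α _ (by norm_num)]
        have key : ∀ j : Fin 9, (j : ℕ) ≤ 6 → botIndex (j + 1) ≤ 18 ∧ 8 + 1 ≤ 18 ∧
            approxRe (botIndex (j + 1)) + 2 < approxRe (8 + 1) := by decide
        exact h.re_lt (key j hj)
      linarith [hb1.2, ht1.1]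
    · have e := congrArg Complex.im (topVertex_succ (fun j => zeta α (perm.symm j)) 7)
      have h₁ : (coord α (botIndex 7)).im < (coord α (botIndex 9)).im := h.im_lt (by decide)
      have h₂ : (coord α (botIndex 8)).im < (coord α (botIndex 9)).im := h.im_lt (by decide)
      rw [botVertex_coord α _ (by norm_num)]
      have e7 : ((7 : Fin 9) : ℕ) = 7 := rfl
      rw [e7, hj2 _ (by norm_num), Complex.add_im, hj2 _ (by norm_num)] at e
      rw [e7, hj2 _ (by norm_num)]
      nlinarith [ht.1, ht.2]
    · have e := congrArg Complex.im (topVertex_succ (fun j => zeta α (perm.symm j)) 8)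
      have h₁ : (coord α (botIndex 8)).im < (coord α (botIndex 9)).im := h.im_lt (by decide)
      rw [botVertex_coord α _ (by norm_num)]
      rw [e8, hj2 _ (by norm_num), Complex.add_im, hj2 _ (by norm_num)] at e
      rw [e8, hj2 _ (by norm_num)]
      nlinarith [ht.1, ht.2]

end IsSmallRoot

end GenusFour

theorem arg_div_of_re_pos {z w : ℂ} (hz : 0 < z.re) (hw : 0 < w.re) :
    Complex.arg (z / w) = Complex.arg z - Complex.arg w := by
  have hz₀ : z ≠ 0 := by rintro rfl; simp at hz
  have hw₀ : w ≠ 0 := by rintro rfl; simp at hw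
  have h₁ := abs_lt.1 (Complex.abs_arg_lt_pi_div_two_iff.2 (.inl hz))
  have h₂ := abs_lt.1 (Complex.abs_arg_lt_pi_div_two_iff.2 (.inl hw))
  have h₃ : Complex.arg w⁻¹ = -Complex.arg w := by
    rw [Complex.arg_inv, if_neg (by linarith [Real.pi_pos])]
  rw [div_eq_mul_inv, (Complex.arg_mul_eq_add_arg_iff hz₀ (inv_ne_zero hw₀)).2, h₃, sub_eq_add_neg]
  rw [h₃]
  constructor <;> linarith

namespace GenusFour

namespace IsSmallRoot

variable {α : ℝ}

/-! ### The vertices of the surface -/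

theorem same_edge (j : Fin 9) {t : ℝ} (ht : t ∈ Set.Icc (0 : ℝ) 1) :
    (M α).Same (edgePoint (zeta α) j t)
      (edgePoint (fun j => zeta α (perm.symm j)) (perm j) t) :=
  ⟨IsSimpleSuspension.edgePoint_top_mem _ _ _ ht, IsSimpleSuspension.edgePoint_bot_mem _ _ _ ht,
    Quotient.sound (.rel _ _ (IsSimpleSuspension.sideRel_iff.2 ⟨j, t, ht, rfl, rfl⟩))⟩

theorem same_start (α : ℝ) (j : Fin 9) :
    (M α).Same (coord α (j + 1)) (coord α (botIndex (perm j))) := by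
  have := same_edge (α := α) j (t := 0) (by simp)
  rw [edgePoint_zero, edgePoint_zero, topVertex_coord α _ (by omega)] at this
  rwa [← botVertex_coord α _ (by omega)]

theorem same_end (α : ℝ) (j : Fin 9) :
    (M α).Same (coord α (j + 2)) (coord α (botIndex (perm j + 1))) := by
  have := same_edge (α := α) j (t := 1) (by simp)
  rw [edgePoint_one, edgePoint_one, topVertex_coord α _ (by omega)] at this
  rwa [← botVertex_coord α _ (by omega)]

/-- Whether the vertex with index `i` represents the conical point of angle `4π`. -/
def isFirst (i : ℕ) : Bool := i ∈ [1, 5, 8, 10, 12, 16]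

theorem same_first (α : ℝ) : ∀ i ≤ 18, 1 ≤ i → isFirst i → (M α).Same (coord α i) (coord α 1) := by
  have h12 : (M α).Same (coord α 12) (coord α 1) := (same_start α 0).symm
  have h5 : (M α).Same (coord α 5) (coord α 1) := same_start α 4
  have h8 : (M α).Same (coord α 8) (coord α 1) := (same_end α 6).trans h12
  have h16 : (M α).Same (coord α 16) (coord α 1) := (same_start α 7).symm.trans h8
  have h10 : (M α).Same (coord α 10) (coord α 1) := (same_end α 8).trans h16
  intro i hi hi₁ h
  interval_cases i <;> first
    | exact .refl h12.2.1
    | assumption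
    | exact absurd h (by decide)

theorem same_second (α : ℝ) :
    ∀ i ≤ 18, 1 ≤ i → ¬ isFirst i → (M α).Same (coord α i) (coord α 2) := by
  have h11 : (M α).Same (coord α 11) (coord α 2) := (same_end α 0).symm
  have h14 : (M α).Same (coord α 14) (coord α 2) := (same_start α 1).symm
  have h4 : (M α).Same (coord α 4) (coord α 2) := (same_start α 3).trans h11
  have h7 : (M α).Same (coord α 7) (coord α 2) := (same_end α 5).trans h14
  have h13 : (M α).Same (coord α 13) (coord α 2) := (same_start α 6).symm.trans h7
  have h3 : (M α).Same (coord α 3) (coord α 2) := (same_end α 1).trans h13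
  have h18 : (M α).Same (coord α 18) (coord α 2) := (same_start α 2).symm.trans h3
  have h17 : (M α).Same (coord α 17) (coord α 2) := (same_end α 2).symm.trans h4
  have h6 : (M α).Same (coord α 6) (coord α 2) := (same_end α 4).trans h18
  have h15 : (M α).Same (coord α 15) (coord α 2) := (same_start α 5).symm.trans h6
  have h9 : (M α).Same (coord α 9) (coord α 2) := (same_end α 7).trans h15
  intro i hi hi₁ h
  interval_cases i <;> first
    | exact .refl h11.2.1
    | assumption
    | exact absurd (by decide) h

theorem coord_injective (h : IsSmallRoot α) {i j : ℕ} (hi : 1 ≤ i ∧ i ≤ 18) (hj : 1 ≤ j ∧ j ≤ 18)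
    (he : coord α i = coord α j) : i = j := by
  by_contra hij
  have key : ∀ i : Fin 19, ∀ j : Fin 19, 1 ≤ (i : ℕ) → 1 ≤ (j : ℕ) → i ≠ j →
      approxRe i + 2 < approxRe j ∨ approxRe j + 2 < approxRe i := by decide
  rcases key ⟨i, by omega⟩ ⟨j, by omega⟩ hi.1 hj.1 (by simpa [Fin.ext_iff] using hij) with h' | h'
  · exact (h.re_lt ⟨hi.2, hj.2, h'⟩).ne (congrArg Complex.re he)
  · exact (h.re_lt ⟨hj.2, hi.2, h'⟩).ne (congrArg Complex.re he).symm

theorem botIndex_mem {k : ℕ} (hk : k ≤ 9) : 1 ≤ botIndex k ∧ botIndex k ≤ 18 := by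
  unfold botIndex
  split_ifs <;> omega

theorem isFirst_eq_of_same (h : IsSmallRoot α) {i j : ℕ} (hi : 1 ≤ i ∧ i ≤ 18)
    (hj : 1 ≤ j ∧ j ≤ 18) (hij : (M α).Same (coord α i) (coord α j)) : isFirst i = isFirst j := by
  obtain ⟨h₁, h₂, h₃⟩ := hij
  have := h.isSimpleSuspension.vertex_color (fun k => isFirst (k + 1)) (fun k => isFirst (botIndex k))
    (by decide) (by decide) (by decide) (by decide) h₃
  have key : ∀ i, (1 ≤ i ∧ i ≤ 18) → ((∃ k ≤ 9, (coord α i = topVertex (zeta α) k ∧ isFirst (k + 1)) ∨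
      (coord α i = botVertex perm (zeta α) k ∧ isFirst (botIndex k))) ↔ isFirst i) := by
    intro i hi
    constructor
    · rintro ⟨k, hk, ⟨h₁, h₂⟩ | ⟨h₁, h₂⟩⟩
      · rw [topVertex_coord α k hk] at h₁
        rwa [h.coord_injective hi (by omega) h₁]
      · rw [botVertex_coord α k hk] at h₁
        rwa [h.coord_injective hi (botIndex_mem hk) h₁]
    · intro hf
      rcases le_or_gt i 10 with hi' | hi'
      · refine ⟨i - 1, by omega, .inl ?_⟩
        rw [topVertex_coord α _ (by omega), Nat.sub_add_cancel hi.1]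
        exact ⟨rfl, hf⟩
      · refine ⟨19 - i, by omega, .inr ?_⟩
        have : botIndex (19 - i) = i := by
          rw [botIndex, if_neg (by omega)]
          omega
        rw [botVertex_coord α _ (by omega), this]
        exact ⟨rfl, hf⟩
  have hi' := key i hi
  have hj' := key j hj
  rw [Bool.eq_iff_iff]
  exact hi'.symm.trans (this.trans hj')

theorem coord_mem (α : ℝ) {i : ℕ} (hi : 1 ≤ i ∧ i ≤ 18) : coord α i ∈ (M α).region := by
  by_cases hf : isFirst i
  · exact (same_first α i hi.2 hi.1 hf).1
  · exact (same_second α i hi.2 hi.1 hf).1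

/-- The conical point of angle `4π` if `b` is true, the conical point of angle `12π` otherwise. -/
def conePoint (α : ℝ) (b : Bool) : (M α).Surface :=
  (M α).toSurface ⟨coord α (if b then 1 else 2), coord_mem α (by cases b <;> simp)⟩

theorem toSurface_coord_eq_iff (h : IsSmallRoot α) {i : ℕ} (hi : 1 ≤ i ∧ i ≤ 18) (b : Bool) :
    (M α).toSurface ⟨coord α i, coord_mem α hi⟩ = conePoint α b ↔ isFirst i = b := by
  constructor
  · intro he
    rw [h.isFirst_eq_of_same hi (j := if b then 1 else 2) (by cases b <;> simp) ⟨_, _, he⟩]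
    cases b <;> rfl
  · rintro rfl
    cases hf : isFirst i with
    | true => exact (same_first α i hi.2 hi.1 hf).2.2
    | false => exact (same_second α i hi.2 hi.1 (by simp [hf])).2.2

theorem conePoint_ne (h : IsSmallRoot α) : conePoint α true ≠ conePoint α false := by
  intro he
  have := (h.toSurface_coord_eq_iff (i := 1) (by norm_num) false).1 he
  exact absurd this (by decide)

theorem vertices_eq (h : IsSmallRoot α) :
    (M α).vertices = {conePoint α true, conePoint α false} := by
  ext s
  obtain ⟨x, rfl⟩ := PolygonGluing.toSurface_surjective s
  have hv : (M α).toSurface x ∈ (M α).vertices ↔ ∃ i, ∃ _ : 1 ≤ i ∧ i ≤ 18, (x : ℂ) = coord α i := by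
    refine (h.isSimpleSuspension.mem_vertices_iff x).trans ?_
    constructor
    · rintro ⟨k, hk, hx | hx⟩
      · exact ⟨k + 1, by omega, by rw [hx, topVertex_coord α k hk]⟩
      · exact ⟨botIndex k, botIndex_mem hk, by rw [hx, botVertex_coord α k hk]⟩
    · rintro ⟨i, hi, hx⟩
      rcases le_or_gt i 10 with hi' | hi'
      · refine ⟨i - 1, by omega, .inl ?_⟩
        rw [topVertex_coord α _ (by omega), Nat.sub_add_cancel hi.1, hx]
      · refine ⟨19 - i, by omega, .inr ?_⟩
        rw [botVertex_coord α _ (by omega), botIndex, if_neg (by omega), hx]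
        congr 1
        omega
  rw [hv, Set.mem_insert_iff, Set.mem_singleton_iff]
  constructor
  · rintro ⟨i, hi, hx⟩
    obtain rfl : x = ⟨coord α i, coord_mem α hi⟩ := Subtype.ext hx
    rw [h.toSurface_coord_eq_iff hi, h.toSurface_coord_eq_iff hi]
    cases isFirst i <;> simp
  · intro hx
    have key : ∀ b, (M α).toSurface x = conePoint α b → (M α).toSurface x ∈ (M α).vertices := by
      intro b hb
      rw [hb]
      refine (h.isSimpleSuspension.mem_vertices_iff _).2 ?_
      cases b
      · exact ⟨1, by norm_num, .inl (topVertex_coord α 1 (by norm_num)).symm⟩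
      · exact ⟨0, by norm_num, .inl (topVertex_coord α 0 (by norm_num)).symm⟩
    rw [← hv]
    rcases hx with hx | hx
    · exact key true hx
    · exact key false hx

theorem hasGenus (h : IsSmallRoot α) : (M α).HasGenus 4 := by
  rw [PolygonGluing.HasGenus, h.vertices_eq, Set.ncard_pair h.conePoint_ne]
  norm_num

/-! ### The cone angles -/

theorem represents_iff (h : IsSmallRoot α) {i : ℕ} (hi : 1 ≤ i ∧ i ≤ 18) (b : Bool) {z : ℂ}
    (hz : z = coord α i) :
    (∃ x : (suspension perm (zeta α)).region, (x : ℂ) = z ∧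
      (suspension perm (zeta α)).toSurface x = conePoint α b) ↔ isFirst i = b := by
  rw [← h.toSurface_coord_eq_iff hi]
  constructor
  · rintro ⟨x, hx, h'⟩
    obtain rfl : x = ⟨coord α i, coord_mem α hi⟩ := Subtype.ext (hx.trans hz)
    exact h'
  · intro h'
    exact ⟨_, hz.symm, h'⟩

theorem topVertex_sub (η : Fin 9 → ℂ) (j : Fin 9) :
    topVertex η (j + 1) - topVertex η j = η j := by
  rw [topVertex_succ, add_sub_cancel_left]

theorem arg_quotient {η : Fin 9 → ℂ} (hη : ∀ j, 0 < (η j).re) (i j : Fin 9) :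
    Complex.arg ((topVertex η (j + 1) - topVertex η j) / (topVertex η (i + 1) - topVertex η i)) =
      Complex.arg (η j) - Complex.arg (η i) := by
  rw [topVertex_sub, topVertex_sub, arg_div_of_re_pos (hη j) (hη i)]

open Classical in
theorem coneAngle_eq (h : IsSmallRoot α) (b : Bool) :
    suspensionConeAngle perm (zeta α) (conePoint α b) =
      if b then 4 * Real.pi else 12 * Real.pi := by
  have hT : ∀ j, 0 < (zeta α j).re := h.lam_pos
  have hB : ∀ j, 0 < (zeta α (perm.symm j)).re := fun j => h.lam_pos _
  have rT : ∀ k, (hk : k ≤ 9) → ((∃ x : (suspension perm (zeta α)).region,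
      (x : ℂ) = topVertex (zeta α) k ∧ (suspension perm (zeta α)).toSurface x = conePoint α b) ↔
      isFirst (k + 1) = b) :=
    fun k hk => h.represents_iff (by omega) b (topVertex_coord α k hk)
  have rB : ∀ k, (hk : k ≤ 9) → ((∃ x : (suspension perm (zeta α)).region,
      (x : ℂ) = botVertex perm (zeta α) k ∧ (suspension perm (zeta α)).toSurface x = conePoint α b) ↔
      isFirst (botIndex k) = b) :=
    fun k hk => h.represents_iff (botIndex_mem hk) b (botVertex_coord α k hk)
  have aT := fun k : Fin 8 => arg_quotient hT k.castSucc k.succ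
  have aB := fun k : Fin 8 => arg_quotient hB k.castSucc k.succ
  have a0 : Complex.arg ((topVertex (zeta α) 1 - topVertex (zeta α) 0) /
      (botVertex perm (zeta α) 1 - botVertex perm (zeta α) 0)) =
      Complex.arg (zeta α 0) - Complex.arg (zeta α 4) := by
    have e₁ := topVertex_sub (zeta α) 0
    have e₂ := topVertex_sub (fun j => zeta α (perm.symm j)) 0
    rw [botVertex, botVertex, ← arg_div_of_re_pos (hT 0) (hT 4)]
    exact congrArg Complex.arg (congrArg₂ (· / ·) e₁ e₂)
  have a9 : Complex.arg ((botVertex perm (zeta α) 9 - botVertex perm (zeta α) (9 - 1)) /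
      (topVertex (zeta α) 9 - topVertex (zeta α) (9 - 1))) =
      Complex.arg (zeta α 3) - Complex.arg (zeta α 8) := by
    have e₁ := topVertex_sub (zeta α) 8
    have e₂ := topVertex_sub (fun j => zeta α (perm.symm j)) 8
    rw [botVertex, botVertex, ← arg_div_of_re_pos (hT 3) (hT 8)]
    exact congrArg Complex.arg (congrArg₂ (· / ·) e₂ e₁)
  have sT : (∑ k ∈ Finset.Ico 1 9, if isFirst (k + 1) = b then
      Real.pi + Complex.arg ((topVertex (zeta α) (k + 1) - topVertex (zeta α) k) /
        (topVertex (zeta α) k - topVertex (zeta α) (k - 1))) else 0) =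
      ∑ k : Fin 8, if isFirst (k + 2) = b then
        Real.pi + (Complex.arg (zeta α k.succ) - Complex.arg (zeta α k.castSucc)) else 0 := by
    rw [Finset.sum_Ico_eq_sum_range, Finset.sum_range]
    refine Finset.sum_congr rfl fun k _ => ?_
    rw [← aT k]
    simp [add_comm 1 (k : ℕ)]
  have sB : (∑ k ∈ Finset.Ico 1 9, if isFirst (botIndex k) = b then
      Real.pi - Complex.arg ((botVertex perm (zeta α) (k + 1) - botVertex perm (zeta α) k) /
        (botVertex perm (zeta α) k - botVertex perm (zeta α) (k - 1))) else 0) =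
      ∑ k : Fin 8, if isFirst (botIndex (k + 1)) = b then
        Real.pi - (Complex.arg (zeta α (perm.symm k.succ)) -
          Complex.arg (zeta α (perm.symm k.castSucc))) else 0 := by
    rw [Finset.sum_Ico_eq_sum_range, Finset.sum_range]
    refine Finset.sum_congr rfl fun k _ => ?_
    rw [← aB k]
    simp [add_comm 1 (k : ℕ), botVertex]
  unfold suspensionConeAngle
  simp only
  rw [a0, a9]
  refine (congrArg₂ (· + ·) (congrArg₂ (· + ·) (congrArg₂ (· + ·)
    ((Finset.sum_congr rfl fun k hk => if_congr (rT k (Finset.mem_Ico.1 hk).2.le) rfl rfl).trans sT)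
    ((Finset.sum_congr rfl fun k hk => if_congr (rB k (Finset.mem_Ico.1 hk).2.le) rfl rfl).trans sB))
    (if_congr (rT 0 (by norm_num)) rfl rfl)) (if_congr (rT 9 (by norm_num)) rfl rfl)).trans ?_
  simp only [Fin.sum_univ_eight]
  cases b <;> simp [isFirst, botIndex, perm] <;> ring

end IsSmallRoot

end GenusFour

namespace GenusFour

/-! ### Polygons with given vertices -/

/-- The pairs of consecutive entries of a cyclic list. -/
def cyclicPairs (l : List ℕ) : List (ℕ × ℕ) := l.zip (l.rotate 1)

/-- The pairs of consecutive entries of a list. -/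
def pairs (l : List ℕ) : List (ℕ × ℕ) := l.zip l.tail

/-- The polygon with vertices `l` has upper boundary `U` and lower boundary `L`. -/
def HasBoundary (l U L : List ℕ) : Prop :=
  (∀ e ∈ cyclicPairs l, e ∈ pairs U ++ pairs L ∨ e.swap ∈ pairs U ++ pairs L) ∧
  ∀ e ∈ pairs U ++ pairs L, e ∈ cyclicPairs l ∨ e.swap ∈ cyclicPairs l

instance (l U L : List ℕ) : Decidable (HasBoundary l U L) := inferInstanceAs (Decidable (_ ∧ _))

theorem mem_closedBrokenLine_map {f : ℕ → ℂ} {l : List ℕ} {z : ℂ} :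
    z ∈ closedBrokenLine (l.map f) ↔ ∃ e ∈ cyclicPairs l, z ∈ segment ℝ (f e.1) (f e.2) := by
  unfold closedBrokenLine cyclicPairs
  rw [← List.map_rotate, List.zip_map, Set.mem_ofPred_eq]
  simp

theorem mem_brokenLine_map {f : ℕ → ℂ} {z : ℂ} : ∀ {u v : ℕ} {c : List ℕ},
    z ∈ brokenLine ((u :: v :: c).map f) ↔
      ∃ e ∈ pairs (u :: v :: c), z ∈ segment ℝ (f e.1) (f e.2)
  | u, v, [] => by
    simp only [List.map_cons, List.map_nil, brokenLine, pairs, List.tail_cons, List.zip_cons_cons,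
      List.zip_nil_right, List.mem_singleton, exists_eq_left, Set.mem_union, Set.mem_singleton_iff]
    constructor
    · rintro (h | rfl)
      · exact h
      · exact right_mem_segment _ _ _
    · exact Or.inl
  | u, v, w :: c => by
    have ih := mem_brokenLine_map (f := f) (z := z) (u := v) (v := w) (c := c)
    simp only [List.map_cons, pairs, List.tail_cons] at ih
    simp only [List.map_cons, pairs, List.tail_cons, brokenLine, Set.mem_union] at ih ⊢
    rw [ih, List.zip_cons_cons]
    simp

theorem mem_brokenLine_map_of_length {f : ℕ → ℂ} {z : ℂ} {c : List ℕ} (hc : 2 ≤ c.length) :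
    z ∈ brokenLine (c.map f) ↔ ∃ e ∈ pairs c, z ∈ segment ℝ (f e.1) (f e.2) := by
  match c, hc with
  | u :: v :: c, _ => exact mem_brokenLine_map

theorem polygonRegion_eq_cell {f : ℕ → ℂ} {a b : ℝ} {l U L : List ℕ}
    (h : IsPolygonChain a b (U.map f) (L.map f))
    (hl : HasBoundary l U L ∧ 2 ≤ U.length ∧ 2 ≤ L.length) :
    polygonRegion (l.map f) = cell a b (pl (L.map f)) (pl (U.map f)) := by
  refine h.verticalHull_eq ?_
  ext z
  rw [Set.mem_union, mem_closedBrokenLine_map, mem_brokenLine_map_of_length hl.2.1,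
    mem_brokenLine_map_of_length hl.2.2]
  have hU : (∃ e ∈ pairs U, z ∈ segment ℝ (f e.1) (f e.2)) ∨
      (∃ e ∈ pairs L, z ∈ segment ℝ (f e.1) (f e.2)) ↔
      ∃ e ∈ pairs U ++ pairs L, z ∈ segment ℝ (f e.1) (f e.2) := by
    simp only [List.mem_append, or_and_right, exists_or]
  have key : ∀ s t : List (ℕ × ℕ), (∀ e ∈ s, e ∈ t ∨ e.swap ∈ t) →
      (∃ e ∈ s, z ∈ segment ℝ (f e.1) (f e.2)) → ∃ e ∈ t, z ∈ segment ℝ (f e.1) (f e.2) := by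
    rintro s t hst ⟨e, he, hz⟩
    rcases hst e he with h | h
    · exact ⟨e, h, hz⟩
    · exact ⟨_, h, by rwa [segment_symm]⟩
  rw [hU]
  exact ⟨key _ _ hl.1.1, key _ _ hl.1.2⟩

theorem segment_subset_polygonRegion {f : ℕ → ℂ} {l : List ℕ} {a b : ℕ}
    (h : (a, b) ∈ cyclicPairs l ∨ (b, a) ∈ cyclicPairs l) :
    segment ℝ (f a) (f b) ⊆ polygonRegion (l.map f) := by
  intro z hz
  refine subset_verticalHull _ (mem_closedBrokenLine_map.2 ?_)
  rcases h with h | h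
  · exact ⟨_, h, hz⟩
  · exact ⟨_, h, by rwa [segment_symm]⟩

/-- The vertices with the indices `l` are safely ordered from left to right. -/
def IsOrdered (l : List ℕ) : Prop :=
  l.Pairwise fun i j => i ≤ 18 ∧ j ≤ 18 ∧ approxRe i + 2 < approxRe j

instance (l : List ℕ) : Decidable (IsOrdered l) := inferInstanceAs (Decidable (List.Pairwise _ _))

/-- The vertices with the indices `l` are above the segment from `u` to `v`, or do not lie over
its interior. -/
def AreAbove (u v : ℕ) (l : List ℕ) : Prop := ∀ i ∈ l, i ≤ 18 ∧
  (i = u ∨ i = v ∨ approxRe i + 2 < approxRe u ∨ approxRe v + 2 < approxRe i ∨ IsAbove u v i)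

instance (u v : ℕ) (l : List ℕ) : Decidable (AreAbove u v l) :=
  inferInstanceAs (Decidable (∀ i ∈ l, _))

/-- The vertices with the indices `l` are below the segment from `u` to `v`, or do not lie under
its interior. -/
def AreBelow (u v : ℕ) (l : List ℕ) : Prop := ∀ i ∈ l, i ≤ 18 ∧
  (i = u ∨ i = v ∨ approxRe i + 2 < approxRe u ∨ approxRe v + 2 < approxRe i ∨ IsBelow u v i)

instance (u v : ℕ) (l : List ℕ) : Decidable (AreBelow u v l) :=
  inferInstanceAs (Decidable (∀ i ∈ l, _))

/-- The region between the broken lines with vertices `U` and `L`. -/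
abbrev between (α a b : ℝ) (U L : List ℕ) : Set ℂ :=
  cell a b (pl (L.map (coord α))) (pl (U.map (coord α)))

/-- The broken lines with vertices `U` and `L` bound a polygon over `[a, b]`. -/
abbrev IsChain (α a b : ℝ) (U L : List ℕ) : Prop :=
  IsPolygonChain a b (U.map (coord α)) (L.map (coord α))

namespace IsSmallRoot

variable {α : ℝ}

theorem isMono (h : IsSmallRoot α) {l : List ℕ} (hl : IsOrdered l) : IsMono (l.map (coord α)) :=
  List.pairwise_map.2 (hl.imp fun hij => h.re_lt hij)

theorem areAbove (h : IsSmallRoot α) {u v : ℕ} (huv : IsOrdered [u, v]) {l : List ℕ}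
    (hl : AreAbove u v l) : ∀ w ∈ l.map (coord α), (coord α u).re < w.re → w.re < (coord α v).re →
      lineAt (coord α u) (coord α v) w.re ≤ w.im := by
  intro w hw h₁ h₂
  obtain ⟨i, hi, rfl⟩ := List.mem_map.1 hw
  have huv' : u ≤ 18 ∧ v ≤ 18 ∧ approxRe u + 2 < approxRe v := by
    simpa [IsOrdered] using huv
  obtain ⟨hi18, h' | h' | h' | h' | h'⟩ := hl i hi
  · exact absurd h₁ (by rw [h']; exact lt_irrefl _)
  · exact absurd h₂ (by rw [h']; exact lt_irrefl _)
  · exact absurd h₁ (h.re_lt ⟨hi18, huv'.1, h'⟩).not_gt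
  · exact absurd h₂ (h.re_lt ⟨huv'.2.1, hi18, h'⟩).not_gt
  · exact h.lineAt_le huv'.1 huv'.2.1 hi18 huv'.2.2 h'

theorem areBelow (h : IsSmallRoot α) {u v : ℕ} (huv : IsOrdered [u, v]) {l : List ℕ}
    (hl : AreBelow u v l) : ∀ w ∈ l.map (coord α), (coord α u).re < w.re → w.re < (coord α v).re →
      w.im ≤ lineAt (coord α u) (coord α v) w.re := by
  intro w hw h₁ h₂
  obtain ⟨i, hi, rfl⟩ := List.mem_map.1 hw
  have huv' : u ≤ 18 ∧ v ≤ 18 ∧ approxRe u + 2 < approxRe v := by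
    simpa [IsOrdered] using huv
  obtain ⟨hi18, h' | h' | h' | h' | h'⟩ := hl i hi
  · exact absurd h₁ (by rw [h']; exact lt_irrefl _)
  · exact absurd h₂ (by rw [h']; exact lt_irrefl _)
  · exact absurd h₁ (h.re_lt ⟨hi18, huv'.1, h'⟩).not_gt
  · exact absurd h₂ (h.re_lt ⟨huv'.2.1, hi18, h'⟩).not_gt
  · exact h.le_lineAt huv'.1 huv'.2.1 hi18 huv'.2.2 h'

/-- The chain `U, L` is cut along the segment from `u` to `v` into two chains. -/
def Cut (α : ℝ) (u v : ℕ) (a b : ℝ) (U L : List ℕ) (a₁ b₁ : ℝ) (U₁ L₁ : List ℕ) (a₂ b₂ : ℝ)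
    (U₂ L₂ : List ℕ) : Prop :=
  IsChain α a₁ b₁ U₁ L₁ ∧ IsChain α a₂ b₂ U₂ L₂ ∧
  between α a b U L = between α a₁ b₁ U₁ L₁ ∪ between α a₂ b₂ U₂ L₂ ∧
  between α a₁ b₁ U₁ L₁ ∩ between α a₂ b₂ U₂ L₂ ⊆ segment ℝ (coord α u) (coord α v)

variable {a b : ℝ}

theorem cut_top (h : IsSmallRoot α) (U₁ : List ℕ) (u m v : ℕ) (U₂ L : List ℕ)
    (hc : IsChain α a b (U₁ ++ u :: m :: v :: U₂) L)
    (huv : IsOrdered [u, m, v] ∧ IsAbove u v m ∧ AreBelow u v L) :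
    Cut α u v a b (U₁ ++ u :: m :: v :: U₂) L (coord α u).re (coord α v).re [u, m, v] [u, v]
      a b (U₁ ++ u :: v :: U₂) L := by
  have huv' : u ≤ 18 ∧ v ≤ 18 ∧ approxRe u + 2 < approxRe v := by
    have := huv.1
    simp only [IsOrdered, List.pairwise_cons, List.mem_cons] at this
    exact this.1 v (by simp)
  have := hc.split_top (U₁.map (coord α)) (coord α u) [coord α m] (coord α v) (U₂.map (coord α))
    (by simp) (by
      intro w hw
      obtain rfl := List.mem_singleton.1 hw
      have hm : m ≤ 18 := by
        have := huv.1
        simp only [IsOrdered, List.pairwise_cons, List.mem_cons] at this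
        exact (this.1 m (by simp)).2.1
      exact h.lineAt_le huv'.1 huv'.2.1 hm huv'.2.2 huv.2.1)
    (h.areBelow (by simpa [IsOrdered] using huv') huv.2.2)
  simpa [Cut, IsChain, between] using this

theorem cut_bot (h : IsSmallRoot α) (L₁ : List ℕ) (u m v : ℕ) (L₂ U : List ℕ)
    (hc : IsChain α a b U (L₁ ++ u :: m :: v :: L₂))
    (huv : IsOrdered [u, m, v] ∧ IsBelow u v m ∧ AreAbove u v U) :
    Cut α u v a b U (L₁ ++ u :: m :: v :: L₂) (coord α u).re (coord α v).re [u, v] [u, m, v]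
      a b U (L₁ ++ u :: v :: L₂) := by
  have huv' : u ≤ 18 ∧ v ≤ 18 ∧ approxRe u + 2 < approxRe v := by
    have := huv.1
    simp only [IsOrdered, List.pairwise_cons, List.mem_cons] at this
    exact this.1 v (by simp)
  have := hc.split_bot (L₁.map (coord α)) (coord α u) [coord α m] (coord α v) (L₂.map (coord α))
    (by simp) (by
      intro w hw
      obtain rfl := List.mem_singleton.1 hw
      have hm : m ≤ 18 := by
        have := huv.1
        simp only [IsOrdered, List.pairwise_cons, List.mem_cons] at this
        exact (this.1 m (by simp)).2.1
      exact h.le_lineAt huv'.1 huv'.2.1 hm huv'.2.2 huv.2.1)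
    (h.areAbove (by simpa [IsOrdered] using huv') huv.2.2)
  simpa [Cut, IsChain, between] using this

theorem cut_bot_top (h : IsSmallRoot α) (U₁ : List ℕ) (v : ℕ) (U₂ L₁ : List ℕ) (u : ℕ)
    (L₂ : List ℕ) (hc : IsChain α a b (U₁ ++ v :: U₂) (L₁ ++ u :: L₂))
    (huv : IsOrdered [u, v] ∧ AreAbove u v (U₁ ++ v :: U₂) ∧ AreBelow u v (L₁ ++ u :: L₂)) :
    Cut α u v a b (U₁ ++ v :: U₂) (L₁ ++ u :: L₂) a (coord α v).re (U₁ ++ [v]) (L₁ ++ [u, v])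
      (coord α u).re b (u :: v :: U₂) (u :: L₂) := by
  have huv' : u ≤ 18 ∧ v ≤ 18 ∧ approxRe u + 2 < approxRe v := by simpa [IsOrdered] using huv.1
  have := hc.split_bot_top (U₁.map (coord α)) (coord α v) (U₂.map (coord α)) (L₁.map (coord α))
    (coord α u) (L₂.map (coord α)) (by simp) (by simp) (h.re_lt huv') (h.areAbove huv.1 huv.2.1)
    (h.areBelow huv.1 huv.2.2)
  simpa [Cut, IsChain, between] using this

theorem cut_top_bot (h : IsSmallRoot α) (U₁ : List ℕ) (u : ℕ) (U₂ L₁ : List ℕ) (v : ℕ)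
    (L₂ : List ℕ) (hc : IsChain α a b (U₁ ++ u :: U₂) (L₁ ++ v :: L₂))
    (huv : IsOrdered [u, v] ∧ AreAbove u v (U₁ ++ u :: U₂) ∧ AreBelow u v (L₁ ++ v :: L₂)) :
    Cut α u v a b (U₁ ++ u :: U₂) (L₁ ++ v :: L₂) a (coord α v).re (U₁ ++ [u, v]) (L₁ ++ [v])
      (coord α u).re b (u :: U₂) (u :: v :: L₂) := by
  have huv' : u ≤ 18 ∧ v ≤ 18 ∧ approxRe u + 2 < approxRe v := by simpa [IsOrdered] using huv.1
  have := hc.split_top_bot (U₁.map (coord α)) (coord α u) (U₂.map (coord α)) (L₁.map (coord α))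
    (coord α v) (L₂.map (coord α)) (by simp) (by simp) (h.re_lt huv') (h.areAbove huv.1 huv.2.1)
    (h.areBelow huv.1 huv.2.2)
  simpa [Cut, IsChain, between] using this

/-- The upper boundary of the polygon. -/
def upper : List ℕ := [1, 2, 3, 4, 5, 6, 7, 8, 9, 10]

/-- The lower boundary of the polygon. -/
def lower : List ℕ := [1, 18, 17, 16, 15, 14, 13, 12, 11, 10]

theorem mem_brokenLine_upper {z : ℂ} : z ∈ brokenLine (upper.map (coord α)) ↔
    ∃ j : Fin 9, z ∈ segment ℝ (topVertex (zeta α) j) (topVertex (zeta α) (j + 1)) := by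
  rw [mem_brokenLine_map_of_length (by decide)]
  have e : pairs upper = (List.finRange 9).map fun j : Fin 9 => ((j : ℕ) + 1, (j : ℕ) + 2) := by
    decide
  rw [e]
  simp only [List.mem_map, List.mem_finRange, true_and, exists_exists_eq_and]
  refine exists_congr fun j => ?_
  rw [topVertex_coord α _ (by omega), topVertex_coord α _ (by omega)]

theorem mem_brokenLine_lower {z : ℂ} : z ∈ brokenLine (lower.map (coord α)) ↔
    ∃ j : Fin 9, z ∈ segment ℝ (botVertex perm (zeta α) j) (botVertex perm (zeta α) (j + 1)) := by
  rw [mem_brokenLine_map_of_length (by decide)]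
  have e : pairs lower =
      (List.finRange 9).map fun j : Fin 9 => (botIndex j, botIndex ((j : ℕ) + 1)) := by
    decide
  rw [e]
  simp only [List.mem_map, List.mem_finRange, true_and, exists_exists_eq_and]
  refine exists_congr fun j => ?_
  rw [botVertex_coord α _ (by omega), botVertex_coord α _ (by omega)]

theorem isChain_upper_lower (h : IsSmallRoot α) :
    IsChain α (coord α 1).re (coord α 10).re upper lower where
  monoU := h.isMono (by decide)
  monoL := h.isMono (by decide)
  headU := rfl
  headL := rfl
  lastU := rfl
  lastL := rfl
  le := by
    intro x h₁ h₂
    have hT : (⟨x, pl (upper.map (coord α)) x⟩ : ℂ) ∈ brokenLine (upper.map (coord α)) :=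
      (mem_brokenLine_iff (h.isMono (by decide)) rfl rfl _).2 ⟨h₁, h₂, rfl⟩
    have hB : (⟨x, pl (lower.map (coord α)) x⟩ : ℂ) ∈ brokenLine (lower.map (coord α)) :=
      (mem_brokenLine_iff (h.isMono (by decide)) rfl rfl _).2 ⟨h₁, h₂, rfl⟩
    rw [mem_brokenLine_upper] at hT
    rw [mem_brokenLine_lower] at hB
    obtain ⟨i, hi⟩ := hT
    obtain ⟨j, hj⟩ := hB
    rw [segment_topVertex] at hi
    rw [botVertex, botVertex, segment_topVertex] at hj
    obtain ⟨s, hs, e₁⟩ := hi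
    obtain ⟨t, ht, e₂⟩ := hj
    have e₁' := congrArg Complex.re e₁
    have e₂' := congrArg Complex.re e₂
    simp only at e₁' e₂'
    have h9 : topVertex (zeta α) 9 = coord α 10 := topVertex_coord α 9 le_rfl
    rcases h₁.eq_or_lt with rfl | h₁
    · rw [pl_at (h.isMono (by decide)) (List.mem_map_of_mem (by decide)),
        pl_at (h.isMono (by decide)) (List.mem_map_of_mem (by decide))]
    rcases h₂.eq_or_lt with rfl | h₂
    · rw [pl_at (h.isMono (by decide)) (List.mem_map_of_mem (by decide)),
        pl_at (h.isMono (by decide)) (List.mem_map_of_mem (by decide))]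
    have := h.isSimpleSuspension.sep i j s hs t ht (e₁'.trans e₂'.symm)
      (by rw [e₁']; exact h₁) (by rw [e₁', h9]; exact h₂)
    rw [e₁, e₂] at this
    exact this.le

theorem region_eq (h : IsSmallRoot α) :
    (M α).region = between α (coord α 1).re (coord α 10).re upper lower := by
  refine h.isChain_upper_lower.verticalHull_eq ?_
  ext z
  rw [Set.mem_union, Set.mem_union, mem_brokenLine_upper, mem_brokenLine_lower, Set.mem_iUnion,
    Set.mem_iUnion]

end IsSmallRoot

end GenusFour

namespace GenusFour

/-! ### The pieces -/

/-- The vertex of the polygon `t` corresponding to the vertex `a` of the polygon `s`. -/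
def image (s t : List ℕ) (a : ℕ) : ℕ := t.getD (s.idxOf a) 0

/-- The first vertex of a polygon. -/
def base (s : List ℕ) : ℕ := s.headD 0

/-- The segments from `a` to `b` and from `c` to `d` are equal or glued to each other. -/
def IsGlued (a b c d : ℕ) : Prop := (a = c ∧ b = d) ∨ ∃ j : Fin 9,
  ((a, b) = ((j : ℕ) + 1, (j : ℕ) + 2) ∧ (c, d) = (botIndex (perm j), botIndex (perm j + 1))) ∨
  ((b, a) = ((j : ℕ) + 1, (j : ℕ) + 2) ∧ (d, c) = (botIndex (perm j), botIndex (perm j + 1))) ∨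
  ((c, d) = ((j : ℕ) + 1, (j : ℕ) + 2) ∧ (a, b) = (botIndex (perm j), botIndex (perm j + 1))) ∨
  ((d, c) = ((j : ℕ) + 1, (j : ℕ) + 2) ∧ (b, a) = (botIndex (perm j), botIndex (perm j + 1)))

instance (a b c d : ℕ) : Decidable (IsGlued a b c d) := inferInstanceAs (Decidable (_ ∨ _))

/-- The segment from `a` to `b` is a side of the `k`-th polygon. -/
def IsSide (s : Fin 8 → List ℕ) (k : Fin 8) (a b : ℕ) : Prop :=
  (a, b) ∈ cyclicPairs (s k) ∨ (b, a) ∈ cyclicPairs (s k)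

instance (s : Fin 8 → List ℕ) (k : Fin 8) (a b : ℕ) : Decidable (IsSide s k a b) :=
  inferInstanceAs (Decidable (_ ∨ _))

/-- If the `k`-th polygon of `s` is mapped to the `k`-th polygon of `t` for every `k`, then
the images of the side from `a` to `b` of the `k`-th polygon and of the side from `c` to `d` of
the `l`-th polygon are equal or glued to each other. -/
def IsMatched (s t : Fin 8 → List ℕ) (k l : Fin 8) (a b c d : ℕ) : Prop :=
  a ∈ s k ∧ b ∈ s k ∧ c ∈ s l ∧ d ∈ s l ∧
  IsGlued (image (s k) (t k) a) (image (s k) (t k) b) (image (s l) (t l) c) (image (s l) (t l) d)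

instance (s t : Fin 8 → List ℕ) (k l : Fin 8) (a b c d : ℕ) : Decidable (IsMatched s t k l a b c d) :=
  inferInstanceAs (Decidable (_ ∧ _))

/-- The polygon with the vertices `l`. -/
abbrev polygon (α : ℝ) (l : List ℕ) : Set ℂ := polygonRegion (l.map (coord α))

/-- The segment from `u` to `v` is a side of the `k`-th and the `l`-th polygon of `s`, with images
that are equal or glued to each other. -/
def CutSegment (α : ℝ) (s t : Fin 8 → List ℕ) (k l : Fin 8) (u v : ℂ) : Prop :=
  ∃ a b, u = coord α a ∧ v = coord α b ∧ IsSide s k a b ∧ IsMatched s t k l a b a b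

namespace IsSmallRoot

variable {α : ℝ}

theorem Cut.dissects {u v : ℕ} {a b a₁ b₁ a₂ b₂ : ℝ} {U L U₁ L₁ U₂ L₂ : List ℕ}
    {s t : Fin 8 → List ℕ} (k l : Fin 8) {ks : List (Fin 8)}
    (hcut : Cut α u v a b U L a₁ b₁ U₁ L₁ a₂ b₂ U₂ L₂)
    (hs : (HasBoundary (s k) U₁ L₁ ∧ 2 ≤ U₁.length ∧ 2 ≤ L₁.length) ∧ k ∉ ks ∧ l ∈ ks ∧
      IsSide s l u v ∧ IsSide s k u v ∧ IsMatched s t k l u v u v)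
    (h : Dissects (fun k => polygon α (s k)) (CutSegment α s t) ks (between α a₂ b₂ U₂ L₂)) :
    Dissects (fun k => polygon α (s k)) (CutSegment α s t) (k :: ks) (between α a b U L) := by
  obtain ⟨h₁, h₂, h₃, h₄⟩ := hcut
  have e : polygon α (s k) = between α a₁ b₁ U₁ L₁ := polygonRegion_eq_cell h₁ hs.1
  rw [h₃, ← e]
  rw [← e] at h₄
  exact .cons hs.2.1 hs.2.2.1 ⟨u, v, rfl, rfl, hs.2.2.2.2⟩
    (segment_subset_polygonRegion hs.2.2.2.1) h₄ h

theorem dissects_single {a b : ℝ} {U L : List ℕ} {s t : Fin 8 → List ℕ} (k : Fin 8)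
    (hc : IsChain α a b U L) (hs : HasBoundary (s k) U L ∧ 2 ≤ U.length ∧ 2 ≤ L.length) :
    Dissects (fun k => polygon α (s k)) (CutSegment α s t) [k] (between α a b U L) := by
  rw [between, ← polygonRegion_eq_cell hc hs]
  exact .single k

theorem dissects_pieces (h : IsSmallRoot α) :
    Dissects (fun k => polygon α (pieces k)) (CutSegment α pieces pieces') [0, 1, 2, 3, 4, 6, 7, 5]
      (M α).region := by
  rw [h.region_eq]
  have c₁ := h.cut_bot_top [1, 2] 3 [4, 5, 6, 7, 8, 9, 10] [1, 18] 17 [16, 15, 14, 13, 12, 11, 10]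
    h.isChain_upper_lower (by decide)
  have c₂ := h.cut_top_bot [17] 3 [4, 5, 6, 7, 8, 9, 10] [17] 16 [15, 14, 13, 12, 11, 10]
    c₁.2.1 (by decide)
  have c₃ := h.cut_bot_top [3] 4 [5, 6, 7, 8, 9, 10] [3] 16 [15, 14, 13, 12, 11, 10]
    c₂.2.1 (by decide)
  have c₄ := h.cut_top_bot [16, 4] 5 [6, 7, 8, 9, 10] [16, 15] 14 [13, 12, 11, 10]
    c₃.2.1 (by decide)
  have c₅ := h.cut_bot_top [5] 6 [7, 8, 9, 10] [5] 14 [13, 12, 11, 10] c₄.2.1 (by decide)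
  have c₆ := h.cut_top [14] 6 7 8 [9, 10] [14, 13, 12, 11, 10] c₅.2.1 (by decide)
  have c₇ := h.cut_bot [14] 13 12 11 [10] [14, 6, 8, 9, 10] c₆.2.1 (by decide)
  exact c₁.dissects 0 1 (by decide) <| c₂.dissects 1 2 (by decide) <| c₃.dissects 2 3 (by decide) <|
    c₄.dissects 3 4 (by decide) <| c₅.dissects 4 5 (by decide) <| c₆.dissects 6 5 (by decide) <|
    c₇.dissects 7 5 (by decide) <| dissects_single 5 c₇.2.1 (by decide)

theorem dissects_pieces' (h : IsSmallRoot α) :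
    Dissects (fun k => polygon α (pieces' k)) (CutSegment α pieces' pieces)
      [2, 4, 1, 5, 0, 7, 6, 3] (M α).region := by
  rw [h.region_eq]
  have c₁ := h.cut_top [1, 2, 3] 4 5 6 [7, 8, 9, 10] lower h.isChain_upper_lower (by decide)
  have c₂ := h.cut_top [1, 2, 3, 4] 6 7 8 [9, 10] lower c₁.2.1 (by decide)
  have c₃ := h.cut_bot [] 1 18 17 [16, 15, 14, 13, 12, 11, 10] [1, 2, 3, 4, 6, 8, 9, 10]
    c₂.2.1 (by decide)
  have c₄ := h.cut_top_bot [1, 2] 3 [4, 6, 8, 9, 10] [1, 17, 16, 15] 14 [13, 12, 11, 10]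
    c₃.2.1 (by decide)
  have c₅ := h.cut_bot_top [3, 4, 6] 8 [9, 10] [3] 14 [13, 12, 11, 10] c₄.2.1 (by decide)
  have c₆ := h.cut_top_bot [14] 8 [9, 10] [14] 13 [12, 11, 10] c₅.2.1 (by decide)
  have c₇ := h.cut_bot_top [8] 9 [10] [8] 13 [12, 11, 10] c₆.2.1 (by decide)
  exact c₁.dissects 2 0 (by decide) <| c₂.dissects 4 0 (by decide) <| c₃.dissects 1 5 (by decide) <|
    c₄.dissects 5 0 (by decide) <| c₅.dissects 0 7 (by decide) <| c₆.dissects 7 6 (by decide) <|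
    c₇.dissects 6 3 (by decide) <| dissects_single 3 c₇.2.1 (by decide)

/-! ### Compatibility with the gluing -/

theorem same_of_isGlued {a b c d : ℕ} (hg : IsGlued a b c d) {t : ℝ} (ht : t ∈ Set.Icc (0 : ℝ) 1)
    (hm : AffineMap.lineMap (coord α a) (coord α b) t ∈ (M α).region) :
    (M α).Same (AffineMap.lineMap (coord α a) (coord α b) t)
      (AffineMap.lineMap (coord α c) (coord α d) t) := by
  have key : ∀ j : Fin 9, ∀ t ∈ Set.Icc (0 : ℝ) 1,
      (M α).Same (AffineMap.lineMap (coord α ((j : ℕ) + 1)) (coord α ((j : ℕ) + 2)) t)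
      (AffineMap.lineMap (coord α (botIndex (perm j))) (coord α (botIndex (perm j + 1))) t) := by
    intro j t ht
    have e : ∀ (η : Fin 9 → ℂ) (i : Fin 9),
        AffineMap.lineMap (topVertex η i) (topVertex η (i + 1)) t = edgePoint η i t := by
      intro η i
      rw [topVertex_succ, AffineMap.lineMap_apply, edgePoint]
      simp [add_comm]
    have := same_edge (α := α) j ht
    rw [← e, ← e, topVertex_coord α _ (by omega), topVertex_coord α _ (by omega)] at this
    rw [← botVertex_coord α _ (by omega), ← botVertex_coord α _ (by omega)]
    exact this
  have ht' : 1 - t ∈ Set.Icc (0 : ℝ) 1 := ⟨by linarith [ht.2], by linarith [ht.1]⟩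
  rcases hg with ⟨rfl, rfl⟩ | ⟨j, ⟨h₁, h₂⟩ | ⟨h₁, h₂⟩ | ⟨h₁, h₂⟩ | ⟨h₁, h₂⟩⟩
  · exact .refl hm
  all_goals
    obtain ⟨rfl, rfl⟩ := Prod.mk.inj h₁
    obtain ⟨rfl, rfl⟩ := Prod.mk.inj h₂
  · exact key j t ht
  · simpa only [AffineMap.lineMap_apply_one_sub] using key j (1 - t) ht'
  · exact (key j t ht).symm
  · simpa only [AffineMap.lineMap_apply_one_sub] using (key j (1 - t) ht').symm

theorem same_of_isMatched {s t : Fin 8 → List ℕ} {f : Fin 8 → ℂ →ᵃ[ℝ] ℂ}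
    (hf : ∀ k, ∀ a ∈ s k, f k (coord α a) = coord α (image (s k) (t k) a))
    (hM : ∀ k, ∀ z ∈ polygon α (s k), f k z ∈ (M α).region) {k l : Fin 8} {a b c d : ℕ}
    (h : IsMatched s t k l a b c d) {r : ℝ} (hr : r ∈ Set.Icc (0 : ℝ) 1)
    (hz : AffineMap.lineMap (coord α a) (coord α b) r ∈ polygon α (s k)) :
    (M α).Same (f k (AffineMap.lineMap (coord α a) (coord α b) r))
      (f l (AffineMap.lineMap (coord α c) (coord α d) r)) := by
  obtain ⟨ha, hb, hc, hd, hg⟩ := h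
  have := hM k _ hz
  rw [AffineMap.apply_lineMap, hf k a ha, hf k b hb] at this
  rw [AffineMap.apply_lineMap, AffineMap.apply_lineMap, hf k a ha, hf k b hb, hf l c hc, hf l d hd]
  exact same_of_isGlued hg hr this

theorem same_map {s t : Fin 8 → List ℕ} {f : Fin 8 → ℂ →ᵃ[ℝ] ℂ}
    (hf : ∀ k, ∀ a ∈ s k, f k (coord α a) = coord α (image (s k) (t k) a))
    (hM : ∀ k, ∀ z ∈ polygon α (s k), f k z ∈ (M α).region) {ks : List (Fin 8)}
    (hD : Dissects (fun k => polygon α (s k)) (CutSegment α s t) ks (M α).region)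
    (hks : ∀ k, k ∈ ks)
    (hside : ∀ j : Fin 9, ∃ k l, IsSide s k (j + 1) (j + 2) ∧
      IsSide s l (botIndex (perm j)) (botIndex (perm j + 1)) ∧
      IsMatched s t k l (j + 1) (j + 2) (botIndex (perm j)) (botIndex (perm j + 1)))
    {x y : ℂ} (hxy : (M α).Same x y) {k l : Fin 8} (hx : x ∈ polygon α (s k))
    (hy : y ∈ polygon α (s l)) : (M α).Same (f k x) (f l y) := by
  have hcov : (M α).region = ⋃ k, polygon α (s k) := by
    rw [hD.eq_iUnion]
    simp [hks]
  refine PolygonGluing.Same.map (fun k => polygon α (s k)) (fun k => f k) hcov ?_ ?_ hxy k l hx hy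
  · intro x k l hxk hxl
    refine hD.connected (x := x) (T := fun k l => (M α).Same (f k x) (f l x))
      (fun k hxk => .refl (hM k x hxk)) (fun _ _ h => h.symm) (fun _ _ _ h h' => h.trans h') ?_
      k (hks k) l (hks l) hxk hxl
    rintro k l _ _ ⟨a, b, rfl, rfl, hk, hm⟩ hx
    have hxk := segment_subset_polygonRegion (f := coord α) hk hx
    rw [segment_eq_image_lineMap] at hx
    obtain ⟨r, hr, rfl⟩ := hx
    exact same_of_isMatched hf hM hm hr hxk
  · intro j
    obtain ⟨k, l, hk, hl, hm⟩ := hside j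
    refine ⟨k, l, fun r hr => ?_⟩
    have e₁ : (M α).startA j + r * (M α).vec j =
        AffineMap.lineMap (coord α ((j : ℕ) + 1)) (coord α ((j : ℕ) + 2)) r := by
      change topVertex (zeta α) j + r * zeta α j = _
      rw [← topVertex_coord α j (by omega), ← topVertex_coord α ((j : ℕ) + 1) (by omega),
        topVertex_succ, AffineMap.lineMap_apply]
      simp [add_comm]
    have e₂ : (M α).startB j + r * (M α).vec j =
        AffineMap.lineMap (coord α (botIndex (perm j))) (coord α (botIndex (perm j + 1))) r := by
      change botVertex perm (zeta α) (perm j) + r * zeta α j = _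
      rw [← botVertex_coord α _ (by omega), ← botVertex_coord α _ (by omega),
        botVertex, botVertex, topVertex_succ, AffineMap.lineMap_apply]
      simp [add_comm]
    rw [e₁, e₂]
    have hz₁ := segment_subset_polygonRegion (f := coord α) hk
      (lineMap_mem_segment (𝕜 := ℝ) _ _ hr)
    have hz₂ := segment_subset_polygonRegion (f := coord α) hl
      (lineMap_mem_segment (𝕜 := ℝ) _ _ hr)
    exact ⟨hz₁, hz₂, same_of_isMatched hf hM hm hr hz₁⟩

end IsSmallRoot

theorem pieces_scale {α : ℝ} (h : α ^ 8 + α ^ 5 - α ^ 4 + α ^ 3 + 1 = 0) :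
    ∀ k, ∀ a ∈ pieces' k,
    (coord α a).re - (coord α (base (pieces' k))).re =
      α * ((coord α (image (pieces' k) (pieces k) a)).re - (coord α (base (pieces k))).re) ∧
    α * ((coord α a).im - (coord α (base (pieces' k))).im) =
      (coord α (image (pieces' k) (pieces k) a)).im - (coord α (base (pieces k))).im := by
  intro k
  fin_cases k <;> repeat' refine List.forall_mem_cons.2 ⟨?_, ?_⟩
  all_goals first
    | exact List.forall_mem_nil _
    | (constructor <;> simp [coord, pieces, pieces', image, base] <;> first
        | ring1
        | linear_combination h
        | linear_combination -h
        | linear_combination 2 * h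
        | linear_combination -2 * h)

end GenusFour

namespace GenusFour

theorem planeMap_apply (β : ℝ) (z : ℂ) : planeMap (A β) z = ⟨β⁻¹ * z.re, β * z.im⟩ := by
  apply Complex.ext <;>
    simp [planeMap, Matrix.toLin_apply, Fin.sum_univ_two, A, Matrix.mulVec, dotProduct]

/-- The affine map `z ↦ A z + d`. -/
def affineMap (β : ℝ) (d : ℂ) : ℂ →ᵃ[ℝ] ℂ :=
  (planeMap (A β) : ℂ →ₗ[ℝ] ℂ).toAffineMap + AffineMap.const ℝ ℂ d

theorem affineMap_apply (β : ℝ) (d z : ℂ) : affineMap β d z = planeMap (A β) z + d := by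
  simp [affineMap]

end GenusFour

namespace PolygonGluing

variable {n : ℕ} {G : PolygonGluing n} {L : ℂ →L[ℝ] ℂ}

/-- The bijection between the regions of `G` and of `L · G`. -/
def regionHomeomorph (G : PolygonGluing n) (e : ℂ ≃ₜ ℂ) (he : ⇑e = L) : G.region ≃ₜ (G.map L).region :=
  (e.image G.region).trans (Homeomorph.setCongr (by rw [he]; rfl))

theorem regionHomeomorph_apply (e : ℂ ≃ₜ ℂ) (he : ⇑e = L) (x : G.region) :
    (G.regionHomeomorph e he x : ℂ) = L x := by
  rw [← he]; rfl

theorem regionHomeomorph_sideRel_iff (e : ℂ ≃ₜ ℂ) (he : ⇑e = L) (x y : G.region) :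
    (G.map L).sideRel (G.regionHomeomorph e he x) (G.regionHomeomorph e he y) ↔ G.sideRel x y := by
  have hL : Function.Injective L := he ▸ e.injective
  have h : ∀ (u v w : ℂ) (t : ℝ), L w = L u + t * L v ↔ w = u + t * v := by
    intro u v w t
    rw [← Complex.real_smul, ← Complex.real_smul, ← map_smul, ← map_add, hL.eq_iff]
  unfold sideRel
  simp only [regionHomeomorph_apply]
  simp only [map, h]

theorem regionHomeomorph_rel_iff (e : ℂ ≃ₜ ℂ) (he : ⇑e = L) (x y : G.region) :
    (G.map L).glueSetoid (G.regionHomeomorph e he x) (G.regionHomeomorph e he y) ↔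
      G.glueSetoid x y := by
  constructor
  · have : ∀ x y, Relation.EqvGen (G.map L).sideRel x y →
        Relation.EqvGen G.sideRel ((G.regionHomeomorph e he).symm x)
          ((G.regionHomeomorph e he).symm y) := by
      intro x y h
      induction h with
      | rel x y h =>
        refine .rel _ _ ((regionHomeomorph_sideRel_iff e he _ _).1 ?_)
        simpa using h
      | refl x => exact .refl _
      | symm x y _ ih => exact ih.symm
      | trans x y z _ _ ih ih' => exact ih.trans _ _ _ ih'
    intro h
    have := this _ _ h
    rwa [Homeomorph.symm_apply_apply, Homeomorph.symm_apply_apply] at this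
  · intro h
    induction h with
    | rel x y h => exact .rel _ _ ((regionHomeomorph_sideRel_iff e he _ _).2 h)
    | refl x => exact .refl _
    | symm x y _ ih => exact ih.symm
    | trans x y z _ _ ih ih' => exact ih.trans _ _ _ ih'

/-- The homeomorphism from `G` to `L · G` induced by `L`. -/
def mapHomeomorph (G : PolygonGluing n) (e : ℂ ≃ₜ ℂ) (he : ⇑e = L) :
    G.Surface ≃ₜ (G.map L).Surface :=
  Homeomorph.Quotient.congr (G.regionHomeomorph e he) fun x y =>
    (regionHomeomorph_rel_iff e he x y).symm

theorem mapHomeomorph_image_vertices (e : ℂ ≃ₜ ℂ) (he : ⇑e = L) :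
    G.mapHomeomorph e he '' G.vertices = (G.map L).vertices := by
  have hL : Function.Injective L := he ▸ e.injective
  have h : ∀ (x : G.region) (j : Fin n), ((G.regionHomeomorph e he x : ℂ) ∈
      ({(G.map L).startA j, (G.map L).startA j + (G.map L).vec j, (G.map L).startB j,
        (G.map L).startB j + (G.map L).vec j} : Set ℂ)) ↔
      (x : ℂ) ∈ ({G.startA j, G.startA j + G.vec j, G.startB j, G.startB j + G.vec j} : Set ℂ) := by
    intro x j
    rw [regionHomeomorph_apply]
    simp only [map, Set.mem_insert_iff, Set.mem_singleton_iff, ← map_add,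
      hL.eq_iff]
  ext s
  constructor
  · rintro ⟨_, ⟨x, rfl, j, hj⟩, rfl⟩
    exact ⟨G.regionHomeomorph e he x, rfl, j, (h x j).2 hj⟩
  · rintro ⟨y, rfl, j, hj⟩
    obtain ⟨x, rfl⟩ := (G.regionHomeomorph e he).surjective y
    exact ⟨_, ⟨x, rfl, j, (h x j).1 hj⟩, rfl⟩

end PolygonGluing

namespace GenusFour

theorem affineMap_image_verticalHull {β : ℝ} (hβ : β < 0) (d : ℂ) (S : Set ℂ) :
    affineMap β d '' verticalHull S = verticalHull (affineMap β d '' S) := by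
  have hβ' : β⁻¹ ≠ 0 := inv_ne_zero hβ.ne
  ext z
  constructor
  · rintro ⟨w, ⟨a, ha, b, hb, h₁, h₂, h₃, h₄⟩, rfl⟩
    refine ⟨_, ⟨b, hb, rfl⟩, _, ⟨a, ha, rfl⟩, ?_⟩
    simp only [affineMap_apply, planeMap_apply, Complex.add_re, Complex.add_im, h₁, h₂, true_and]
    constructor <;> nlinarith
  · rintro ⟨_, ⟨a, ha, rfl⟩, _, ⟨b, hb, rfl⟩, h⟩
    simp only [affineMap_apply, planeMap_apply, Complex.add_re, Complex.add_im] at h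
    obtain ⟨h₁, h₂, h₃, h₄⟩ := h
    have hab : b.re = a.re := by
      have : β⁻¹ * b.re = β⁻¹ * a.re := by linarith
      exact mul_left_cancel₀ hβ' this
    refine ⟨⟨a.re, (z.im - d.im) / β⟩, ⟨b, hb, a, ha, hab, rfl, ?_, ?_⟩, ?_⟩
    · rw [le_div_iff_of_neg hβ]
      linarith
    · rw [div_le_iff_of_neg hβ]
      linarith
    · rw [affineMap_apply, planeMap_apply]
      apply Complex.ext
      · simpa using h₁
      · simp only [Complex.add_im]
        field_simp [hβ.ne]
        ring

theorem affineMap_image_polygonRegion {β : ℝ} (hβ : β < 0) (d : ℂ) (l : List ℂ) :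
    affineMap β d '' polygonRegion l = polygonRegion (l.map (affineMap β d)) := by
  rw [polygonRegion, affineMap_image_verticalHull hβ, ← closedBrokenLine_map]
  rfl

/-- The linear map `A` as a homeomorphism of the plane. -/
def planeHomeomorph (β : ℝ) (hβ : β ≠ 0) : ℂ ≃ₜ ℂ where
  toFun := planeMap (A β)
  invFun := planeMap (A β⁻¹)
  left_inv z := by
    rw [planeMap_apply, planeMap_apply]
    apply Complex.ext <;> simp [hβ]
  right_inv z := by
    rw [planeMap_apply, planeMap_apply]
    apply Complex.ext <;> simp [hβ]
  continuous_toFun := (planeMap (A β)).continuous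
  continuous_invFun := (planeMap (A β⁻¹)).continuous

end GenusFour

namespace GenusFour

/-- The translation that moves the image of the `k`-th piece under `A` to the `k`-th piece. -/
def shift (α : ℝ) (k : Fin 8) : ℂ :=
  coord α (base (pieces k)) - planeMap (A α) (coord α (base (pieces' k)))

/-- The affine map from the `k`-th piece of `pieces'` to the `k`-th piece of `pieces`. -/
def forward (α : ℝ) (k : Fin 8) : ℂ →ᵃ[ℝ] ℂ := affineMap α (shift α k)

/-- The inverse of `forward`. -/
def backward (α : ℝ) (k : Fin 8) : ℂ →ᵃ[ℝ] ℂ := affineMap α⁻¹ (-planeMap (A α⁻¹) (shift α k))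

theorem piecewise_p_eq_coord (α : ℝ) : (∀ k, ∀ i ∈ pieces' k, p α i = coord α i) ∧
    ∀ k, ∀ i ∈ pieces k, p α i = coord α i := by
  have h : (∀ k, ∀ i ∈ pieces' k, 1 ≤ i ∧ i ≤ 18) ∧ ∀ k, ∀ i ∈ pieces k, 1 ≤ i ∧ i ≤ 18 := by
    decide
  exact ⟨fun k i hi => p_eq α (h.1 k i hi).1 (h.1 k i hi).2,
    fun k i hi => p_eq α (h.2 k i hi).1 (h.2 k i hi).2⟩

namespace IsSmallRoot

variable {α : ℝ}

theorem ne_zero (h : IsSmallRoot α) : α ≠ 0 := by linarith [h.lt]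

theorem neg (h : IsSmallRoot α) : α < 0 := by linarith [h.lt]

theorem forward_coord (h : IsSmallRoot α) (k : Fin 8) (a : ℕ) (ha : a ∈ pieces' k) :
    forward α k (coord α a) = coord α (image (pieces' k) (pieces k) a) := by
  obtain ⟨h₁, h₂⟩ := pieces_scale h.eq_zero k a ha
  rw [forward, affineMap_apply, shift, planeMap_apply, planeMap_apply]
  apply Complex.ext
  · simp only [Complex.add_re, Complex.sub_re]
    have : α⁻¹ * ((coord α a).re - (coord α (base (pieces' k))).re) =
        (coord α (image (pieces' k) (pieces k) a)).re - (coord α (base (pieces k))).re := by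
      rw [h₁, inv_mul_cancel_left₀ h.ne_zero]
    linarith
  · simp only [Complex.add_im, Complex.sub_im]
    linarith

theorem backward_forward (h : IsSmallRoot α) (k : Fin 8) (z : ℂ) :
    backward α k (forward α k z) = z := by
  rw [forward, backward, affineMap_apply, affineMap_apply, map_add, add_neg_cancel_right]
  exact (planeHomeomorph α h.ne_zero).left_inv z

theorem forward_backward (h : IsSmallRoot α) (k : Fin 8) (z : ℂ) :
    forward α k (backward α k z) = z := by
  rw [forward, backward, affineMap_apply, affineMap_apply, map_add, map_neg]
  have e : ∀ w, planeMap (A α) (planeMap (A α⁻¹) w) = w :=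
    (planeHomeomorph α h.ne_zero).right_inv
  rw [e, e, neg_add_cancel_right]

theorem backward_coord (h : IsSmallRoot α) (k : Fin 8) (a : ℕ) (ha : a ∈ pieces k) :
    backward α k (coord α a) = coord α (image (pieces k) (pieces' k) a) := by
  have key : ∀ k, ∀ a ∈ pieces k, image (pieces k) (pieces' k) a ∈ pieces' k ∧
      image (pieces' k) (pieces k) (image (pieces k) (pieces' k) a) = a := by decide
  obtain ⟨h₁, h₂⟩ := key k a ha
  have := h.forward_coord k _ h₁
  rw [h₂] at this
  rw [← this, h.backward_forward]

theorem map_forward (h : IsSmallRoot α) (k : Fin 8) :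
    (pieces' k).map (fun i => forward α k (coord α i)) = (pieces k).map (coord α) := by
  have key : ∀ k, (pieces' k).map (image (pieces' k) (pieces k)) = pieces k := by decide
  rw [← congrArg (List.map (coord α)) (key k), List.map_map]
  exact List.map_congr_left fun a ha => h.forward_coord k a ha

theorem forward_image (h : IsSmallRoot α) (k : Fin 8) :
    forward α k '' polygon α (pieces' k) = polygon α (pieces k) := by
  rw [forward, affineMap_image_polygonRegion h.neg, List.map_map]
  exact congrArg polygonRegion (h.map_forward k)

theorem backward_mem (h : IsSmallRoot α) (k : Fin 8) {z : ℂ} (hz : z ∈ polygon α (pieces k)) :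
    backward α k z ∈ polygon α (pieces' k) := by
  rw [← h.forward_image] at hz
  obtain ⟨w, hw, rfl⟩ := hz
  rwa [h.backward_forward]

theorem region_eq_iUnion_pieces (h : IsSmallRoot α) :
    (M α).region = ⋃ k, polygon α (pieces k) := by
  rw [h.dissects_pieces.eq_iUnion]
  have : ∀ k : Fin 8, k ∈ [0, 1, 2, 3, 4, 6, 7, (5 : Fin 8)] := by decide
  simp only [this, Set.iUnion_true]

theorem region_eq_iUnion_pieces' (h : IsSmallRoot α) :
    (M α).region = ⋃ k, polygon α (pieces' k) := by
  rw [h.dissects_pieces'.eq_iUnion]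
  have : ∀ k : Fin 8, k ∈ [2, 4, 1, 5, 0, 7, 6, (3 : Fin 8)] := by decide
  simp only [this, Set.iUnion_true]

theorem polygon_subset (h : IsSmallRoot α) (k : Fin 8) : polygon α (pieces k) ⊆ (M α).region := by
  rw [h.region_eq_iUnion_pieces]
  exact Set.subset_iUnion (fun k => polygon α (pieces k)) k

theorem polygon_subset' (h : IsSmallRoot α) (k : Fin 8) : polygon α (pieces' k) ⊆ (M α).region := by
  rw [h.region_eq_iUnion_pieces']
  exact Set.subset_iUnion (fun k => polygon α (pieces' k)) k

theorem forward_mem (h : IsSmallRoot α) (k : Fin 8) {z : ℂ} (hz : z ∈ polygon α (pieces' k)) :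
    forward α k z ∈ polygon α (pieces k) := by
  rw [← h.forward_image]
  exact ⟨z, hz, rfl⟩

theorem same_forward (h : IsSmallRoot α) {x y : ℂ} (hxy : (M α).Same x y) {k l : Fin 8}
    (hx : x ∈ polygon α (pieces' k)) (hy : y ∈ polygon α (pieces' l)) :
    (M α).Same (forward α k x) (forward α l y) :=
  same_map h.forward_coord (fun k _ hz => h.polygon_subset k (h.forward_mem k hz))
    h.dissects_pieces' (by decide) (by decide +kernel) hxy hx hy

theorem same_backward (h : IsSmallRoot α) {x y : ℂ} (hxy : (M α).Same x y) {k l : Fin 8}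
    (hx : x ∈ polygon α (pieces k)) (hy : y ∈ polygon α (pieces l)) :
    (M α).Same (backward α k x) (backward α l y) :=
  same_map h.backward_coord (fun k _ hz => h.polygon_subset' k (h.backward_mem k hz))
    h.dissects_pieces (by decide) (by decide +kernel) hxy hx hy

theorem isCompact_polygon (α : ℝ) (l : List ℕ) : IsCompact (polygon α l) :=
  (IsFiniteConvexUnion.polygonRegion _).isCompact

theorem isTranslationSurface (h : IsSmallRoot α) : (M α).IsTranslationSurface :=
  h.isSimpleSuspension.isTranslationSurface

/-- The affine homeomorphism with derivative `A`. -/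
theorem exists_affine_homeomorph (h : IsSmallRoot α) : ∃ f : (M α).Surface ≃ₜ (M α).Surface,
    ∀ k, ∀ x y : (M α).region, (x : ℂ) ∈ polygon α (pieces' k) → (y : ℂ) = forward α k x →
      f ((M α).toSurface x) = (M α).toSurface y := by
  obtain ⟨hc, -, ht, -, -⟩ := h.isTranslationSurface
  have : ∀ k, CompactSpace (polygon α (pieces' k)) := fun k =>
    isCompact_iff_compactSpace.1 (isCompact_polygon α _)
  let φ : (Σ k : Fin 8, polygon α (pieces' k)) → (M α).region :=
    fun x => ⟨x.2, h.polygon_subset' x.1 x.2.2⟩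
  let ψ : (Σ k : Fin 8, polygon α (pieces' k)) → (M α).region :=
    fun x => ⟨forward α x.1 x.2, h.polygon_subset x.1 (h.forward_mem x.1 x.2.2)⟩
  have hφ : Continuous φ := continuous_sigma fun k =>
    Continuous.subtype_mk continuous_subtype_val _
  have hψ : Continuous ψ := continuous_sigma fun k =>
    Continuous.subtype_mk ((forward α k).continuous_of_finiteDimensional.comp continuous_subtype_val) _
  have hφs : Function.Surjective φ := by
    intro x
    obtain ⟨k, hk⟩ := Set.mem_iUnion.1 (h.region_eq_iUnion_pieces'.subset x.2)
    exact ⟨⟨k, x, hk⟩, rfl⟩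
  have hψs : Function.Surjective ψ := by
    intro x
    obtain ⟨k, hk⟩ := Set.mem_iUnion.1 (h.region_eq_iUnion_pieces.subset x.2)
    exact ⟨⟨k, _, h.backward_mem k hk⟩, Subtype.ext (h.forward_backward k x)⟩
  obtain ⟨f, hf⟩ := exists_homeomorph_of_same_fibers
    (PolygonGluing.continuous_toSurface.comp hφ) (PolygonGluing.continuous_toSurface.comp hψ)
    (PolygonGluing.toSurface_surjective.comp hφs) (PolygonGluing.toSurface_surjective.comp hψs)
    (by
      rintro ⟨k, x⟩ ⟨l, y⟩
      constructor
      · intro he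
        exact (h.same_forward ⟨_, _, he⟩ x.2 y.2).2.2
      · intro he
        have := h.same_backward ⟨_, _, he⟩ (h.forward_mem k x.2) (h.forward_mem l y.2)
        rw [h.backward_forward, h.backward_forward] at this
        exact this.2.2)
  refine ⟨f, fun k x y hx hy => ?_⟩
  obtain rfl : y = ψ ⟨k, x, hx⟩ := Subtype.ext hy
  exact hf ⟨k, x, hx⟩

theorem image_vertices (h : IsSmallRoot α) {f : (M α).Surface ≃ₜ (M α).Surface}
    (hf : ∀ k, ∀ x y : (M α).region, (x : ℂ) ∈ polygon α (pieces' k) → (y : ℂ) = forward α k x →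
      f ((M α).toSurface x) = (M α).toSurface y) : f '' (M α).vertices = (M α).vertices := by
  have hfin := h.isTranslationSurface.2.2.2.1
  have hmem : ∀ i, (hi : 1 ≤ i ∧ i ≤ 18) →
      (M α).toSurface ⟨coord α i, coord_mem α hi⟩ ∈ (M α).vertices := by
    intro i hi
    rw [h.vertices_eq, (h.toSurface_coord_eq_iff hi (isFirst i)).2 rfl]
    cases isFirst i <;> simp
  have hside : IsSide pieces' 0 8 14 := by decide
  have e₁ : f (conePoint α true) = (M α).toSurface ⟨coord α 1, coord_mem α (by norm_num)⟩ := by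
    rw [← (h.toSurface_coord_eq_iff (i := 8) (by norm_num) true).2 (by decide)]
    exact hf 0 _ _ (segment_subset_polygonRegion hside (left_mem_segment _ _ _))
      (h.forward_coord 0 8 (by decide)).symm
  have e₂ : f (conePoint α false) = (M α).toSurface ⟨coord α 2, coord_mem α (by norm_num)⟩ := by
    rw [← (h.toSurface_coord_eq_iff (i := 14) (by norm_num) false).2 (by decide)]
    exact hf 0 _ _ (segment_subset_polygonRegion hside (right_mem_segment _ _ _))
      (h.forward_coord 0 14 (by decide)).symm
  refine Set.eq_of_subset_of_ncard_le ?_ (Set.ncard_image_of_injective _ f.injective).ge hfin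
  rintro _ ⟨s, hs, rfl⟩
  rw [h.vertices_eq] at hs
  rcases hs with rfl | rfl
  · rw [e₁]
    exact hmem 1 (by norm_num)
  · rw [e₂]
    exact hmem 2 (by norm_num)

theorem isAffine_of_forward (h : IsSmallRoot α) {f : (M α).Surface ≃ₜ (M α).Surface}
    (hf : ∀ k, ∀ x y : (M α).region, (x : ℂ) ∈ polygon α (pieces' k) → (y : ℂ) = forward α k x →
      f ((M α).toSurface x) = (M α).toSurface y) : PolygonGluing.IsAffine f (planeMap (A α)) := by
  refine ⟨h.image_vertices hf, fun φ ψ hφ hψ z hz hs => ?_⟩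
  have := h.isTranslationSurface.2.2.1
  refine PolygonGluing.hasFDerivAt_of_pieces (G := M α) (H := M α)
    (IsSimpleSuspension.isFiniteConvexUnion_region _ _).isCompact f _
    (fun k => polygon α (pieces' k)) (shift α) (fun k => (isCompact_polygon α _).isClosed)
    h.region_eq_iUnion_pieces' ?_ ?_ hφ hψ hz hs
  · intro k x hx
    rw [← affineMap_apply]
    exact h.polygon_subset k (h.forward_mem k hx)
  · intro k x y hx hy
    rw [← affineMap_apply] at hy
    exact hf k x y hx hy

theorem isAffinePseudoAnosov (h : IsSmallRoot α) {f : (M α).Surface ≃ₜ (M α).Surface}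
    (hf : PolygonGluing.IsAffine f (planeMap (A α))) : IsAffinePseudoAnosov f (A α) |α| := by
  have h1 := h.lt
  have h0 := h.neg
  refine ⟨?_, hf, ?_, α, ?_, ?_, rfl⟩
  · simp [A, Matrix.det_fin_two, h.ne_zero]
  · have e : (A α).trace = α⁻¹ + α := by simp [A, Matrix.trace_fin_two]
    have : α⁻¹ + α + 2 < 0 := by
      have e' : α⁻¹ + α + 2 = (α + 1) ^ 2 / α := by
        have := h.ne_zero
        field_simp
        ring
      rw [e']
      exact div_neg_of_pos_of_neg (by nlinarith) h0
    rw [e, abs_of_neg (by linarith)]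
    linarith
  · refine Module.End.hasEigenvalue_of_hasEigenvector (x := ![0, 1])
      ⟨Module.End.mem_eigenspace_iff.2 ?_, ?_⟩
    · ext i
      fin_cases i <;> simp [A]
    · intro he
      have := congrFun he 1
      simp at this
  · rw [abs_of_neg h0]
    linarith

/-! ### The isometry between `M'` and `M` -/

theorem polygon_q (h : IsSmallRoot α) (k : Fin 8) :
    polygonRegion ((pieces' k).map (q α)) = planeMap (A α) '' polygon α (pieces' k) := by
  have e : ⇑(affineMap α 0) = planeMap (A α) := by
    funext z
    rw [affineMap_apply, add_zero]
  rw [← e, affineMap_image_polygonRegion h.neg, List.map_map, e]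
  refine congrArg polygonRegion (List.map_congr_left fun i hi => ?_)
  rw [q, (piecewise_p_eq_coord α).1 k i hi]
  rfl

theorem polygon_p (α : ℝ) (k : Fin 8) :
    polygonRegion ((pieces k).map (p α)) = polygon α (pieces k) :=
  congrArg polygonRegion (List.map_congr_left fun i hi => (piecewise_p_eq_coord α).2 k i hi)

theorem map_q_add_shift (h : IsSmallRoot α) (k : Fin 8) :
    (pieces' k).map (fun i => q α i + shift α k) = (pieces k).map (p α) := by
  rw [List.map_congr_left fun i hi => (piecewise_p_eq_coord α).2 k i hi, ← h.map_forward]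
  refine List.map_congr_left fun i hi => ?_
  rw [q, (piecewise_p_eq_coord α).1 k i hi, forward, affineMap_apply]

theorem exists_isometry (h : IsSmallRoot α) :
    ∃ g : (M' α).Surface ≃ₜ (M α).Surface,
      (∀ x y, (M α).flatDist (g x) (g y) = (M' α).flatDist x y) ∧
      PolygonGluing.IsAffine g (ContinuousLinearMap.id ℝ ℂ) ∧
      PolygonGluing.IsCutAndPaste g (fun k => polygonRegion ((pieces' k).map (q α)))
        (fun k => polygonRegion ((pieces k).map (p α))) (shift α) := by
  obtain ⟨f, hf⟩ := h.exists_affine_homeomorph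
  have he : ⇑(planeHomeomorph α h.ne_zero) = planeMap (A α) := rfl
  let i : (M α).Surface ≃ₜ (M' α).Surface := (M α).mapHomeomorph _ he
  let g : (M' α).Surface ≃ₜ (M α).Surface := i.symm.trans f
  have hcov' : (M' α).region = ⋃ k, polygonRegion ((pieces' k).map (q α)) := by
    change planeMap (A α) '' (M α).region = _
    rw [h.region_eq_iUnion_pieces', Set.image_iUnion]
    exact Set.iUnion_congr fun k => (h.polygon_q k).symm
  have hcov : (M α).region = ⋃ k, polygonRegion ((pieces k).map (p α)) := by
    rw [h.region_eq_iUnion_pieces]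
    exact Set.iUnion_congr fun k => (polygon_p α k).symm
  have himage : ∀ k, (fun z => z + shift α k) '' polygonRegion ((pieces' k).map (q α)) =
      polygonRegion ((pieces k).map (p α)) := by
    intro k
    rw [h.polygon_q, polygon_p, ← h.forward_image, Set.image_image]
    exact Set.image_congr fun z _ => (affineMap_apply _ _ _).symm
  have hg : ∀ k, ∀ x : (M' α).region, ∀ y : (M α).region,
      (x : ℂ) ∈ polygonRegion ((pieces' k).map (q α)) → (y : ℂ) = x + shift α k →
      g ((M' α).toSurface x) = (M α).toSurface y := by
    intro k x y hx hy
    obtain ⟨w, rfl⟩ := ((M α).regionHomeomorph _ he).surjective x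
    rw [PolygonGluing.regionHomeomorph_apply] at hx hy
    rw [h.polygon_q, ← he, (planeHomeomorph α h.ne_zero).injective.mem_set_image] at hx
    have : i.symm ((M' α).toSurface ((M α).regionHomeomorph _ he w)) = (M α).toSurface w :=
      i.symm_apply_eq.2 rfl
    change f (i.symm _) = _
    rw [this]
    rw [← affineMap_apply] at hy
    exact hf k w y hx hy
  have hmem : ∀ k, ∀ x ∈ polygonRegion ((pieces' k).map (q α)), x + shift α k ∈ (M α).region := by
    intro k x hx
    rw [hcov]
    exact Set.mem_iUnion.2 ⟨k, by rw [← himage]; exact ⟨x, hx, rfl⟩⟩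
  have ht : T2Space (M' α).Surface := by
    have := h.isTranslationSurface.2.2.1
    exact i.t2Space
  have hcompact : IsCompact (M' α).region := by
    rw [hcov']
    exact isCompact_iUnion fun k => (IsFiniteConvexUnion.polygonRegion _).isCompact
  refine ⟨g, fun x y => le_antisymm ?_ ?_, ⟨?_, fun φ ψ hφ hψ z hz hs => ?_⟩,
    hcov', hcov, ?_, ?_, himage, hg⟩
  · exact PolygonGluing.flatDist_map_le g _ (shift α)
      (fun k => IsFiniteConvexUnion.polygonRegion _) hcov' hmem hg x y
  · have hback : ∀ k, ∀ x ∈ polygonRegion ((pieces k).map (p α)),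
        x + -shift α k ∈ polygonRegion ((pieces' k).map (q α)) := by
      intro k x hx
      rw [← himage] at hx
      obtain ⟨w, hw, rfl⟩ := hx
      simpa using hw
    have := PolygonGluing.flatDist_map_le g.symm
      (fun k => polygonRegion ((pieces k).map (p α))) (fun k => -shift α k)
      (fun k => IsFiniteConvexUnion.polygonRegion _) hcov (fun k x hx => by
        rw [hcov']
        exact Set.mem_iUnion.2 ⟨k, hback k x hx⟩)
      (fun k x y hx hy => by
        rw [Homeomorph.symm_apply_eq]
        refine (hg k y x ?_ ?_).symm
        · rw [hy]
          exact hback k x hx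
        · rw [hy, neg_add_cancel_right]) (g x) (g y)
    simpa only [Homeomorph.symm_apply_apply] using this
  · change (fun s => f (i.symm s)) '' (M' α).vertices = (M α).vertices
    have : (M' α).vertices = i '' (M α).vertices :=
      (PolygonGluing.mapHomeomorph_image_vertices _ he).symm
    rw [this, Set.image_image]
    simp only [Homeomorph.symm_apply_apply]
    exact h.image_vertices hf
  · exact PolygonGluing.hasFDerivAt_of_pieces hcompact g _ _ (shift α)
      (fun k => (IsFiniteConvexUnion.polygonRegion _).isCompact.isClosed) hcov' hmem hg hφ hψ hz hs
  · intro k l hkl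
    have hall : ∀ k : Fin 8, k ∈ [2, 4, 1, 5, 0, 7, 6, (3 : Fin 8)] := by decide
    have : Disjoint (interior (polygon α (pieces' k))) (interior (polygon α (pieces' l))) :=
      h.dissects_pieces'.disjoint_interior k (hall k) l (hall l) hkl
    change Disjoint (interior (polygonRegion ((pieces' k).map (q α))))
      (interior (polygonRegion ((pieces' l).map (q α))))
    rw [h.polygon_q, h.polygon_q, ← he, ← Homeomorph.image_interior, ← Homeomorph.image_interior]
    exact (Set.disjoint_image_iff (planeHomeomorph α h.ne_zero).injective).2 this
  · intro k l hkl
    have hall : ∀ k : Fin 8, k ∈ [0, 1, 2, 3, 4, 6, 7, (5 : Fin 8)] := by decide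
    change Disjoint (interior (polygonRegion ((pieces k).map (p α))))
      (interior (polygonRegion ((pieces l).map (p α))))
    rw [polygon_p, polygon_p]
    exact h.dissects_pieces.disjoint_interior k (hall k) l (hall l) hkl

end IsSmallRoot

end GenusFour

end

theorem mainTheorem9 :
    (∃! α : ℝ, α < -1 ∧ GenusFour.poly.IsRoot (-α)) ∧
    ∀ α : ℝ, α < -1 → GenusFour.poly.IsRoot (-α) →
      -- `|α| = 1.28064…` is the largest real root of `X⁸ - X⁵ - X⁴ - X³ + 1`
      (IsGreatest {x : ℝ | GenusFour.poly.IsRoot x} |α| ∧ |(|α| - 1.28064)| < 0.000005) ∧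
      -- the data `(π, ζ)`, `ζ = (λ, τ)`, come from a closed Rauzy path: `λ` and `τ` are eigenvectors
      -- of its matrix for the Perron eigenvalue `α⁴` and for its inverse
      (IsClosedRauzyPath GenusFour.perm GenusFour.path GenusFour.R ∧
        (GenusFour.R.map (Int.cast : ℤ → ℝ)).mulVec (GenusFour.lam α) = α ^ 4 • GenusFour.lam α ∧
        (GenusFour.R.map (Int.cast : ℤ → ℝ)).mulVec (GenusFour.tau α) =
          (α ^ 4)⁻¹ • GenusFour.tau α ∧
        (∀ μ : ℂ, (GenusFour.R.map (Int.cast : ℤ → ℂ)).charpoly.IsRoot μ → ‖μ‖ ≤ α ^ 4) ∧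
        IsSuspensionDatum GenusFour.perm (GenusFour.zeta α) (GenusFour.lam α)) ∧
      -- `M(π, ζ)` is a translation surface of genus `4`, with two conical points of angles `4π`, `12π`
      ((GenusFour.M α).IsTranslationSurface ∧ (GenusFour.M α).HasGenus 4 ∧
        ∃ s₁ s₂ : (GenusFour.M α).Surface, s₁ ≠ s₂ ∧ (GenusFour.M α).vertices = {s₁, s₂} ∧
          suspensionConeAngle GenusFour.perm (GenusFour.zeta α) s₁ = 4 * Real.pi ∧
          suspensionConeAngle GenusFour.perm (GenusFour.zeta α) s₂ = 12 * Real.pi) ∧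
      -- `M' = A M` and `M` are isometric, as translation surfaces, by cut-and-paste into 8 pieces
      (∃ h : (GenusFour.M' α).Surface ≃ₜ (GenusFour.M α).Surface,
        (∀ x y, (GenusFour.M α).flatDist (h x) (h y) = (GenusFour.M' α).flatDist x y) ∧
        PolygonGluing.IsAffine h (ContinuousLinearMap.id ℝ ℂ) ∧
        ∃ d : Fin 8 → ℂ,
          (∀ k, (GenusFour.pieces' k).map (fun i => GenusFour.q α i + d k) =
            (GenusFour.pieces k).map (GenusFour.p α)) ∧
          PolygonGluing.IsCutAndPaste h
            (fun k => polygonRegion ((GenusFour.pieces' k).map (GenusFour.q α)))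
            (fun k => polygonRegion ((GenusFour.pieces k).map (GenusFour.p α))) d) ∧
      -- the affine pseudo-Anosov map with derivative `A` and dilatation `|α|`
      ∃ f : (GenusFour.M α).Surface ≃ₜ (GenusFour.M α).Surface,
        IsAffinePseudoAnosov f (GenusFour.A α) |α| := by
  refine ⟨GenusFour.existsUnique_root, fun α h₁ h₂ => ?_⟩
  have h : GenusFour.IsSmallRoot α := ⟨h₁, h₂⟩
  refine ⟨⟨GenusFour.isGreatest_abs h₁ h₂, ?_⟩,
    ⟨GenusFour.isClosedRauzyPath, GenusFour.mulVec_lam h.eq_zero, GenusFour.mulVec_tau h.eq_zero,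
      h.norm_le, h.isSuspensionDatum⟩,
    ⟨h.isTranslationSurface, h.hasGenus, _, _, h.conePoint_ne, h.vertices_eq,
      h.coneAngle_eq true, h.coneAngle_eq false⟩, ?_, ?_⟩
  · rw [abs_of_neg h.neg, abs_lt]
    constructor <;> norm_num <;> linarith [h.bounds.1, h.bounds.2]
  · obtain ⟨g, h₁, h₂, h₃⟩ := h.exists_isometry
    exact ⟨g, h₁, h₂, _, h.map_q_add_shift, h₃⟩
  · obtain ⟨f, hf⟩ := h.exists_affine_homeomorph
    exact ⟨f, h.isAffinePseudoAnosov (h.isAffine_of_forward hf)⟩
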